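/- **Language.** Let $\mathcal L$ be the first-order language of arithmetic with relation symbols $=,<$ and a function constant for each (Kalmár) elementary recursive function. A *positive operator* is an $\mathcal L\cup\{X\}$-formula $\varphi(X,x)$ with the only free number variable $x$ in which the unary predicate variable $X$ occurs only positively. An *$\mathsf{Acc}$-operator* is a positive operator of the form $\forall y(\theta_0(x,y)\to t_0(x,y)\in X)$ with $\theta_0$ a bounded $\mathcal L$-formula and $t_0$ a term. For a set $\Phi$ of positive operators, $\mathcal L(\Phi)$ is $\mathcal L$ together with a unary predicate constant $R_\varphi$ for each $\varphi\in\Phi$. **Formula classes.** An $\mathcal L(\Phi)$-formula is *positive* (*negative*) if the constants $R_\varphi$ occur in it only positively (only negatively). $\mathrm P\cup\mathrm N$ is the class of formulas that are positive or negative; $\mathrm P\wedge\mathrm N$ is the class of conjunctions $C\wedge D$ with $C$ positive and $D$ negative. $\Pi^0_0(\mathrm P)=\Sigma^0_0(\mathrm P)$ is the class of formulas obtained from positive formulas by $\neg,\vee,\wedge$ and bounded quantifiers. The classes $\Pi^0_k(\mathrm P),\Sigma^0_k(\mathrm P)$, $k\ge 0$, are the least ones extending these such that $\Pi^0_k(\mathrm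 P)\cup\Sigma^0_k(\mathrm P)\subset\Pi^0_{k+1}(\mathrm P)\cap\Sigma^0_{k+1}(\mathrm P)$; all of them are closed under $\vee,\wedge$ and bounded quantifiers; negations of $\Pi^0_k(\mathrm P)$-formulas are in $\Sigma^0_k(\mathrm P)$ and vice versa; and for $k\ge1$, $\Pi^0_k(\mathrm P)$ is closed under $\forall x$ and $\Sigma^0_k(\mathrm P)$ under $\exists x$. **Theories.** For classes $\Theta,\Gamma$ of $\mathcal L(\Phi)$-formulas, $Th(\mathbb N)+(\Theta,\Gamma)\text{-ID}(\Phi)$ is the theory in classical first-order logic with equality whose axioms are all true $\mathcal L$-sentences (these include the axioms of elementary arithmetic) and the universal closures of - $\theta(0)\wedge\forall x(\theta(x)\to\theta(x+1))\to\forall y\,\theta(y)$ for $\theta\in\Theta$, - $\forall x[\varphi(R_\varphi,x)\to R_\varphi(x)]$ for $\varphi\in\Phi$, - $\forall u[R_\varphi(u)\to\forall x(\varphi(\sigma,x)\to\sigma(x))\to\sigma(u)]$ for $\varphi\in\Phi$ and $\sigma\in\Gamma$, where $\theta,\sigma$ may contain further free variables as parameters. $(\Theta,\Gamma)\text{-ID}$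 stands for $(\Theta,\Gamma)\text{-ID}(\Phi)$ with $\Phi$ the set of all positive operators, and $\Gamma\text{-ID}(\Phi)$ for $(\Gamma,\Gamma)\text{-ID}(\Phi)$. **Norms.** For a positive operator $\varphi$ let $I_\varphi$ be the least fixed point of $\mathcal X\mapsto\{n\in\mathbb N:\mathbb N\models\varphi[\mathcal X,n]\}$ and let $I_\varphi^{\alpha}$ be its stages: $I^0_\varphi=\emptyset$, $I_\varphi^{\alpha+1}=\{n:\mathbb N\models\varphi[I^\alpha_\varphi,n]\}$, and unions at limits. For $n\in I_\varphi$ let $|n|_\varphi=\min\{\alpha:n\in I_\varphi^{\alpha+1}\}$. **Ordinals.** Let $\Omega=\omega_1$ be the least uncountable ordinal. In the rest of this statement, however, $\omega_n$ for $n<\omega$ denotes the tower $\omega_0=1$, $\omega_{n+1}=\omega^{\omega_n}$. For $\alpha<\varepsilon_{\Omega+1}$ define by recursion $\vartheta(\alpha)=\min\{\rho<\Omega: C(\alpha,\rho)\cap\Omega\subseteq\rho\ \wedge\ \alpha\in C(\alpha,\rho)\}$, where $C(\alpha,\rho)$ is the closure of $\rho\cup\{0,\Omega\}$ under $+$, $\xi\mapsto\omega^\xi$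 and $\vartheta{\restriction}\alpha$. **Theorem.** Let $n\in\mathbb N$, and write $R_\varphi(n)$ for $R_\varphi$ applied to the numeral of $n$. 1. For each $k\ge0$ and each positive operator $\varphi$: if $Th(\mathbb N)+(\Pi^0_k(\mathrm P),\mathrm P\cup\mathrm N)\text{-ID}\vdash R_\varphi(n)$, then $n\in I_\varphi$ and $|n|_\varphi<\vartheta(\Omega\cdot\omega_{1+k})$. 2. For each $k\ge0$ and each $\mathsf{Acc}$-operator $\varphi$: if $Th(\mathbb N)+(\Pi^0_k(\mathrm P),\mathrm P\wedge\mathrm N)\text{-ID}(\mathsf{Acc})\vdash R_\varphi(n)$, then $n\in I_\varphi$ and $|n|_\varphi<\vartheta(\Omega\cdot\omega_{1+k})$. 3. For each $\mathsf{Acc}$-operator $\varphi$: if $Th(\mathbb N)+\Pi^0_1(\mathrm P)\text{-ID}(\mathsf{Acc})\vdash R_\varphi(n)$, then $n\in I_\varphi$ and $|n|_\varphi<\vartheta(\Omega^\omega)$. -/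

import Mathlib

namespace WeakID

/-! ### The arithmetical language -/

/-- Kalmár elementary recursive functions: the least class of number-theoretic functions that
contains zero, successor, the projections, addition and truncated subtraction and is closed under
composition, bounded sums and bounded products. -/
inductive Elementary : {k : ℕ} → ((Fin k → ℕ) → ℕ) → Prop
  | zero : Elementary (fun _ : Fin 0 → ℕ => 0)
  | succ : Elementary (fun v : Fin 1 → ℕ => v 0 + 1)
  | proj {k : ℕ} (i : Fin k) : Elementary (fun v => v i)
  | add : Elementary (fun v : Fin 2 → ℕ => v 0 + v 1)
  | tsub : Elementary (fun v : Fin 2 → ℕ => v 0 - v 1)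
  | comp {m k : ℕ} {f : (Fin m → ℕ) → ℕ} {g : Fin m → (Fin k → ℕ) → ℕ} :
      Elementary f → (∀ i, Elementary (g i)) → Elementary (fun v => f (fun i => g i v))
  | bsum {k : ℕ} {f : (Fin (k + 1) → ℕ) → ℕ} : Elementary f →
      Elementary (fun v : Fin (k + 1) → ℕ =>
        ∑ i ∈ Finset.range (v 0), f (Fin.cons i (Fin.tail v)))
  | bprod {k : ℕ} {f : (Fin (k + 1) → ℕ) → ℕ} : Elementary f →
      Elementary (fun v : Fin (k + 1) → ℕ =>
        ∏ i ∈ Finset.range (v 0), f (Fin.cons i (Fin.tail v)))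

/-- The function constants of arity `k`: one for each `k`-ary elementary recursive function. -/
def ElemFun (k : ℕ) : Type := {f : (Fin k → ℕ) → ℕ // Elementary f}

/-- Terms whose variables are among `0, …, n - 1` (de Bruijn indices). -/
inductive Term (n : ℕ) : Type
  | var (i : Fin n) : Term n
  | app {k : ℕ} (f : ElemFun k) (ts : Fin k → Term n) : Term n

namespace Term

/-- Simultaneous substitution. -/
def subst {n m : ℕ} (e : Fin n → Term m) : Term n → Term m
  | var i => e i
  | app f ts => app f (fun i => (ts i).subst e)

/-- Weakening by a new variable `0`. -/
def shift {n : ℕ} (t : Term n) : Term (n + 1) := t.subst (fun i => var i.succ)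

/-- The value of a term in the standard model. -/
def val {n : ℕ} (v : Fin n → ℕ) : Term n → ℕ
  | var i => v i
  | app f ts => f.1 (fun i => (ts i).val v)

/-- The constant `0`. -/
def zero {n : ℕ} : Term n := app (k := 0) ⟨_, Elementary.zero⟩ Fin.elim0

/-- The successor `t + 1`. -/
def succ {n : ℕ} (t : Term n) : Term n := app (k := 1) ⟨_, Elementary.succ⟩ (fun _ => t)

/-- The numeral of a natural number. -/
def numeral {n : ℕ} : ℕ → Term n
  | 0 => zero
  | m + 1 => succ (numeral m)

/-- Extension of a substitution under a quantifier. -/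
def up {n m : ℕ} (e : Fin n → Term m) : Fin (n + 1) → Term (m + 1) :=
  Fin.cons (var 0) (fun i => (e i).shift)

end Term

/-! ### Formulas -/

/-- First-order formulas in negation normal form over the arithmetical language with additional
unary predicate symbols from `P`; the free variables are among `0, …, n - 1`. For each predicate
symbol its complement is available. Under a quantifier the bound variable is variable `0`. -/
inductive Fml (P : Type) : ℕ → Type
  | eq {n : ℕ} (t s : Term n) : Fml P n
  | neq {n : ℕ} (t s : Term n) : Fml P n
  | lt {n : ℕ} (t s : Term n) : Fml P n
  | nlt {n : ℕ} (t s : Term n) : Fml P n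
  | pos {n : ℕ} (p : P) (t : Term n) : Fml P n
  | neg {n : ℕ} (p : P) (t : Term n) : Fml P n
  | and {n : ℕ} (A B : Fml P n) : Fml P n
  | or {n : ℕ} (A B : Fml P n) : Fml P n
  | all {n : ℕ} (A : Fml P (n + 1)) : Fml P n
  | ex {n : ℕ} (A : Fml P (n + 1)) : Fml P n

namespace Fml

variable {P Q : Type}

/-- Negation, by de Morgan's laws. -/
def not : {n : ℕ} → Fml P n → Fml P n
  | _, eq t s => neq t s
  | _, neq t s => eq t s
  | _, lt t s => nlt t s
  | _, nlt t s => lt t s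
  | _, pos p t => neg p t
  | _, neg p t => pos p t
  | _, and A B => or A.not B.not
  | _, or A B => and A.not B.not
  | _, all A => ex A.not
  | _, ex A => all A.not

/-- Implication. -/
def imp {n : ℕ} (A B : Fml P n) : Fml P n := or A.not B

/-- Atomic formulas and their complements. -/
def IsLiteral : {n : ℕ} → Fml P n → Prop
  | _, and _ _ => False
  | _, or _ _ => False
  | _, all _ => False
  | _, ex _ => False
  | _, _ => True

/-- Simultaneous substitution of terms for the free variables. -/
def subst : {n m : ℕ} → (Fin n → Term m) → Fml P n → Fml P m
  | _, _, e, eq t s => eq (t.subst e) (s.subst e)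
  | _, _, e, neq t s => neq (t.subst e) (s.subst e)
  | _, _, e, lt t s => lt (t.subst e) (s.subst e)
  | _, _, e, nlt t s => nlt (t.subst e) (s.subst e)
  | _, _, e, pos p t => pos p (t.subst e)
  | _, _, e, neg p t => neg p (t.subst e)
  | _, _, e, and A B => and (A.subst e) (B.subst e)
  | _, _, e, or A B => or (A.subst e) (B.subst e)
  | _, _, e, all A => all (A.subst (Term.up e))
  | _, _, e, ex A => ex (A.subst (Term.up e))

/-- Weakening by a new variable `0`. -/
def shift {n : ℕ} (A : Fml P n) : Fml P (n + 1) := A.subst (fun i => Term.var i.succ)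

/-- `A(t)`: the term `t` is substituted for variable `0`. -/
def inst {n : ℕ} (A : Fml P (n + 1)) (t : Term n) : Fml P n := A.subst (Fin.cons t Term.var)

/-- For `σ(x)` with `x` the variable `0`: a new parameter is inserted right after `x`. -/
def shiftParam {n : ℕ} (A : Fml P (n + 1)) : Fml P (n + 2) :=
  A.subst (Fin.cons (Term.var 0) (fun i => Term.var i.succ.succ))

/-- A sentence regarded as a formula in the context of `n` variables. -/
def ofSentence {n : ℕ} (A : Fml P 0) : Fml P n := A.subst Fin.elim0

/-- Universal closure. -/
def closure : {n : ℕ} → Fml P n → Fml P 0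
  | 0, A => A
  | _ + 1, A => closure (all A)

/-- Renaming of predicate symbols. -/
def mapPred (f : P → Q) : {n : ℕ} → Fml P n → Fml Q n
  | _, eq t s => eq t s
  | _, neq t s => neq t s
  | _, lt t s => lt t s
  | _, nlt t s => nlt t s
  | _, pos p t => pos (f p) t
  | _, neg p t => neg (f p) t
  | _, and A B => and (A.mapPred f) (B.mapPred f)
  | _, or A B => or (A.mapPred f) (B.mapPred f)
  | _, all A => all (A.mapPred f)
  | _, ex A => ex (A.mapPred f)

/-- An arithmetical formula (no additional predicate symbol) in a larger language. -/
def ofArith {n : ℕ} (A : Fml Empty n) : Fml P n := A.mapPred Empty.elim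

/-- For a formula `φ(X)` with one predicate variable `X`, a formula `σ(x)` (with `x` the variable
`0`) and terms `e` for the free variables of `φ`: the formula `φ(σ)[e]`. -/
def substPred : {n m : ℕ} → Fml Unit n → (Fin n → Term m) → Fml P (m + 1) → Fml P m
  | _, _, eq t s, e, _ => eq (t.subst e) (s.subst e)
  | _, _, neq t s, e, _ => neq (t.subst e) (s.subst e)
  | _, _, lt t s, e, _ => lt (t.subst e) (s.subst e)
  | _, _, nlt t s, e, _ => nlt (t.subst e) (s.subst e)
  | _, _, pos _ t, e, σ => σ.inst (t.subst e)
  | _, _, neg _ t, e, σ => (σ.inst (t.subst e)).not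
  | _, _, and A B, e, σ => and (A.substPred e σ) (B.substPred e σ)
  | _, _, or A B, e, σ => or (A.substPred e σ) (B.substPred e σ)
  | _, _, all A, e, σ => all (A.substPred (Term.up e) σ.shiftParam)
  | _, _, ex A, e, σ => ex (A.substPred (Term.up e) σ.shiftParam)

/-- The bounded quantifier `∀ x < t, A`. -/
def ball {n : ℕ} (t : Term n) (A : Fml P (n + 1)) : Fml P n :=
  all (or (nlt (Term.var 0) t.shift) A)

/-- The bounded quantifier `∃ x < t, A`. -/
def bex {n : ℕ} (t : Term n) (A : Fml P (n + 1)) : Fml P n :=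
  ex (and (lt (Term.var 0) t.shift) A)

/-- Every additional predicate symbol occurs only positively. -/
def Positive : {n : ℕ} → Fml P n → Prop
  | _, neg _ _ => False
  | _, and A B => A.Positive ∧ B.Positive
  | _, or A B => A.Positive ∧ B.Positive
  | _, all A => A.Positive
  | _, ex A => A.Positive
  | _, _ => True

/-- Every additional predicate symbol occurs only negatively. -/
def Negative : {n : ℕ} → Fml P n → Prop
  | _, pos _ _ => False
  | _, and A B => A.Negative ∧ B.Negative
  | _, or A B => A.Negative ∧ B.Negative
  | _, all A => A.Negative
  | _, ex A => A.Negative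
  | _, _ => True

/-- Satisfaction over the natural numbers, for an interpretation `I` of the additional predicate
symbols and an assignment `v`. -/
def Sat (I : P → Set ℕ) : {n : ℕ} → Fml P n → (Fin n → ℕ) → Prop
  | _, eq t s, v => t.val v = s.val v
  | _, neq t s, v => t.val v ≠ s.val v
  | _, lt t s, v => t.val v < s.val v
  | _, nlt t s, v => ¬ t.val v < s.val v
  | _, pos p t, v => t.val v ∈ I p
  | _, neg p t, v => t.val v ∉ I p
  | _, and A B, v => A.Sat I v ∧ B.Sat I v
  | _, or A B, v => A.Sat I v ∨ B.Sat I v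
  | _, all A, v => ∀ x : ℕ, A.Sat I (Fin.cons x v)
  | _, ex A, v => ∃ x : ℕ, A.Sat I (Fin.cons x v)

theorem Positive.sat_mono {I J : P → Set ℕ} (h : ∀ p, I p ⊆ J p) :
    ∀ {n : ℕ} (A : Fml P n), A.Positive → ∀ v, A.Sat I v → A.Sat J v
  | _, eq _ _, _, _, hv => hv
  | _, neq _ _, _, _, hv => hv
  | _, lt _ _, _, _, hv => hv
  | _, nlt _ _, _, _, hv => hv
  | _, pos p _, _, _, hv => h p hv
  | _, neg _ _, hA, _, _ => hA.elim
  | _, and A B, hA, v, hv => ⟨sat_mono h A hA.1 v hv.1, sat_mono h B hA.2 v hv.2⟩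
  | _, or A B, hA, v, hv => hv.imp (sat_mono h A hA.1 v) (sat_mono h B hA.2 v)
  | _, all A, hA, _, hv => fun x => sat_mono h A hA _ (hv x)
  | _, ex A, hA, _, hv => hv.imp fun _ hx => sat_mono h A hA _ hx

/-- Bounded formulas: built from literals by `∧`, `∨` and bounded quantifiers. -/
inductive IsBounded : {n : ℕ} → Fml P n → Prop
  | literal {n : ℕ} {A : Fml P n} : A.IsLiteral → IsBounded A
  | and {n : ℕ} {A B : Fml P n} : IsBounded A → IsBounded B → IsBounded (A.and B)
  | or {n : ℕ} {A B : Fml P n} : IsBounded A → IsBounded B → IsBounded (A.or B)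
  | ball {n : ℕ} (t : Term n) {A : Fml P (n + 1)} : IsBounded A → IsBounded (ball t A)
  | bex {n : ℕ} (t : Term n) {A : Fml P (n + 1)} : IsBounded A → IsBounded (bex t A)

end Fml

/-! ### The classes `Π⁰ₖ(P)` and `Σ⁰ₖ(P)` -/

/-- The two sides of the hierarchy. -/
inductive Side : Type
  | pi : Side
  | sigma : Side

/-- The opposite side. -/
def Side.dual : Side → Side
  | pi => sigma
  | sigma => pi

/-- `Hier .pi k A` says `A ∈ Π⁰ₖ(P)` and `Hier .sigma k A` says `A ∈ Σ⁰ₖ(P)`: at level `0` the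
formulas obtained from positive formulas by `¬, ∧, ∨` and bounded quantifiers (unbounded
quantifiers may occur inside the positive formulas); unbounded quantifiers are added from level
`1` on. -/
inductive Hier {P : Type} : Side → ℕ → {n : ℕ} → Fml P n → Prop
  | positive (s : Side) {n : ℕ} {A : Fml P n} : A.Positive → Hier s 0 A
  | step (s s' : Side) {k n : ℕ} {A : Fml P n} : Hier s k A → Hier s' (k + 1) A
  | not {s : Side} {k n : ℕ} {A : Fml P n} : Hier s k A → Hier s.dual k A.not
  | and {s : Side} {k n : ℕ} {A B : Fml P n} : Hier s k A → Hier s k B → Hier s k (A.and B)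
  | or {s : Side} {k n : ℕ} {A B : Fml P n} : Hier s k A → Hier s k B → Hier s k (A.or B)
  | ball {s : Side} {k n : ℕ} (t : Term n) {A : Fml P (n + 1)} :
      Hier s k A → Hier s k (Fml.ball t A)
  | bex {s : Side} {k n : ℕ} (t : Term n) {A : Fml P (n + 1)} :
      Hier s k A → Hier s k (Fml.bex t A)
  | all {k n : ℕ} {A : Fml P (n + 1)} : Hier .pi (k + 1) A → Hier .pi (k + 1) A.all
  | ex {k n : ℕ} {A : Fml P (n + 1)} : Hier .sigma (k + 1) A → Hier .sigma (k + 1) A.ex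

/-! ### Provability in first-order logic with equality -/

/-- One-sided sequent calculus for classical first-order logic with equality and with the
sentences of `T` as axioms. A sequent is a finite list of formulas in a context of `n` variables,
read disjunctively. -/
inductive Derivable {P : Type} (T : Set (Fml P 0)) : {n : ℕ} → List (Fml P n) → Prop
  | literal {n : ℕ} {Γ : List (Fml P n)} (L : Fml P n) :
      L.IsLiteral → L ∈ Γ → L.not ∈ Γ → Derivable T Γ
  | refl {n : ℕ} {Γ : List (Fml P n)} (t : Term n) : Fml.eq t t ∈ Γ → Derivable T Γ
  | eqSubst {n : ℕ} {Γ : List (Fml P n)} (L : Fml P (n + 1)) (t s : Term n) : L.IsLiteral →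
      Fml.neq t s ∈ Γ → (L.inst t).not ∈ Γ → L.inst s ∈ Γ → Derivable T Γ
  | ax {n : ℕ} {Γ : List (Fml P n)} (A : Fml P 0) : A ∈ T → A.ofSentence ∈ Γ → Derivable T Γ
  | and {n : ℕ} {Γ : List (Fml P n)} (A B : Fml P n) : A.and B ∈ Γ →
      Derivable T (A :: Γ) → Derivable T (B :: Γ) → Derivable T Γ
  | orLeft {n : ℕ} {Γ : List (Fml P n)} (A B : Fml P n) : A.or B ∈ Γ →
      Derivable T (A :: Γ) → Derivable T Γ
  | orRight {n : ℕ} {Γ : List (Fml P n)} (A B : Fml P n) : A.or B ∈ Γ →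
      Derivable T (B :: Γ) → Derivable T Γ
  | all {n : ℕ} {Γ : List (Fml P n)} (A : Fml P (n + 1)) : A.all ∈ Γ →
      Derivable T (A :: Γ.map Fml.shift) → Derivable T Γ
  | ex {n : ℕ} {Γ : List (Fml P n)} (A : Fml P (n + 1)) (t : Term n) : A.ex ∈ Γ →
      Derivable T (A.inst t :: Γ) → Derivable T Γ
  | cut {n : ℕ} {Γ : List (Fml P n)} (C : Fml P n) :
      Derivable T (C :: Γ) → Derivable T (C.not :: Γ) → Derivable T Γ

/-- `T ⊢ A`. -/
def Provable {P : Type} (T : Set (Fml P 0)) (A : Fml P 0) : Prop := Derivable T [A]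

/-! ### Positive operators -/

/-- Positive operators `φ(X, x)`: arithmetical formulas in the predicate variable `X` and the
number variable `x` in which `X` occurs only positively. -/
def PosOp : Type := {φ : Fml Unit 1 // φ.Positive}

/-- The monotone operator `S ↦ {n | ℕ ⊨ φ[S, n]}`. -/
def PosOp.toHom (φ : PosOp) : Set ℕ →o Set ℕ where
  toFun S := {n | φ.1.Sat (fun _ => S) (fun _ => n)}
  monotone' _ _ h _ hn := Fml.Positive.sat_mono (fun _ => h) φ.1 φ.2 _ hn

/-- The least fixed point of a positive operator. -/
def PosOp.fix (φ : PosOp) : Set ℕ := φ.toHom.lfp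

/-- The stages of the inductive definition: `I⁰ = ∅`, `I^{α+1} = φ(I^α)`, with unions at limits. -/
noncomputable def PosOp.stage (φ : PosOp) (α : Ordinal.{0}) : Set ℕ :=
  OrdinalApprox.lfpApprox φ.toHom ⊥ α

/-- The inductive norm `min {α | n ∈ I^{α+1}}`, meaningful for `n` in the least fixed point. -/
noncomputable def PosOp.norm (φ : PosOp) (n : ℕ) : Ordinal.{0} :=
  sInf {α | n ∈ φ.stage (α + 1)}

/-- Operators of the form `∀ y (θ₀(x, y) → t₀(x, y) ∈ X)` with `θ₀` an arithmetical bounded formula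
and `t₀` a term; below the quantifier `y` is variable `0` and `x` is variable `1`. -/
def accOps : Set PosOp :=
  {φ | ∃ (θ₀ : Fml Empty 2) (t₀ : Term 2), θ₀.IsBounded ∧
    φ.1 = Fml.all (Fml.imp θ₀.ofArith (Fml.pos () t₀))}

/-! ### The theories -/

section Theories

variable (Φ : Set PosOp)

/-- `L(Φ)`-formulas: one unary predicate constant `R_φ` for each `φ ∈ Φ`. -/
abbrev LFml (n : ℕ) : Type := Fml Φ n

/-- Classes of `L(Φ)`-formulas (in any number of free variables). -/
abbrev FmlClass : Type := ∀ n : ℕ, Set (LFml Φ n)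

/-- `Th(ℕ)`: all arithmetical sentences that are true in the natural numbers. -/
def trueArith : Set (LFml Φ 0) :=
  {A | ∃ B : Fml Empty 0, B.Sat (fun _ => ∅) Fin.elim0 ∧ A = B.ofArith}

variable {Φ}

/-- The induction axiom `θ(0) ∧ ∀ x (θ(x) → θ(x + 1)) → ∀ y θ(y)`. -/
def indAx {n : ℕ} (θ : LFml Φ (n + 1)) : LFml Φ n :=
  Fml.imp
    (Fml.and (θ.inst Term.zero)
      (Fml.all (Fml.imp θ (θ.shiftParam.inst (Term.succ (Term.var 0))))))
    (Fml.all θ)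

/-- The closure axiom `∀ x (φ(R_φ, x) → R_φ(x))`. -/
def closAx (φ : Φ) : LFml Φ 0 :=
  Fml.all (Fml.imp
    (φ.1.1.substPred (fun _ => Term.var 0) (Fml.pos φ (Term.var 0)))
    (Fml.pos φ (Term.var 0)))

/-- The minimality axiom `∀ u (R_φ(u) → ∀ x (φ(σ, x) → σ(x)) → σ(u))`. -/
def minAx {n : ℕ} (φ : Φ) (σ : LFml Φ (n + 1)) : LFml Φ n :=
  Fml.all (Fml.imp (Fml.pos φ (Term.var 0))
    (Fml.imp
      (Fml.all (Fml.imp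
        (φ.1.1.substPred (fun _ => Term.var 0) σ.shiftParam.shiftParam)
        σ.shiftParam))
      σ))

variable (Φ)

/-- The theory `Th(ℕ) + (Θ, Γ)-ID(Φ)`: complete induction for formulas in `Θ`, minimality of `R_φ`
with respect to formulas in `Γ`, for operators `φ ∈ Φ`. Formulas may contain number parameters, and
the axioms are the universal closures. The axioms of elementary arithmetic (defining equations,
axioms for `=, <`, and bounded induction) are true arithmetical sentences, hence are in `Th(ℕ)`. -/
def thID (Θ Γ : FmlClass Φ) : Set (LFml Φ 0) :=
  trueArith Φ
    ∪ {A | ∃ (n : ℕ) (θ : LFml Φ (n + 1)), θ ∈ Θ (n + 1) ∧ A = (indAx θ).closure}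
    ∪ {A | ∃ φ : Φ, A = closAx φ}
    ∪ {A | ∃ (n : ℕ) (φ : Φ) (σ : LFml Φ (n + 1)), σ ∈ Γ (n + 1) ∧ A = (minAx φ σ).closure}

/-- The class `Π⁰ₖ(P)`. -/
def piClass (k : ℕ) : FmlClass Φ := fun _ => {A | Hier .pi k A}

/-- The class `P ∪ N` of formulas that are positive or negative. -/
def posOrNeg : FmlClass Φ := fun _ => {A | A.Positive ∨ A.Negative}

/-- The class `P ∧ N` of conjunctions of a positive and a negative formula. -/
def posAndNeg : FmlClass Φ := fun _ => {A | ∃ C D, C.Positive ∧ D.Negative ∧ A = Fml.and C D}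

end Theories

/-! ### Ordinals -/

/-- The first uncountable ordinal. -/
noncomputable abbrev Om : Ordinal.{0} := Ordinal.omega 1

/-- The set `C(α, β)` for a given function `f` on the ordinals below `α`: the closure of
`β ∪ {0, Ω}` under `+`, `ξ ↦ ω^ξ` and `f`. -/
inductive CSet (α β : Ordinal.{0}) (f : ∀ ξ : Ordinal.{0}, ξ < α → Ordinal.{0}) :
    Ordinal.{0} → Prop
  | zero : CSet α β f 0
  | Om : CSet α β f Om
  | lt {ξ : Ordinal.{0}} : ξ < β → CSet α β f ξ
  | add {ξ η : Ordinal.{0}} : CSet α β f ξ → CSet α β f η → CSet α β f (ξ + η)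
  | exp {ξ : Ordinal.{0}} : CSet α β f ξ → CSet α β f (Ordinal.omega0 ^ ξ)
  | apply {ξ : Ordinal.{0}} (h : ξ < α) : CSet α β f ξ → CSet α β f (f ξ h)

/-- The collapsing function `ϑ`, for `α` below the next epsilon number above `Ω`:
`ϑ(α) = min {ρ < Ω | C(α, ρ) ∩ Ω ⊆ ρ ∧ α ∈ C(α, ρ)}`. -/
noncomputable def vartheta (α : Ordinal.{0}) : Ordinal.{0} :=
  sInf {ρ | ρ < Om ∧ (∀ ξ, CSet α ρ (fun η _ => vartheta η) ξ → ξ < Om → ξ < ρ) ∧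
    CSet α ρ (fun η _ => vartheta η) α}
termination_by α

/-- `ω₀ = 1`, `ω_{n+1} = ω^{ω_n}`. -/
noncomputable def omegaTower : ℕ → Ordinal.{0}
  | 0 => 1
  | n + 1 => Ordinal.omega0 ^ omegaTower n

end WeakID

/-! The proof combines an asymmetric interpretation with partial cut elimination. A statement about
the predicates `R_φ` is read at two countable stages γ and δ: negative occurrences of `R_φ` mean
`I_φ^γ`, positive ones `I_φ^δ`. A sequent derived with height α turns out to be valid at all pairs
(β, ϑ(Ω·α+β)) with β countable and not below the parameter of the derivation. Closure of `R_φ` costs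
one stage, which is paid by ϑ(Ω·a+β) < ϑ(Ω·α+β) for a < α. At β = 0 a derivation of `R_φ(n)` gives n
∈ I_φ^{ϑ(Ω·α)}, which bounds the norm. The relation `Ctl` keeps the ordinals generated from the
parameters, so that the collapsing inequalities `lt_fv` and `fv_lt_fv` apply.

A cut on D survives this reading if the truth value of D stabilises along increasing sequences of
stages, as it does for formulas built from positive ones by ¬, ∧, ∨ and bounded quantifiers. If the
side formulas failed at (β, δ), the premises would make D true at (s_i, s_{i+1}) and false at
(s_{i+1}, s_i) for a chain of stages s_i between β and δ, against stability. The same chain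
validates induction for such formulas. A chain of length δ validates minimality for σ in P ∪ N or P
∧ N, by induction on the stages below δ, since there the two stages can be varied independently
(`Rect`). This is `Der.val_weak`; no restriction on the operator is needed.

All other cuts must be removed beforehand, which is done on two levels. The outer calculus `repCalc`
has formulas of a target system as its literals. A finitary proof embeds there with finite height
and finite cut rank, and eliminating the outer cuts keeps heights finite. Only cuts on target
formulas remain, and `Der.toTarget` reads the result in the target system; the outcome is
`target_of_provable`. For k = 0 the target is validity itself and the levels are 2d+1 < ω. For k ≥ 1
a Π⁰ₖ(P)-formula becomes k alternating infinitary connectives over stable literals, induction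
unfolds into finitely many cuts, heights are ω·d, and k exponentiations by `Der.cutElim` lead below
ω_{1+k}.

For accessibility operators and σ in Π⁰₁(P), the formula φ(σ,x) again has a single infinite
conjunction in front. Minimality at u can then be derived by recursion on the norm |u|, with |u| as
a parameter and height Ω·d+ω^{|u|}+1 (`Der.acc_min`). Heights are now Ω·d; one cut elimination gives
ω^{Ω·d}, and Ω·ω^{Ω·d} < Ω^ω. -/

namespace WeakID

open Ordinal

universe u

/-! ### Infinitary propositional formulas -/

/-- Infinitary propositional formulas over a type of literals, with countable conjunctions and
disjunctions. -/
inductive IFml (Λ : Type u) : Type u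
  | lit (l : Λ) : IFml Λ
  | conj (f : ℕ → IFml Λ) : IFml Λ
  | disj (f : ℕ → IFml Λ) : IFml Λ

namespace IFml

variable {Λ : Type u}

section Neg

variable [InvolutiveNeg Λ]

/-- Negation by de Morgan's laws. -/
def not : IFml Λ → IFml Λ
  | lit l => lit (-l)
  | conj f => disj fun i => (f i).not
  | disj f => conj fun i => (f i).not

theorem not_not : ∀ A : IFml Λ, A.not.not = A
  | lit l => by simp [not]
  | conj f => by simp [not, fun i => not_not (f i)]
  | disj f => by simp [not, fun i => not_not (f i)]

instance : InvolutiveNeg (IFml Λ) where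
  neg := not
  neg_neg := not_not

@[simp] theorem neg_lit (l : Λ) : -(lit l) = lit (-l) := rfl
@[simp] theorem neg_conj (f : ℕ → IFml Λ) : -(conj f) = disj fun i => -(f i) := rfl
@[simp] theorem neg_disj (f : ℕ → IFml Λ) : -(disj f) = conj fun i => -(f i) := rfl

end Neg

/-- All literals of the formula satisfy `ok` and connectives are nested at most `r` times. -/
def RkLe (ok : Λ → Prop) : IFml Λ → ℕ → Prop
  | lit l, _ => ok l
  | conj _, 0 => False
  | disj _, 0 => False
  | conj f, r + 1 => ∀ i, (f i).RkLe ok r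
  | disj f, r + 1 => ∀ i, (f i).RkLe ok r

theorem RkLe.mono {ok : Λ → Prop} : ∀ {A : IFml Λ} {r s : ℕ}, A.RkLe ok r → r ≤ s → A.RkLe ok s
  | lit _, _, _, h, _ => h
  | conj _, _ + 1, _ + 1, h, hs => fun i => (h i).mono (Nat.le_of_succ_le_succ hs)
  | disj _, _ + 1, _ + 1, h, hs => fun i => (h i).mono (Nat.le_of_succ_le_succ hs)

theorem RkLe.neg [InvolutiveNeg Λ] {ok : Λ → Prop} (hok : ∀ l, ok l → ok (-l)) :
    ∀ {A : IFml Λ} {r : ℕ}, A.RkLe ok r → (-A).RkLe ok r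
  | lit l, _, h => hok l h
  | conj _, _ + 1, h => fun i => RkLe.neg hok (h i)
  | disj _, _ + 1, h => fun i => RkLe.neg hok (h i)

/-- The sequence `A, B, B, …`, used for binary connectives. -/
def two {α : Type*} (A B : α) : ℕ → α
  | 0 => A
  | _ + 1 => B

theorem two_map {α β : Type*} (F : α → β) (A B : α) :
    (fun i => F (two A B i)) = two (F A) (F B) := by
  funext i; cases i <;> rfl

end IFml

/-! ### A calculus with generic rules for literals -/

/-- An inference rule whose principal formulas are literals: if `Γ` contains the principal
literals and `Γ, prem i` is derivable for all `i`, then `Γ` is derivable. The premises may use the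
additional ordinal parameter `par`. -/
structure InfRule (Λ : Type u) where
  prin : Set Λ
  idx : Type
  prem : idx → Set (IFml Λ)
  par : Ordinal.{0}

/-- The data of an infinitary calculus: rules, a relation controlling ordinal heights by ordinal
parameters, and the literals that may occur in cut formulas. -/
structure Calc (Λ : Type u) [InvolutiveNeg Λ] where
  rules : Set (InfRule Λ)
  ctl : Ordinal.{0} → Ordinal.{0} → Prop
  ok : Λ → Prop
  ctl_mono : ∀ {ξ ξ' α}, ξ ≤ ξ' → ctl ξ α → ctl ξ' α
  ctl_add : ∀ {ξ α β}, ctl ξ α → ctl ξ β → ctl ξ (α + β)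
  ctl_nat : ∀ ξ (n : ℕ), ctl ξ n
  ok_neg : ∀ l, ok l → ok (-l)

variable {Λ : Type u} [InvolutiveNeg Λ]

/-- `Der S r ξ α Γ`: the sequent `Γ` is derivable with height `α`, parameter `ξ` and cut formulas
of rank at most `r`. -/
inductive Der (S : Calc Λ) (r : ℕ) : Ordinal.{0} → Ordinal.{0} → Set (IFml Λ) → Prop
  | conj {ξ α : Ordinal.{0}} {Γ : Set (IFml Λ)} (f : ℕ → IFml Λ) (a : ℕ → Ordinal.{0}) :
      S.ctl ξ α → IFml.conj f ∈ Γ → (∀ i, a i < α) →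
      (∀ i, Der S r ξ (a i) (insert (f i) Γ)) → Der S r ξ α Γ
  | disj {ξ α : Ordinal.{0}} {Γ : Set (IFml Λ)} (f : ℕ → IFml Λ) (i : ℕ) (a : Ordinal.{0}) :
      S.ctl ξ α → IFml.disj f ∈ Γ → a < α →
      Der S r ξ a (insert (f i) Γ) → Der S r ξ α Γ
  | cut {ξ α : Ordinal.{0}} {Γ : Set (IFml Λ)} (C : IFml Λ) (a b : Ordinal.{0}) :
      S.ctl ξ α → C.RkLe S.ok r → a < α → b < α →
      Der S r ξ a (insert C Γ) → Der S r ξ b (insert (-C) Γ) → Der S r ξ α Γ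
  | rule {ξ α : Ordinal.{0}} {Γ : Set (IFml Λ)} (ρ : InfRule Λ) (a : ρ.idx → Ordinal.{0}) :
      S.ctl ξ α → ρ ∈ S.rules → (∀ l ∈ ρ.prin, IFml.lit l ∈ Γ) → (∀ i, a i < α) →
      (∀ i, Der S r (max ξ ρ.par) (a i) (ρ.prem i ∪ Γ)) → Der S r ξ α Γ

namespace Der

variable {S : Calc Λ} {r : ℕ}

theorem ctl {ξ α : Ordinal.{0}} {Γ : Set (IFml Λ)} (h : Der S r ξ α Γ) : S.ctl ξ α := by
  cases h <;> assumption

theorem weaken {ξ α : Ordinal.{0}} {Γ : Set (IFml Λ)} (h : Der S r ξ α Γ) :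
    ∀ {ξ' α' : Ordinal.{0}} {Γ' : Set (IFml Λ)}, ξ ≤ ξ' → α ≤ α' → S.ctl ξ' α' → Γ ⊆ Γ' →
      Der S r ξ' α' Γ' := by
  induction h with
  | conj f a _ hf ha hd ih =>
    intro ξ' α' Γ' hξ hα hc hΓ
    exact .conj f a hc (hΓ hf) (fun i => (ha i).trans_le hα)
      fun i => ih i hξ le_rfl (S.ctl_mono hξ (hd i).ctl) (Set.insert_subset_insert hΓ)
  | disj f i a _ hf ha hd ih =>
    intro ξ' α' Γ' hξ hα hc hΓ
    exact .disj f i a hc (hΓ hf) (ha.trans_le hα)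
      (ih hξ le_rfl (S.ctl_mono hξ hd.ctl) (Set.insert_subset_insert hΓ))
  | cut C a b _ hC ha hb hd he ihd ihe =>
    intro ξ' α' Γ' hξ hα hc hΓ
    exact .cut C a b hc hC (ha.trans_le hα) (hb.trans_le hα)
      (ihd hξ le_rfl (S.ctl_mono hξ hd.ctl) (Set.insert_subset_insert hΓ))
      (ihe hξ le_rfl (S.ctl_mono hξ he.ctl) (Set.insert_subset_insert hΓ))
  | rule ρ a _ hρ hp ha hd ih =>
    intro ξ' α' Γ' hξ hα hc hΓ
    exact .rule ρ a hc hρ (fun l hl => hΓ (hp l hl)) (fun i => (ha i).trans_le hα)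
      fun i => ih i (max_le_max_right _ hξ) le_rfl
        (S.ctl_mono (max_le_max_right _ hξ) (hd i).ctl) (Set.union_subset_union_right _ hΓ)

theorem mono_left {ξ α : Ordinal.{0}} {Γ Γ' : Set (IFml Λ)} (h : Der S r ξ α Γ) (hΓ : Γ ⊆ Γ') :
    Der S r ξ α Γ' :=
  h.weaken le_rfl le_rfl h.ctl hΓ

theorem mono_height {ξ α α' : Ordinal.{0}} {Γ : Set (IFml Λ)} (h : Der S r ξ α Γ) (hα : α ≤ α')
    (hc : S.ctl ξ α') : Der S r ξ α' Γ :=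
  h.weaken le_rfl hα hc subset_rfl

theorem inversion {ξ α : Ordinal.{0}} {Γ : Set (IFml Λ)} (h : Der S r ξ α Γ) (f : ℕ → IFml Λ)
    (i : ℕ) : ∀ {Γ' : Set (IFml Λ)}, Γ ⊆ insert (IFml.conj f) Γ' →
      Der S r ξ α (insert (f i) Γ') := by
  have key : ∀ (A : IFml Λ) {Γ Γ' : Set (IFml Λ)}, Γ ⊆ insert (IFml.conj f) Γ' →
      insert A Γ ⊆ insert (IFml.conj f) (insert A Γ') := fun A Γ Γ' h =>
    (Set.insert_subset_insert h).trans (Set.insert_comm _ _ _).subset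
  induction h with
  | conj f' a hc hf ha hd ih =>
    intro Γ' hΓ
    rcases hΓ hf with he | hm
    · cases he
      exact (ih i (key _ hΓ)).weaken le_rfl (ha i).le hc (by simp)
    · exact .conj f' a hc (.inr hm) ha fun j =>
        (ih j (key _ hΓ)).mono_left (Set.insert_comm _ _ _).subset
  | disj f' j a hc hf ha hd ih =>
    intro Γ' hΓ
    have hm : IFml.disj f' ∈ Γ' := (hΓ hf).resolve_left (by simp)
    exact .disj f' j a hc (.inr hm) ha ((ih (key _ hΓ)).mono_left (Set.insert_comm _ _ _).subset)
  | cut C a b hc hC ha hb hd he ihd ihe =>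
    intro Γ' hΓ
    exact .cut C a b hc hC ha hb
      ((ihd (key _ hΓ)).mono_left (Set.insert_comm _ _ _).subset)
      ((ihe (key _ hΓ)).mono_left (Set.insert_comm _ _ _).subset)
  | rule ρ a hc hρ hp ha hd ih =>
    intro Γ' hΓ
    refine .rule ρ a hc hρ (fun l hl => .inr ((hΓ (hp l hl)).resolve_left (by simp))) ha
      fun j => ?_
    rw [Set.union_insert]
    refine ih j (Set.union_subset ?_ (hΓ.trans (Set.insert_subset_insert Set.subset_union_right)))
    exact Set.subset_union_left.trans (Set.subset_insert _ _)

/-- Every use of the disjunction in the second derivation becomes a cut on the smaller formula `f j`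
against `h j`. Literal rules never touch the disjunction, and putting `α` in front keeps heights
increasing. Rules may raise the parameter on the way up, hence the separate `ξ'`. -/
theorem reduction {ξ α : Ordinal.{0}} {Γ : Set (IFml Λ)} (f : ℕ → IFml Λ)
    (hf : ∀ i, (f i).RkLe S.ok r) (h : ∀ i, Der S r ξ α (insert (f i) Γ))
    {ξ' β : Ordinal.{0}} {Δ : Set (IFml Λ)} (hd : Der S r ξ' β Δ) :
    ξ ≤ ξ' → ∀ {Γ' : Set (IFml Λ)}, Γ ⊆ Γ' → Δ ⊆ insert (IFml.disj fun i => -(f i)) Γ' →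
      Der S r ξ' (α + β) Γ' := by
  have key : ∀ (A : IFml Λ) {Γ Γ' : Set (IFml Λ)}, Γ ⊆ insert (IFml.disj fun i => -(f i)) Γ' →
      insert A Γ ⊆ insert (IFml.disj fun i => -(f i)) (insert A Γ') := fun A Γ Γ' h =>
    (Set.insert_subset_insert h).trans (Set.insert_comm _ _ _).subset
  have hca : S.ctl ξ α := (h 0).ctl
  induction hd with
  | conj f' a hc hf ha hd ih =>
    intro hξ Γ' hΓ hΔ
    have hm := (hΔ hf).resolve_left (by simp)
    exact .conj f' (fun i => α + a i) (S.ctl_add (S.ctl_mono hξ hca) hc) hm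
      (fun i => by simpa using ha i)
      fun j => ih j hξ (hΓ.trans (Set.subset_insert _ _)) (key _ hΔ)
  | @disj ξ' β Δ f' j a hc hf' ha hd ih =>
    intro hξ Γ' hΓ hΔ
    have ih' := ih hξ (hΓ.trans (Set.subset_insert _ _)) (key _ hΔ)
    have hlt : α + a < α + β := by simpa using ha
    have hc' := S.ctl_add (S.ctl_mono hξ hca) hc
    rcases hΔ hf' with he | hm
    · cases he
      refine .cut (f j) α (α + a) hc' (hf j) (le_self_add.trans_lt hlt) hlt ?_ ih'
      exact (h j).weaken hξ le_rfl (S.ctl_mono hξ hca) (Set.insert_subset_insert hΓ)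
    · exact .disj f' j _ hc' hm hlt ih'
  | cut C a b hc hC ha hb hd he ihd ihe =>
    intro hξ Γ' hΓ hΔ
    exact .cut C (α + a) (α + b) (S.ctl_add (S.ctl_mono hξ hca) hc) hC (by simpa using ha)
      (by simpa using hb) (ihd hξ (hΓ.trans (Set.subset_insert _ _)) (key _ hΔ))
      (ihe hξ (hΓ.trans (Set.subset_insert _ _)) (key _ hΔ))
  | rule ρ a hc hρ hp ha hd ih =>
    intro hξ Γ' hΓ hΔ
    refine .rule ρ (fun i => α + a i) (S.ctl_add (S.ctl_mono hξ hca) hc) hρ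
      (fun l hl => (hΔ (hp l hl)).resolve_left (by simp)) (fun i => by simpa using ha i)
      fun j => ih j (hξ.trans (le_max_left _ _)) (hΓ.trans Set.subset_union_right) ?_
    exact Set.union_subset (Set.subset_union_left.trans (Set.subset_insert _ _))
      (hΔ.trans (Set.insert_subset_insert Set.subset_union_right))

theorem cutElim (g : Ordinal.{0} → Ordinal.{0}) (hg : StrictMono g)
    (hadd : ∀ {a b c}, a < c → b < c → g a + g b ≤ g c)
    (hctl : ∀ {ξ α}, S.ctl ξ α → S.ctl ξ (g α)) {ξ α : Ordinal.{0}} {Γ : Set (IFml Λ)}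
    (h : Der S (r + 1) ξ α Γ) : Der S r ξ (g α) Γ := by
  induction h with
  | conj f a hc hf ha hd ih => exact .conj f _ (hctl hc) hf (fun i => hg (ha i)) ih
  | disj f i a hc hf ha hd ih => exact .disj f i _ (hctl hc) hf (hg ha) ih
  | cut C a b hc hC ha hb hd he ihd ihe =>
    match C, hC, ihd, ihe with
    | .lit l, hC, ihd, ihe => exact .cut (.lit l) _ _ (hctl hc) hC (hg ha) (hg hb) ihd ihe
    | .conj f, hC, ihd, ihe =>
      refine (reduction f hC (fun i => ihd.inversion f i subset_rfl) ihe le_rfl subset_rfl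
        subset_rfl).mono_height (hadd ha hb) (hctl hc)
    | .disj f, hC, ihd, ihe =>
      refine (reduction (fun i => -(f i)) (fun i => (hC i).neg S.ok_neg)
        (fun i => ihe.inversion _ i subset_rfl) ihd le_rfl subset_rfl
        (by simp)).mono_height (hadd hb ha) (hctl hc)
  | rule ρ a hc hρ hp ha hd ih => exact .rule ρ _ (hctl hc) hρ hp (fun i => hg (ha i)) ih

/-- Excluded middle for formulas of finite rank, from excluded middle for literals. -/
theorem em (hem : ∀ (l : Λ) (Γ : Set (IFml Λ)), S.ok l → IFml.lit l ∈ Γ → IFml.lit (-l) ∈ Γ →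
      Der S r 0 0 Γ) :
    ∀ (A : IFml Λ) (k : ℕ) {Γ : Set (IFml Λ)}, A.RkLe S.ok k → A ∈ Γ → -A ∈ Γ →
      Der S r 0 ((2 * k : ℕ) : Ordinal.{0}) Γ
  | .lit l, k, Γ, hk, h, h' => (hem l Γ hk h h').mono_height (zero_le) (S.ctl_nat _ _)
  | .conj f, k + 1, Γ, hk, h, h' => by
    refine .conj f (fun _ => ((2 * k + 1 : ℕ) : Ordinal.{0})) (S.ctl_nat _ _) h
      (fun i => by exact_mod_cast (by omega)) fun i => ?_
    refine .disj (fun i => -(f i)) i ((2 * k : ℕ) : Ordinal.{0}) (S.ctl_nat _ _) (.inr h')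
      (by exact_mod_cast (by omega)) (em hem (f i) k (hk i) ?_ ?_) <;> simp
  | .disj f, k + 1, Γ, hk, h, h' => by
    refine .conj (fun i => -(f i)) (fun _ => ((2 * k + 1 : ℕ) : Ordinal.{0})) (S.ctl_nat _ _) h'
      (fun i => by exact_mod_cast (by omega)) fun i => ?_
    refine .disj f i ((2 * k : ℕ) : Ordinal.{0}) (S.ctl_nat _ _) (.inr h)
      (by exact_mod_cast (by omega)) (em hem (f i) k (hk i) ?_ ?_) <;> simp

theorem mono_rank {r' : ℕ} (hr : r ≤ r') {ξ α : Ordinal.{0}} {Γ : Set (IFml Λ)}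
    (h : Der S r ξ α Γ) : Der S r' ξ α Γ := by
  induction h with
  | conj f a hc hf ha _ ih => exact .conj f a hc hf ha ih
  | disj f i a hc hf ha _ ih => exact .disj f i a hc hf ha ih
  | cut C a b hc hC ha hb _ _ ihd ihe => exact .cut C a b hc (hC.mono hr) ha hb ihd ihe
  | rule ρ a hc hρ hp ha _ ih => exact .rule ρ a hc hρ hp ha ih

section Nat

variable {Γ : Set (IFml Λ)} {ξ : Ordinal.{0}} {m : ℕ}

theorem nat_le {m' : ℕ} (h : Der S r ξ m Γ) (hm : m ≤ m') : Der S r ξ m' Γ :=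
  h.mono_height (by exact_mod_cast hm) (S.ctl_nat _ _)

theorem nat_conj {f : ℕ → IFml Λ} (hf : IFml.conj f ∈ Γ)
    (h : ∀ i, Der S r ξ m (insert (f i) Γ)) : Der S r ξ (m + 1 : ℕ) Γ :=
  .conj f (fun _ => m) (S.ctl_nat _ _) hf (fun _ => by exact_mod_cast Nat.lt_succ_self m) h

theorem nat_disj {f : ℕ → IFml Λ} (hf : IFml.disj f ∈ Γ) (i : ℕ)
    (h : Der S r ξ m (insert (f i) Γ)) : Der S r ξ (m + 1 : ℕ) Γ :=
  .disj f i m (S.ctl_nat _ _) hf (by exact_mod_cast Nat.lt_succ_self m) h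

theorem nat_cut {C : IFml Λ} (hC : C.RkLe S.ok r) (h : Der S r ξ m (insert C Γ))
    (h' : Der S r ξ m (insert (-C) Γ)) : Der S r ξ (m + 1 : ℕ) Γ :=
  .cut C m m (S.ctl_nat _ _) hC (by exact_mod_cast Nat.lt_succ_self m)
    (by exact_mod_cast Nat.lt_succ_self m) h h'

theorem nat_rule {ρ : InfRule Λ} (hρ : ρ ∈ S.rules) (hp : ∀ l ∈ ρ.prin, IFml.lit l ∈ Γ)
    (h : ∀ i, Der S r (max ξ ρ.par) m (ρ.prem i ∪ Γ)) : Der S r ξ (m + 1 : ℕ) Γ :=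
  .rule ρ (fun _ => m) (S.ctl_nat _ _) hρ hp (fun _ => by exact_mod_cast Nat.lt_succ_self m) h

theorem nat_conj_two {A B : IFml Λ} (hf : IFml.conj (IFml.two A B) ∈ Γ)
    (h : Der S r ξ m (insert A Γ)) (h' : Der S r ξ m (insert B Γ)) : Der S r ξ (m + 1 : ℕ) Γ :=
  nat_conj hf fun i => by cases i <;> assumption

end Nat

end Der

/-! ### The collapsing function -/

theorem Om_pos : 0 < Om := omega_pos 1

theorem Om_ne_zero : Om ≠ 0 := Om_pos.ne'

theorem one_lt_Om : 1 < Om := one_lt_omega0.trans omega0_lt_omega_one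

theorem omega0_lt_Om : ω < Om := omega0_lt_omega_one

theorem add_lt_Om {a b : Ordinal.{0}} (ha : a < Om) (hb : b < Om) : a + b < Om :=
  isPrincipal_add_omega 1 ha hb

theorem omega0_opow_lt_Om {a : Ordinal.{0}} (ha : a < Om) : ω ^ a < Om :=
  isPrincipal_opow_omega 1 omega0_lt_Om ha

theorem isSuccLimit_Om : Order.IsSuccLimit Om :=
  isSuccLimit_of_isPrincipal_add one_lt_Om (isPrincipal_add_omega 1)

theorem omega0_opow_Om : ω ^ Om = Om := by
  refine le_antisymm ?_ (right_le_opow _ one_lt_omega0)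
  exact opow_le_of_isSuccLimit omega0_ne_zero isSuccLimit_Om |>.2
    fun b hb => (omega0_opow_lt_Om hb).le

/-- The set `C(α, ρ)` for the collapsing function. -/
abbrev CC (α ρ : Ordinal.{0}) : Ordinal.{0} → Prop := CSet α ρ (fun η _ => vartheta η)

/-- The closure of `ρ ∪ {0, Ω}` under `+` and `ξ ↦ ω ^ ξ`. -/
abbrev Cl (ρ : Ordinal.{0}) : Ordinal.{0} → Prop := CC 0 ρ

/-- `Cl ρ ∩ Ω ⊆ ρ`. -/
def Closed (ρ : Ordinal.{0}) : Prop := ∀ ξ, Cl ρ ξ → ξ < Om → ξ < ρ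

theorem vartheta_lt_Om (α : Ordinal.{0}) : vartheta α < Om := by
  rw [vartheta]
  by_cases h : {ρ | ρ < Om ∧ (∀ ξ, CC α ρ ξ → ξ < Om → ξ < ρ) ∧ CC α ρ α}.Nonempty
  -- If no ordinal qualifies, the infimum takes the default value 0, which is countable as well.
  · exact (csInf_mem h).1
  · rw [Set.not_nonempty_iff_eq_empty] at h
    rw [h, Ordinal.sInf_empty]
    exact Om_pos

theorem Cl.toCC {α ρ ξ : Ordinal.{0}} (h : Cl ρ ξ) : CC α ρ ξ := by
  induction h with
  | zero => exact .zero
  | Om => exact .Om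
  | lt h => exact .lt h
  | add _ _ h₁ h₂ => exact .add h₁ h₂
  | exp _ h => exact .exp h
  | apply h => exact absurd h not_lt_zero

theorem CSet.mono {α ρ ρ' ξ : Ordinal.{0}} (hρ : ρ ≤ ρ') (h : CC α ρ ξ) : CC α ρ' ξ := by
  induction h with
  | zero => exact .zero
  | Om => exact .Om
  | lt h => exact .lt (h.trans_le hρ)
  | add _ _ h₁ h₂ => exact .add h₁ h₂
  | exp _ h => exact .exp h
  | apply h _ ih => exact .apply h ih

/-- Values of ϑ are countable, so they already lie below ρ once C(α,ρ) ∩ Ω ⊆ ρ: over such ρ the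
clause for ϑ generates nothing new. -/
theorem CSet.toCl {α ρ ξ : Ordinal.{0}} (hρ : ∀ ξ, CC α ρ ξ → ξ < WeakID.Om → ξ < ρ)
    (h : CC α ρ ξ) : Cl ρ ξ := by
  induction h with
  | zero => exact .zero
  | Om => exact .Om
  | lt h => exact .lt h
  | add _ _ h₁ h₂ => exact .add h₁ h₂
  | exp _ h => exact .exp h
  | apply h hc _ => exact .lt (hρ _ (.apply h hc) (vartheta_lt_Om _))

theorem Closed.of_CC {α ρ : Ordinal.{0}} (hρ : ∀ ξ, CC α ρ ξ → ξ < Om → ξ < ρ) : Closed ρ :=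
  fun ξ h => hρ ξ h.toCC

theorem Closed.pos {ρ : Ordinal.{0}} (hρ : Closed ρ) : 0 < ρ := hρ 0 .zero Om_pos

/-- For an ordinal in `Cl ρ` the remainder modulo `Ω` is below `ρ`. -/
theorem Closed.mod_lt {ρ x : Ordinal.{0}} (hρ : Closed ρ) (hx : Cl ρ x) : x % Om < ρ := by
  have hlt : ∀ y : Ordinal.{0}, y % Om < Om := fun y => Ordinal.mod_lt y Om_ne_zero
  induction hx with
  | zero => simpa using hρ.pos
  | Om => simpa using hρ.pos
  | lt h => exact (Ordinal.mod_le _ _).trans_lt h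
  | @add x y _ _ hx hy =>
    have ex := Ordinal.div_add_mod x Om
    have ey := Ordinal.div_add_mod y Om
    by_cases hq : y / Om = 0
    · rw [hq, mul_zero, zero_add] at ey
      conv_lhs => rw [← ex, ← ey]
      rw [add_assoc, mul_add_mod_self, Ordinal.mod_eq_of_lt (add_lt_Om (hlt x) (hlt y))]
      exact hρ _ (.add (.lt hx) (.lt hy)) (add_lt_Om (hlt x) (hlt y))
    -- A summand y ≥ Ω absorbs the remainder of x, so the sum has the remainder of y.
    · obtain ⟨q, hq'⟩ : ∃ q, y / Om = 1 + q :=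
        ⟨y / Om - 1, (Ordinal.add_sub_cancel_of_le (Order.one_le_iff_pos.2 (pos_iff_ne_zero.2 hq))).symm⟩
      have habs : x % Om + Om * (y / Om) = Om * (y / Om) := by
        rw [hq', mul_add, mul_one, ← add_assoc, (isPrincipal_add_omega 1).add_eq_right (hlt x)]
      have : x + y = Om * (x / Om + y / Om) + y % Om := by
        conv_lhs => rw [← ex, ← ey]
        rw [add_assoc, ← add_assoc (x % Om), habs, mul_add, add_assoc]
      rw [this, mul_add_mod_self, Ordinal.mod_mod]
      exact hy
  | @exp x _ hx =>
    have ex := Ordinal.div_add_mod x Om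
    by_cases hq : x / Om = 0
    · rw [hq, mul_zero, zero_add] at ex
      have h1 : x < Om := ex ▸ hlt x
      rw [Ordinal.mod_eq_of_lt (omega0_opow_lt_Om h1)]
      rw [ex] at hx
      exact hρ _ (.exp (.lt hx)) (omega0_opow_lt_Om h1)
    -- For x ≥ Ω the power ω^x is a multiple of ω^Ω = Ω, with remainder 0.
    · obtain ⟨q, hq'⟩ : ∃ q, x / Om = 1 + q :=
        ⟨x / Om - 1, (Ordinal.add_sub_cancel_of_le (Order.one_le_iff_pos.2 (pos_iff_ne_zero.2 hq))).symm⟩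
      rw [← ex, hq', mul_add, mul_one, add_assoc, opow_add, omega0_opow_Om, Ordinal.mul_mod]
      exact hρ.pos
  | apply h => exact absurd h not_lt_zero

/-- Since Ω·ω^x = ω^(Ω+x), multiplication by Ω acts termwise on Cantor normal forms. For x < ρ the
leading term is peeled off by induction, which needs no closure of ρ. -/
theorem Cl.Om_mul {ρ x : Ordinal.{0}} (hx : Cl ρ x) : Cl ρ (Om * x) := by
  induction hx with
  | zero => rw [mul_zero]; exact .zero
  | Om =>
    rw [show Om * Om = ω ^ (Om + Om) by rw [opow_add, omega0_opow_Om]]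
    exact .exp (.add .Om .Om)
  | @lt x h =>
    induction x using WellFoundedLT.induction with
    | ind x ih =>
      rcases eq_or_ne x 0 with rfl | hx
      · rw [mul_zero]; exact .zero
      · have e : ω ^ log ω x + (x - ω ^ log ω x) = x :=
          Ordinal.add_sub_cancel_of_le (opow_log_le_self _ hx)
        rw [← e, mul_add]
        refine .add ?_ (ih _ (sub_omega0_opow_log_lt hx) ((sub_omega0_opow_log_lt hx).trans h))
        rw [show Om * ω ^ log ω x = ω ^ (Om + log ω x) by rw [opow_add, omega0_opow_Om]]
        exact .exp (.add .Om (.lt ((log_le_self _ _).trans_lt h)))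
  | add _ _ h₁ h₂ => rw [mul_add]; exact .add h₁ h₂
  | @exp x h _ =>
    rw [show Om * ω ^ x = ω ^ (Om + x) by rw [opow_add, omega0_opow_Om]]
    exact .exp (.add .Om h)
  | apply h => exact absurd h not_lt_zero

/-! ### Existence of closed ordinals -/

/-- The elements of `C(α, ρ)` obtained by at most `n` applications of the closure functions. -/
def CStage (α ρ : Ordinal.{0}) : ℕ → Set Ordinal.{0}
  | 0 => Set.Iio ρ ∪ {0, Om}
  | n + 1 => CStage α ρ n ∪ Set.image2 (· + ·) (CStage α ρ n) (CStage α ρ n) ∪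
      (fun ξ => ω ^ ξ) '' CStage α ρ n ∪ vartheta '' CStage α ρ n

theorem CStage_countable (α : Ordinal.{0}) {ρ : Ordinal.{0}} (hρ : ρ < Om) :
    ∀ n, (CStage α ρ n).Countable
  | 0 => by
    refine .union ?_ (Set.to_countable _)
    rw [← Cardinal.le_aleph0_iff_set_countable, Cardinal.mk_Iio_ordinal]
    rw [← Cardinal.lift_aleph0.{1, 0}, Cardinal.lift_le]
    rw [Om, ← Cardinal.ord_aleph, Cardinal.lt_ord] at hρ
    exact Cardinal.lt_aleph_one_iff.1 hρ
  | n + 1 => by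
    have h := CStage_countable α hρ n
    exact ((h.union (h.image2 h _)).union (h.image _)).union (h.image _)

theorem CStage_mono (α ρ : Ordinal.{0}) : Monotone (CStage α ρ) :=
  monotone_nat_of_le_succ fun _ _ h => .inl (.inl (.inl h))

/-- `CStage` drops the restriction to arguments of ϑ below α; an upper bound is enough for
countability. -/
theorem CSet.mem_CStage {α ρ ξ : Ordinal.{0}} (h : CC α ρ ξ) : ∃ n, ξ ∈ CStage α ρ n := by
  induction h with
  | zero => exact ⟨0, .inr (by simp)⟩
  | Om => exact ⟨0, .inr (by simp)⟩
  | lt h => exact ⟨0, .inl h⟩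
  | add _ _ h₁ h₂ =>
    obtain ⟨n, hn⟩ := h₁
    obtain ⟨m, hm⟩ := h₂
    exact ⟨max n m + 1, .inl (.inl (.inr ⟨_, CStage_mono α ρ (le_max_left _ _) hn, _,
      CStage_mono α ρ (le_max_right _ _) hm, rfl⟩))⟩
  | exp _ h =>
    obtain ⟨n, hn⟩ := h
    exact ⟨n + 1, .inl (.inr ⟨_, hn, rfl⟩)⟩
  | apply _ _ h =>
    obtain ⟨n, hn⟩ := h
    exact ⟨n + 1, .inr ⟨_, hn, rfl⟩⟩

/-- The closure of a countable set under finitary operations is countable, and a countable set of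
countable ordinals is bounded below ω₁. Adjoining ρ itself makes the bound exceed ρ. -/
theorem exists_bound_CC (α : Ordinal.{0}) {ρ : Ordinal.{0}} (hρ : ρ < Om) :
    ∃ ρ' < Om, ρ < ρ' ∧ ∀ ξ, CC α ρ ξ → ξ < Om → ξ < ρ' := by
  have hc : ({ξ | CC α ρ ξ ∧ ξ < Om} ∪ {ρ}).Countable :=
    ((Set.countable_iUnion (CStage_countable α hρ)).mono fun ξ hξ =>
      Set.mem_iUnion.2 hξ.1.mem_CStage).union (Set.countable_singleton _)
  have := hc.to_subtype
  have hb : ∀ i : ↥({ξ | CC α ρ ξ ∧ ξ < Om} ∪ {ρ}), i.1 + 1 < Om := by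
    rintro ⟨x, hx | rfl⟩
    · exact add_lt_Om hx.2 one_lt_Om
    · exact add_lt_Om hρ one_lt_Om
  refine ⟨⨆ i : ↥({ξ | CC α ρ ξ ∧ ξ < Om} ∪ {ρ}), (i.1 + 1), iSup_lt_omega_one hb, ?_, ?_⟩
  · exact (lt_add_one _).trans_le (Ordinal.le_iSup
      (fun i : ↥({ξ | CC α ρ ξ ∧ ξ < Om} ∪ {ρ}) => i.1 + 1) ⟨ρ, .inr rfl⟩)
  · intro ξ h h'
    exact (lt_add_one _).trans_le (Ordinal.le_iSup
      (fun i : ↥({ξ | CC α ρ ξ ∧ ξ < Om} ∪ {ρ}) => i.1 + 1) ⟨ξ, .inl ⟨h, h'⟩⟩)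

theorem CSet.exists_of_iSup {α ξ : Ordinal.{0}} {s : ℕ → Ordinal.{0}} (hs : Monotone s)
    (h : CC α (⨆ n, s n) ξ) : ∃ n, CC α (s n) ξ := by
  induction h with
  | zero => exact ⟨0, .zero⟩
  | Om => exact ⟨0, .Om⟩
  | lt h =>
    obtain ⟨n, hn⟩ := Ordinal.lt_iSup_iff.1 h
    exact ⟨n, .lt hn⟩
  | add _ _ h₁ h₂ =>
    obtain ⟨n, hn⟩ := h₁
    obtain ⟨m, hm⟩ := h₂
    exact ⟨max n m, .add (hn.mono (hs (le_max_left _ _))) (hm.mono (hs (le_max_right _ _)))⟩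
  | exp _ h =>
    obtain ⟨n, hn⟩ := h
    exact ⟨n, .exp hn⟩
  | apply h' _ h =>
    obtain ⟨n, hn⟩ := h
    exact ⟨n, .apply h' hn⟩

/-- Iterate the bound ω times; by finitary generation each element of the closure of the supremum
appears already at some iterate. -/
theorem exists_closed_CC (α : Ordinal.{0}) {β : Ordinal.{0}} (hβ : β < Om) :
    ∃ ρ < Om, β < ρ ∧ ∀ ξ, CC α ρ ξ → ξ < Om → ξ < ρ := by
  choose! g hg using fun ρ (h : ρ < Om) => exists_bound_CC α h
  let s : ℕ → Ordinal.{0} := fun n => g^[n] β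
  have hs1 : ∀ n, s (n + 1) = g (s n) := fun n => Function.iterate_succ_apply' g n β
  have hs : ∀ n, s n < Om := by
    intro n
    induction n with
    | zero => exact hβ
    | succ n ih => rw [hs1]; exact (hg _ ih).1
  have hlt : ∀ n, s n < s (n + 1) := fun n => by rw [hs1]; exact (hg _ (hs n)).2.1
  have hmono : Monotone s := monotone_nat_of_le_succ fun n => (hlt n).le
  refine ⟨⨆ n, s n, iSup_lt_omega_one hs, (hlt 0).trans_le (Ordinal.le_iSup s 1), ?_⟩
  intro ξ h hξ
  obtain ⟨n, hn⟩ := h.exists_of_iSup hmono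
  have := (hg _ (hs n)).2.2 ξ hn hξ
  rw [← hs1] at this
  exact this.trans_le (Ordinal.le_iSup s _)

/-! ### Control of ordinals by countable parameters -/

/-- `α` is generated by `+`, `ω ^ ·`, `Ω` from ordinals below any closed ordinal above `ξ`. -/
def Ctl (ξ α : Ordinal.{0}) : Prop := ∀ ρ, Closed ρ → ξ < ρ → Cl ρ α

theorem Ctl.mono {ξ ξ' α : Ordinal.{0}} (h : ξ ≤ ξ') (hα : Ctl ξ α) : Ctl ξ' α :=
  fun ρ hρ hξ => hα ρ hρ (h.trans_lt hξ)

theorem Ctl.add {ξ α β : Ordinal.{0}} (hα : Ctl ξ α) (hβ : Ctl ξ β) : Ctl ξ (α + β) :=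
  fun ρ hρ hξ => .add (hα ρ hρ hξ) (hβ ρ hρ hξ)

theorem Ctl.exp {ξ α : Ordinal.{0}} (hα : Ctl ξ α) : Ctl ξ (ω ^ α) :=
  fun ρ hρ hξ => .exp (hα ρ hρ hξ)

theorem Ctl.of_le {ξ α : Ordinal.{0}} (h : α ≤ ξ) : Ctl ξ α :=
  fun _ _ hξ => .lt (h.trans_lt hξ)

theorem Ctl.Om_mul {ξ α : Ordinal.{0}} (h : Ctl ξ α) : Ctl ξ (Om * α) :=
  fun ρ hρ hξ => (h ρ hρ hξ).Om_mul

theorem Ctl.one (ξ : Ordinal.{0}) : Ctl ξ 1 := by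
  simpa using (Ctl.of_le (zero_le : 0 ≤ ξ)).exp

theorem ctl_Om (ξ : Ordinal.{0}) : Ctl ξ Om := by
  simpa using (Ctl.one ξ).Om_mul

theorem Ctl.nat (ξ : Ordinal.{0}) : ∀ n : ℕ, Ctl ξ n
  | 0 => by simpa using Ctl.of_le (zero_le : 0 ≤ ξ)
  | n + 1 => by push_cast; exact (Ctl.nat ξ n).add (Ctl.one ξ)

theorem omegaTower_lt_Om : ∀ j, omegaTower j < Om
  | 0 => one_lt_Om
  | j + 1 => omega0_opow_lt_Om (omegaTower_lt_Om j)

theorem ctl_omegaTower (ξ : Ordinal.{0}) : ∀ j, Ctl ξ (omegaTower j)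
  | 0 => Ctl.one ξ
  | j + 1 => (ctl_omegaTower ξ j).exp

/-- Every closed ordinal exceeds all the towers, so heights below a tower need no parameters. This
is why the calculus for induction and simple minimality can do without control. -/
theorem Ctl.of_lt_omegaTower (ξ : Ordinal.{0}) {j : ℕ} {α : Ordinal.{0}} (h : α < omegaTower j) :
    Ctl ξ α :=
  fun ρ hρ hξ => .lt (h.trans (hρ _ (ctl_omegaTower ξ j ρ hρ hξ) (omegaTower_lt_Om j)))

theorem Ctl.max {ξ α β : Ordinal.{0}} (hα : Ctl ξ α) (hβ : Ctl ξ β) : Ctl ξ (max α β) := by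
  rcases max_choice α β with h | h <;> rw [h] <;> assumption

/-- Control by a countable β makes the set defining ϑ(x) nonempty: any ordinal above β that is
closed for C(x,·) belongs to it. Without that, ϑ(x) might be a meaningless default. -/
theorem vartheta_spec {x β : Ordinal.{0}} (hβ : β < Om) (hx : Ctl β x) :
    (∀ ξ, CC x (vartheta x) ξ → ξ < Om → ξ < vartheta x) ∧ CC x (vartheta x) x := by
  have hne : {ρ | ρ < Om ∧ (∀ ξ, CC x ρ ξ → ξ < Om → ξ < ρ) ∧ CC x ρ x}.Nonempty := by
    obtain ⟨ρ, h1, h2, h3⟩ := exists_closed_CC x hβ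
    exact ⟨ρ, h1, h3, (hx ρ (Closed.of_CC h3) h2).toCC⟩
  have := csInf_mem hne
  rw [vartheta]
  exact this.2

theorem vartheta_lt_of {x y β : Ordinal.{0}} (hβ : β < Om) (hx : Ctl β x) (hyx : y < x)
    (hy : Cl (vartheta x) y) : vartheta y < vartheta x :=
  (vartheta_spec hβ hx).1 _ (.apply hyx hy.toCC) (vartheta_lt_Om _)

/-- The function `β ↦ ϑ(Ω · α + β)`. -/
noncomputable def fv (α β : Ordinal.{0}) : Ordinal.{0} := vartheta (Om * α + β)

section fv

variable {ξ α β : Ordinal.{0}}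

theorem fv_lt_Om (α β : Ordinal.{0}) : fv α β < Om := vartheta_lt_Om _

theorem Ctl.Om_mul_add (hα : Ctl ξ α) (hξ : ξ ≤ β) : Ctl β (Om * α + β) :=
  (hα.mono hξ).Om_mul.add (.of_le le_rfl)

theorem fv_closed (hα : Ctl ξ α) (hξ : ξ ≤ β) (hβ : β < Om) : Closed (fv α β) :=
  Closed.of_CC (vartheta_spec hβ (hα.Om_mul_add hξ)).1

/-- The definition of ϑ forces its argument into the closure, and β is the remainder of that
argument modulo Ω, so `Closed.mod_lt` applies. -/
theorem lt_fv (hα : Ctl ξ α) (hξ : ξ ≤ β) (hβ : β < Om) : β < fv α β := by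
  have h := vartheta_spec hβ (hα.Om_mul_add hξ)
  have := (fv_closed hα hξ hβ).mod_lt (h.2.toCl h.1)
  rwa [mul_add_mod_self, Ordinal.mod_eq_of_lt hβ] at this

/-- The collapsing inequality behind the soundness steps: a smaller multiple of Ω loses against a
larger one even with any γ below the value added, because the closed ordinal `fv α β` generates
Ω·α'+γ. So `fv α β` is closed under `fv α'` for γ ≥ ξ'. -/
theorem fv_lt_fv (hα : Ctl ξ α) (hξ : ξ ≤ β) (hβ : β < Om) {ξ' α' γ : Ordinal.{0}}
    (hα' : Ctl ξ' α') (hξ' : ξ' ≤ γ) (hγ : γ < fv α β) (hlt : α' < α) : fv α' γ < fv α β := by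
  refine vartheta_lt_of hβ (hα.Om_mul_add hξ) ?_ ?_
  · have hγ' : γ < Om := hγ.trans (fv_lt_Om _ _)
    calc Om * α' + γ < Om * α' + Om := by simpa using hγ'
      _ = Om * (α' + 1) := by rw [mul_add, mul_one]
      _ ≤ Om * α := by gcongr; exact Order.add_one_le_of_lt hlt
      _ ≤ Om * α + β := le_self_add
  · exact .add (hα' _ (fv_closed hα hξ hβ) (hξ'.trans_lt hγ)).Om_mul (.lt hγ)

theorem fv_strictMono_right (hα : Ctl ξ α) (hξ : ξ ≤ β) {β' : Ordinal.{0}} (hlt : β < β')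
    (hβ' : β' < Om) : fv α β < fv α β' := by
  have hξ' := hξ.trans hlt.le
  have h1 := lt_fv hα hξ' hβ'
  refine vartheta_lt_of hβ' (hα.Om_mul_add hξ') (by simpa using hlt) ?_
  exact .add (hα _ (fv_closed hα hξ' hβ') (hξ'.trans_lt h1)).Om_mul (.lt (hlt.trans h1))

theorem fv_zero_lt_vartheta {x : Ordinal.{0}} (hx : Ctl 0 x) (hα : Ctl 0 α) (hlt : Om * α < x) :
    fv α 0 < vartheta x := by
  have hc := Closed.of_CC (vartheta_spec Om_pos hx).1
  rw [fv, add_zero]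
  exact vartheta_lt_of Om_pos hx hlt (hα _ hc hc.pos).Om_mul

end fv

/-! ### Stages of positive operators -/

namespace PosOp

variable (φ : PosOp)

theorem stage_mono : Monotone φ.stage := OrdinalApprox.lfpApprox_mono_right _

variable {φ}

theorem mem_stage {n : ℕ} {δ : Ordinal.{0}} :
    n ∈ φ.stage δ ↔ ∃ γ < δ, n ∈ φ.toHom (φ.stage γ) := by
  unfold stage
  rw [OrdinalApprox.lfpApprox]
  simp

theorem norm_lt {n : ℕ} {δ : Ordinal.{0}} (h : n ∈ φ.stage δ) : φ.norm n < δ := by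
  obtain ⟨γ, hγ, hn⟩ := mem_stage.1 h
  refine lt_of_le_of_lt (csInf_le' ?_) hγ
  exact mem_stage.2 ⟨γ, lt_add_one γ, hn⟩

theorem mem_fix {n : ℕ} {δ : Ordinal.{0}} (h : n ∈ φ.stage δ) : n ∈ φ.fix := by
  induction δ using WellFoundedLT.induction generalizing n with
  | ind δ ih =>
    obtain ⟨γ, hγ, hn⟩ := mem_stage.1 h
    rw [fix, ← OrderHom.map_lfp]
    exact φ.toHom.monotone (fun m hm => ih γ hγ hm) hn

theorem mem_norm {n : ℕ} {δ : Ordinal.{0}} (h : n ∈ φ.stage δ) :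
    n ∈ φ.toHom (φ.stage (φ.norm n)) := by
  have hne : {α | n ∈ φ.stage (α + 1)}.Nonempty := ⟨δ, φ.stage_mono le_self_add h⟩
  obtain ⟨γ, hγ, hn⟩ := mem_stage.1 (csInf_mem hne : n ∈ φ.stage (φ.norm n + 1))
  exact φ.toHom.monotone (φ.stage_mono (Order.lt_add_one_iff.1 hγ)) hn

end PosOp

/-! ### Literals with two stages -/

/-- A literal: a condition on a stage for the negative and a stage for the positive occurrences of
the predicate constants. -/
@[ext] structure Lit where
  rel : Ordinal.{0} → Ordinal.{0} → Prop
  mono : ∀ {γ γ' δ δ'}, γ' ≤ γ → δ ≤ δ' → rel γ δ → rel γ' δ'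

namespace Lit

/-- The negation exchanges the rôles of the stages. -/
def not (D : Lit) : Lit where
  rel γ δ := ¬ D.rel δ γ
  mono hγ hδ h h' := h (D.mono hδ hγ h')

instance : InvolutiveNeg Lit where
  neg := not
  neg_neg D := by ext; simp [not]

@[simp] theorem neg_rel (D : Lit) (γ δ : Ordinal.{0}) : (-D).rel γ δ ↔ ¬ D.rel δ γ := Iff.rfl

/-- The literal that is a constant proposition. -/
def const (p : Prop) : Lit := ⟨fun _ _ => p, fun _ _ h => h⟩

/-- Countable conjunction of literals. -/
def all (E : ℕ → Lit) : Lit :=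
  ⟨fun γ δ => ∀ i, (E i).rel γ δ, fun hγ hδ h i => (E i).mono hγ hδ (h i)⟩

/-- Countable disjunction of literals. -/
def ex (E : ℕ → Lit) : Lit :=
  ⟨fun γ δ => ∃ i, (E i).rel γ δ, fun hγ hδ ⟨i, h⟩ => ⟨i, (E i).mono hγ hδ h⟩⟩

/-- The literal `n ∈ R_φ`. -/
noncomputable def mem (φ : PosOp) (n : ℕ) : Lit :=
  ⟨fun _ δ => n ∈ φ.stage δ, fun _ hδ h => φ.stage_mono hδ h⟩

/-- The literal `φ(R_φ, n)`. -/
noncomputable def step (φ : PosOp) (n : ℕ) : Lit :=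
  ⟨fun _ δ => n ∈ φ.toHom (φ.stage δ), fun _ hδ h => φ.toHom.monotone (φ.stage_mono hδ) h⟩

/-- The literal `φ(σ, n)`. -/
def opr (φ : PosOp) (σ : ℕ → Lit) (n : ℕ) : Lit :=
  ⟨fun γ δ => n ∈ φ.toHom {y | (σ y).rel γ δ},
    fun hγ hδ h => φ.toHom.monotone (fun y hy => (σ y).mono hγ hδ hy) h⟩

end Lit

/-- The truth value is eventually constant along sequences of stages. -/
def EvConst (p : Ordinal.{0} → Ordinal.{0} → Prop) : Prop :=
  ∀ s : ℕ → Ordinal.{0}, Monotone s → ∃ (N : ℕ) (b : Prop), ∀ i ≥ N, ∀ j ≥ N, p (s i) (s j) ↔ b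

namespace EvConst

variable {p q : Ordinal.{0} → Ordinal.{0} → Prop}

theorem not (h : EvConst p) : EvConst fun γ δ => ¬ p δ γ := fun s hs => by
  obtain ⟨N, b, hb⟩ := h s hs
  exact ⟨N, ¬ b, fun i hi j hj => not_congr (hb j hj i hi)⟩

theorem and (hp : EvConst p) (hq : EvConst q) : EvConst fun γ δ => p γ δ ∧ q γ δ := fun s hs => by
  obtain ⟨N, b, hb⟩ := hp s hs
  obtain ⟨M, c, hc⟩ := hq s hs
  exact ⟨max N M, b ∧ c, fun i hi j hj =>
    and_congr (hb i (le_of_max_le_left hi) j (le_of_max_le_left hj))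
      (hc i (le_of_max_le_right hi) j (le_of_max_le_right hj))⟩

theorem or (hp : EvConst p) (hq : EvConst q) : EvConst fun γ δ => p γ δ ∨ q γ δ := by
  simpa [or_iff_not_and_not] using (hp.not.and hq.not).not

theorem const (b : Prop) : EvConst fun _ _ => b := fun _ _ => ⟨0, b, fun _ _ _ _ => Iff.rfl⟩

/-- Each instance stabilises at its own index, and only finitely many indices have a maximum.
Unbounded quantifiers would destroy stability. -/
theorem bforall {p : ℕ → Ordinal.{0} → Ordinal.{0} → Prop} (h : ∀ x, EvConst (p x)) :
    ∀ b : ℕ, EvConst fun γ δ => ∀ x < b, p x γ δ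
  | 0 => by simpa using EvConst.const True
  | b + 1 => by
    have := (bforall h b).and (h b)
    simpa [Nat.le_iff_lt_or_eq, or_imp, forall_and] using this

theorem bexists {p : ℕ → Ordinal.{0} → Ordinal.{0} → Prop} (h : ∀ x, EvConst (p x)) (b : ℕ) :
    EvConst fun γ δ => ∃ x < b, p x γ δ := by
  simpa using (bforall (fun x => (h x).not) b).not

/-- A monotone condition changes its truth value at most once along an increasing sequence. -/
theorem of_pos {p : Ordinal.{0} → Prop} (h : ∀ {δ δ'}, δ ≤ δ' → p δ → p δ') :
    EvConst fun _ δ => p δ := fun s hs => by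
  by_cases he : ∃ N, p (s N)
  · obtain ⟨N, hN⟩ := he
    exact ⟨N, True, fun i _ j hj => iff_true_intro (h (hs hj) hN)⟩
  · exact ⟨0, False, fun i _ j _ => iff_false_intro fun hj => he ⟨j, hj⟩⟩

end EvConst

/-- Literals admitted as cut formulas. -/
def Lit.Ok (D : Lit) : Prop := EvConst D.rel

theorem Lit.Ok.neg {D : Lit} (h : D.Ok) : (-D).Ok := EvConst.not h

/-! ### Rules for literals -/

/-- The conclusion is valid for all stages. -/
def axRule (Δ : Set Lit) : InfRule Lit := ⟨Δ, Empty, Empty.elim, 0⟩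

/-- Semantic consequence between literals. -/
def semRule (D : Lit) (E : ℕ → Lit) : InfRule Lit := ⟨{D}, ℕ, fun i => {.lit (E i)}, 0⟩

/-- Closure of `R_φ`. -/
noncomputable def closRule (φ : PosOp) (n : ℕ) : InfRule Lit :=
  ⟨{.mem φ n}, Unit, fun _ => {.lit (.step φ n)}, 0⟩

/-- Minimality of `R_φ` with respect to `σ`. -/
noncomputable def minRule (φ : PosOp) (σ : ℕ → Lit) (u : ℕ) : InfRule Lit :=
  ⟨{-.mem φ u, σ u}, ℕ, fun x => {.lit (-.opr φ σ x), .lit (σ x)}, 0⟩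

/-- Complete induction for `θ`. -/
def indRule (θ : ℕ → Lit) (m : ℕ) : InfRule Lit :=
  ⟨{θ m}, Option ℕ, fun o => o.elim {.lit (θ 0)} fun j => {.lit (-θ j), .lit (θ (j + 1))}, 0⟩

/-- The norm of `n` as a new parameter. -/
noncomputable def normRule (φ : PosOp) (n : ℕ) : InfRule Lit :=
  ⟨{-.mem φ n}, Unit, fun _ => ∅, φ.norm n⟩

/-- The rules that are common to both calculi. -/
def baseRules : Set (InfRule Lit) :=
  {ρ | (∃ Δ : Set Lit, (∀ γ δ, γ ≤ δ → δ < Om → ∃ D ∈ Δ, D.rel γ δ) ∧ ρ = axRule Δ) ∨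
    (∃ D E, (∀ γ δ, γ ≤ δ → δ < Om → (∀ i, (E i).rel γ δ) → D.rel γ δ) ∧ ρ = semRule D E) ∨
    ∃ φ n, ρ = closRule φ n}

/-- `σ` is a conjunction of a condition on the first stage and a condition on the second. -/
def Rect (σ : ℕ → Lit) : Prop :=
  ∀ n {γ δ γ' δ'}, (σ n).rel γ δ → (σ n).rel γ' δ' → (σ n).rel γ δ'

/-- The rules with minimality and induction. -/
def weakRules : Set (InfRule Lit) :=
  {ρ | ρ ∈ baseRules ∨ (∃ φ σ u, Rect σ ∧ ρ = minRule φ σ u) ∨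
    ∃ θ m, (∀ j, (θ j).Ok) ∧ ρ = indRule θ m}

/-- The rules with norms as parameters. -/
def normRules : Set (InfRule Lit) :=
  {ρ | ρ ∈ baseRules ∨ ∃ φ n δ, n ∈ φ.stage δ ∧ ρ = normRule φ n}

/-! ### Soundness for literal sequents -/

/-- `Γ` is valid if the negative occurrences are interpreted at stage `β` and the positive ones at
stage `ϑ(Ω · α + β)`. -/
def Val (ξ α : Ordinal.{0}) (Γ : Set (IFml Lit)) : Prop :=
  ∀ β, ξ ≤ β → β < Om → ∃ D, .lit D ∈ Γ ∧ D.rel β (fv α β)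

theorem Closed.add_lt {ρ x y : Ordinal.{0}} (hρ : Closed ρ) (hO : ρ < Om) (hx : x < ρ)
    (hy : y < ρ) : x + y < ρ :=
  hρ _ (.add (.lt hx) (.lt hy)) (add_lt_Om (hx.trans hO) (hy.trans hO))

theorem Closed.one_lt {ρ : Ordinal.{0}} (hρ : Closed ρ) : 1 < ρ := by
  have := hρ _ (.exp .zero) (by simpa using one_lt_Om)
  simpa using this

theorem fv_mono_left {ξ a α β : Ordinal.{0}} (hα : Ctl ξ α) (ha : Ctl ξ a) (hξ : ξ ≤ β)
    (hβ : β < Om) (h : a < α) : fv a β < fv α β :=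
  fv_lt_fv hα hξ hβ ha hξ (lt_fv hα hξ hβ) h

/-- The closure rule is the one that consumes stages: if φ(R_φ,n) holds at stage `fv a β`, then n
enters every later stage, and `fv α β` is later. -/
theorem Val.of_base {ξ α : Ordinal.{0}} {Γ : Set (IFml Lit)} {ρ : InfRule Lit}
    (hρ : ρ ∈ baseRules) (a : ρ.idx → Ordinal.{0}) (hα : Ctl ξ α) (hca : ∀ i, Ctl ξ (a i))
    (ha : ∀ i, a i < α) (hp : ∀ l ∈ ρ.prin, IFml.lit l ∈ Γ)
    (h : ∀ i, Val ξ (a i) (ρ.prem i ∪ Γ)) : Val ξ α Γ := by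
  intro β hξ hβ
  have hle := (lt_fv hα hξ hβ).le
  by_contra! hcon
  rcases hρ with ⟨Δ, hΔ, rfl⟩ | ⟨D, E, hD, rfl⟩ | ⟨φ, n, rfl⟩
  · obtain ⟨D, hD, hr⟩ := hΔ β (fv α β) hle (fv_lt_Om _ _)
    exact hcon D (hp D hD) hr
  · refine hcon D (hp D rfl) (hD _ _ hle (fv_lt_Om _ _) fun i => ?_)
    obtain ⟨D', hD' | hD', hr⟩ := h i β hξ hβ
    · cases hD'
      exact Lit.mono _ le_rfl (fv_mono_left hα (hca i) hξ hβ (ha i)).le hr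
    · exact (hcon D' hD' (Lit.mono _ le_rfl (fv_mono_left hα (hca i) hξ hβ (ha i)).le hr)).elim
  · have hlt := fv_mono_left hα (hca ()) hξ hβ (ha ())
    obtain ⟨D', hD' | hD', hr⟩ := h () β hξ hβ
    · cases hD'
      exact hcon (.mem φ n) (hp _ rfl) (PosOp.mem_stage.2 ⟨_, hlt, hr⟩)
    · exact (hcon D' hD' (Lit.mono _ le_rfl hlt.le hr)).elim

/-- Beyond the point of stability the order of the two stages no longer matters. -/
theorem EvConst.not_alternating {p : Ordinal.{0} → Ordinal.{0} → Prop} (hp : EvConst p)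
    {s : ℕ → Ordinal.{0}} (hs : Monotone s) (h : ∀ i, p (s i) (s (i + 1)))
    (h' : ∀ i, ¬ p (s (i + 1)) (s i)) : False := by
  obtain ⟨N, b, hb⟩ := hp s hs
  exact h' N ((hb _ (Nat.le_succ _) _ le_rfl).2 ((hb _ le_rfl _ (Nat.le_succ _)).1 (h N)))

/-! ### Cut, minimality and induction read at two stages -/

section Weak

variable {α β : Ordinal.{0}} {j : ℕ} {Γ : Set (IFml Lit)}

/-- Height α is interpreted at level 2α+1. The level 2α lies strictly between the premises' 2a+1 and
the conclusion's 2α+1, and it indexes the chain of intermediate stages s_ζ = ϑ(Ω·2α+(β+ζ)). -/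
theorem two_mul_add_one_lt {a α : Ordinal.{0}} (h : a < α) : 2 * a + 1 < 2 * α := by
  calc 2 * a + 1 < 2 * a + 2 := by simp
    _ = 2 * (a + 1) := by rw [mul_add, mul_one]
    _ ≤ 2 * α := by gcongr; exact Order.add_one_le_of_lt h

/-- If `Γ` fails at stages `β` and `δ = ϑ(Ω · (2α + 1) + β)`, then one of the remaining formulas of
a premise holds at any two successive stages of the form `ϑ(Ω · 2α + (β + ζ))` below `δ`. -/
theorem premise_of_not (ht : 2 * α + 1 < omegaTower j) (hβ : β < Om)
    (hcon : ∀ D, .lit D ∈ Γ → ¬ D.rel β (fv (2 * α + 1) β)) {a : Ordinal.{0}} (ha : a < α)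
    {P : Set (IFml Lit)} (hv : Val 0 (2 * a + 1) (P ∪ Γ)) {ζ η : Ordinal.{0}} (hζ : ζ < η)
    (hη : β + η < fv (2 * α + 1) β) :
    ∃ D, .lit D ∈ P ∧ D.rel (fv (2 * α) (β + ζ)) (fv (2 * α) (β + η)) := by
  have hlt := two_mul_add_one_lt ha
  have h2 : Ctl 0 (2 * α) := Ctl.of_lt_omegaTower 0 ((lt_add_one _).trans ht)
  have h1 : Ctl 0 (2 * α + 1) := Ctl.of_lt_omegaTower 0 ht
  have h0 : Ctl 0 (2 * a + 1) := Ctl.of_lt_omegaTower 0 (hlt.trans ((lt_add_one _).trans ht))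
  have hηO := hη.trans (fv_lt_Om _ _)
  have hζη : β + ζ < β + η := by simpa using hζ
  obtain ⟨D, hD, hr⟩ := hv (fv (2 * α) (β + ζ)) zero_le (fv_lt_Om _ _)
  have hs := fv_strictMono_right h2 zero_le hζη hηO
  have hr' : D.rel (fv (2 * α) (β + ζ)) (fv (2 * α) (β + η)) :=
    D.mono le_rfl (fv_lt_fv h2 zero_le hηO h0 zero_le hs hlt).le hr
  rcases hD with hD | hD
  · exact ⟨D, hD, hr'⟩
  · refine (hcon D hD (D.mono ?_ ?_ hr')).elim
    · exact (le_self_add.trans_lt (lt_fv h2 zero_le (hζη.trans hηO))).le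
    · exact (fv_lt_fv h1 zero_le hβ h2 zero_le hη (lt_add_one _)).le

theorem chain_mono (h2 : Ctl 0 (2 * α)) (hβ : β < Om) :
    Monotone fun i : ℕ => fv (2 * α) (β + i) :=
  monotone_nat_of_le_succ fun i =>
    (fv_strictMono_right h2 zero_le (by simp)
      (add_lt_Om hβ ((natCast_lt_omega0 _).trans omega0_lt_Om))).le

/-- If the conclusion failed at its two stages, the premises would make D alternate along the chain
s_i for i < ω, all of it below ϑ(Ω·(2α+1)+β). -/
theorem Val.weak_cut (ht : 2 * α + 1 < omegaTower j) {a b : Ordinal.{0}} (ha : a < α) (hb : b < α)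
    {D : Lit} (hD : D.Ok) (h : Val 0 (2 * a + 1) (insert (.lit D) Γ))
    (h' : Val 0 (2 * b + 1) (insert (.lit (-D)) Γ)) : Val 0 (2 * α + 1) Γ := by
  intro β _ hβ
  by_contra! hcon
  have h1 : Ctl 0 (2 * α + 1) := Ctl.of_lt_omegaTower 0 ht
  have h2 : Ctl 0 (2 * α) := Ctl.of_lt_omegaTower 0 ((lt_add_one _).trans ht)
  have hcl := fv_closed h1 zero_le hβ
  have hn : ∀ i : ℕ, β + i < fv (2 * α + 1) β := fun i =>
    hcl.add_lt (fv_lt_Om _ _) (lt_fv h1 zero_le hβ)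
      (hcl _ (Ctl.nat 0 i _ hcl hcl.pos) ((natCast_lt_omega0 _).trans omega0_lt_Om))
  refine EvConst.not_alternating hD (chain_mono h2 hβ) (fun i => ?_) fun i => ?_
  · obtain ⟨E, hE, hr⟩ := premise_of_not ht hβ hcon ha (P := {.lit D}) h
      (ζ := i) (η := (i + 1 : ℕ)) (by simp) (hn _)
    cases hE
    exact hr
  · obtain ⟨E, hE, hr⟩ := premise_of_not ht hβ hcon hb (P := {.lit (-D)}) h'
      (ζ := i) (η := (i + 1 : ℕ)) (by simp) (hn _)
    cases hE
    exact hr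

theorem Val.weak_rule (ht : 2 * α + 1 < omegaTower j) {ρ : InfRule Lit} (hρ : ρ ∈ weakRules)
    (a : ρ.idx → Ordinal.{0}) (ha : ∀ i, a i < α) (hp : ∀ l ∈ ρ.prin, IFml.lit l ∈ Γ)
    (h : ∀ i, Val 0 (2 * a i + 1) (ρ.prem i ∪ Γ)) : Val 0 (2 * α + 1) Γ := by
  have h1 : Ctl 0 (2 * α + 1) := Ctl.of_lt_omegaTower 0 ht
  have h2 : Ctl 0 (2 * α) := Ctl.of_lt_omegaTower 0 ((lt_add_one _).trans ht)
  rcases hρ with hρ | ⟨φ, σ, u, hσ, rfl⟩ | ⟨θ, m, hθ, rfl⟩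
  · have hlt : ∀ i, 2 * a i + 1 < 2 * α + 1 := fun i =>
      (two_mul_add_one_lt (ha i)).trans (lt_add_one _)
    exact .of_base hρ _ h1 (fun i => Ctl.of_lt_omegaTower 0 ((hlt i).trans ht)) hlt hp h
  · intro β _ hβ
    by_contra! hcon
    set δ := fv (2 * α + 1) β with hδ
    have hcl := fv_closed h1 zero_le hβ
    have hβδ : β < δ := lt_fv h1 zero_le hβ
    have hadd : ∀ {x y}, x < δ → y < δ → x + y < δ := fun hx hy =>
      hcl.add_lt (fv_lt_Om _ _) hx hy
    have hsm : ∀ {ζ η}, ζ ≤ η → η < δ → fv (2 * α) (β + ζ) ≤ fv (2 * α) (β + η) := by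
      intro ζ η hζ hη
      rcases hζ.eq_or_lt with rfl | hlt
      · exact le_rfl
      · exact (fv_strictMono_right h2 zero_le (by simpa using hlt)
          ((hadd hβδ hη).trans (fv_lt_Om _ _))).le
    have hu : u ∈ φ.stage β := by
      have := hcon _ (hp (-.mem φ u) (by simp [minRule]))
      simpa [Lit.mem] using this
    -- Along the chain s_ζ, an element of stage ξ satisfies σ with positive stage s_ξ and an
    -- arbitrary negative stage s_ζ. The freedom in ζ is essential: inside ¬φ(σ,y) the stages are
    -- exchanged, so the induction hypothesis is used at the later stage s_{η+1}.
    have main : ∀ ξ < δ, ∀ y ∈ φ.stage ξ, ∀ ζ < δ,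
        (σ y).rel (fv (2 * α) (β + ζ)) (fv (2 * α) (β + ξ)) := by
      intro ξ
      induction ξ using WellFoundedLT.induction with
      | ind ξ ih =>
        intro hξ y hy ζ hζ
        obtain ⟨b, hb, hyb⟩ := PosOp.mem_stage.1 hy
        have hbδ := hb.trans hξ
        have step : ∀ η < δ, b ≤ η →
            (σ y).rel (fv (2 * α) (β + η)) (fv (2 * α) (β + (η + 1))) := by
          intro η hη hbη
          have hη1 := hadd hη hcl.one_lt
          obtain ⟨E, hE, hr⟩ := premise_of_not ht hβ hcon (ha y) (h y)
            (lt_add_one η) (hadd hβδ hη1)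
          rcases hE with hE | hE
          · cases hE
            refine (hr (φ.toHom.monotone (fun z hz => ?_) hyb)).elim
            exact (σ z).mono le_rfl (hsm hbη hη) (ih b hb hbδ z hz _ hη1)
          · cases hE
            exact hr
        -- `Rect` joins the positive stage of `e1`, which is at most s_ξ because b + 1 ≤ ξ, with the
        -- negative stage of `e2`, which is at least s_ζ.
        have e1 := step b hbδ le_rfl
        have e2 := step (max ζ b) (max_lt hζ hbδ) (le_max_right _ _)
        exact (σ y).mono (hsm (le_max_left _ _) (max_lt hζ hbδ))
          (hsm (Order.add_one_le_of_lt hb) hξ) (hσ y e2 e1)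
    refine hcon _ (hp (σ u) (by simp [minRule])) ((σ u).mono ?_ ?_ (main β hβδ u hu 0 hcl.pos))
    · rw [add_zero]
      exact (lt_fv h2 zero_le hβ).le
    · exact (fv_lt_fv h1 zero_le hβ h2 zero_le (hadd hβδ hβδ) (lt_add_one _)).le
  · intro β _ hβ
    by_contra! hcon
    have hcl := fv_closed h1 zero_le hβ
    have hn : ∀ i : ℕ, β + i < fv (2 * α + 1) β := fun i =>
      hcl.add_lt (fv_lt_Om _ _) (lt_fv h1 zero_le hβ)
        (hcl _ (Ctl.nat 0 i _ hcl hcl.pos) ((natCast_lt_omega0 _).trans omega0_lt_Om))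
    -- Each instance of θ is true from some index of the chain on. The index may grow with t, but
    -- for every numeral it remains finite.
    have main : ∀ t, ∃ N : ℕ, ∀ i ≥ N, ∀ k ≥ N,
        (θ t).rel (fv (2 * α) (β + i)) (fv (2 * α) (β + k)) := by
      intro t
      induction t with
      | zero =>
        obtain ⟨N, b, hb⟩ := hθ 0 _ (chain_mono h2 hβ)
        obtain ⟨E, hE, hr⟩ := premise_of_not ht hβ hcon (ha none) (h none)
          (ζ := N) (η := (N + 1 : ℕ)) (by simp) (hn _)
        cases hE
        have hbt := (hb _ le_rfl _ (Nat.le_succ N)).1 hr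
        exact ⟨N, fun i hi k hk => (hb i hi k hk).2 hbt⟩
      | succ t ih =>
        obtain ⟨M, hM⟩ := ih
        obtain ⟨N', b, hb⟩ := hθ (t + 1) _ (chain_mono h2 hβ)
        obtain ⟨N, hNM, hNN⟩ : ∃ N, M ≤ N ∧ N' ≤ N := ⟨_, le_max_left _ _, le_max_right _ _⟩
        obtain ⟨E, hE, hr⟩ := premise_of_not ht hβ hcon (ha (some t)) (h (some t))
          (ζ := N) (η := (N + 1 : ℕ)) (by simp) (hn _)
        rcases hE with hE | hE
        · cases hE
          exact (hr (hM _ (hNM.trans (Nat.le_succ N)) _ hNM)).elim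
        · cases hE
          have hbt := (hb _ hNN _ (hNN.trans (Nat.le_succ N))).1 hr
          exact ⟨N', fun i hi k hk => (hb i hi k hk).2 hbt⟩
    obtain ⟨N, hN⟩ := main m
    refine hcon _ (hp (θ m) rfl) ((θ m).mono ?_ ?_ (hN N le_rfl N le_rfl))
    · exact (le_self_add.trans_lt (lt_fv h2 zero_le ((hn N).trans (fv_lt_Om _ _)))).le
    · exact (fv_lt_fv h1 zero_le hβ h2 zero_le (hn N) (lt_add_one _)).le

end Weak

/-! ### The two calculi -/

/-- The calculus with minimality and induction rules and without control of heights. -/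
def weakCalc : Calc Lit where
  rules := weakRules
  ctl _ _ := True
  ok := Lit.Ok
  ctl_mono _ h := h
  ctl_add _ _ := trivial
  ctl_nat _ _ := trivial
  ok_neg _ h := h.neg

/-- The calculus with norms as parameters. -/
def normCalc : Calc Lit where
  rules := normRules
  ctl := Ctl
  ok := Lit.Ok
  ctl_mono := Ctl.mono
  ctl_add := Ctl.add
  ctl_nat := Ctl.nat
  ok_neg _ h := h.neg

/-- Sequents of literals. -/
def LitSeq (Γ : Set (IFml Lit)) : Prop := ∀ A ∈ Γ, ∃ D, A = .lit D

theorem LitSeq.insert {Γ : Set (IFml Lit)} (h : LitSeq Γ) (D : Lit) :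
    LitSeq (insert (.lit D) Γ) := by
  rintro A (rfl | hA)
  exacts [⟨D, rfl⟩, h A hA]

theorem LitSeq.base {Γ : Set (IFml Lit)} (h : LitSeq Γ) {ρ : InfRule Lit} (hρ : ρ ∈ baseRules)
    (i : ρ.idx) : LitSeq (ρ.prem i ∪ Γ) := by
  rintro A (hA | hA)
  · rcases hρ with ⟨Δ, hΔ, rfl⟩ | ⟨D, E, hD, rfl⟩ | ⟨φ, n, rfl⟩
    · exact i.elim
    · exact ⟨_, hA⟩
    · exact ⟨_, hA⟩
  · exact h A hA

theorem LitSeq.weak {Γ : Set (IFml Lit)} (h : LitSeq Γ) {ρ : InfRule Lit} (hρ : ρ ∈ weakRules)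
    (i : ρ.idx) : LitSeq (ρ.prem i ∪ Γ) := by
  rcases hρ with hρ | ⟨φ, σ, u, _, rfl⟩ | ⟨θ, m, _, rfl⟩
  · exact h.base hρ i
  · rintro A ((rfl | rfl) | hA)
    exacts [⟨_, rfl⟩, ⟨_, rfl⟩, h A hA]
  · cases i with
    | none =>
      rintro A (rfl | hA)
      exacts [⟨_, rfl⟩, h A hA]
    | some k =>
      rintro A ((rfl | rfl) | hA)
      exacts [⟨_, rfl⟩, ⟨_, rfl⟩, h A hA]

theorem Der.val_weak {j : ℕ} {ξ α : Ordinal.{0}} {Γ : Set (IFml Lit)}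
    (h : Der weakCalc 0 ξ α Γ) (hΓ : LitSeq Γ) (ht : 2 * α + 1 < omegaTower j) :
    Val 0 (2 * α + 1) Γ := by
  have hlt : ∀ {a α : Ordinal.{0}}, a < α → 2 * α + 1 < omegaTower j →
      2 * a + 1 < omegaTower j := fun ha ht =>
    (two_mul_add_one_lt ha).trans ((lt_add_one _).trans ht)
  induction h with
  | conj f _ _ hf => obtain ⟨D, hD⟩ := hΓ _ hf; cases hD
  | disj f _ _ _ hf => obtain ⟨D, hD⟩ := hΓ _ hf; cases hD
  | cut C a b _ hC ha hb _ _ ihd ihe =>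
    cases C with
    | lit D =>
      exact .weak_cut ht ha hb hC (ihd (hΓ.insert D) (hlt ha ht))
        (ihe (hΓ.insert (-D)) (hlt hb ht))
    | conj f => exact hC.elim
    | disj f => exact hC.elim
  | rule ρ a _ hρ hp ha _ ih =>
    exact .weak_rule ht hρ a ha hp fun i => ih i (hΓ.weak hρ i) (hlt (ha i) ht)

/-- Heights may now be uncountable and depend on parameters, so each inequality between values of ϑ
needs β above the current parameter. That is what the side condition ξ ≤ β in `Val` provides. -/
theorem Der.val_norm {ξ α : Ordinal.{0}} {Γ : Set (IFml Lit)}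
    (h : Der normCalc 0 ξ α Γ) (hΓ : LitSeq Γ) : Val ξ α Γ := by
  induction h with
  | conj f _ _ hf => obtain ⟨D, hD⟩ := hΓ _ hf; cases hD
  | disj f _ _ _ hf => obtain ⟨D, hD⟩ := hΓ _ hf; cases hD
  | @cut ξ α Γ C a b hc hC ha hb hd he ihd ihe =>
    cases C with
    | conj f => exact hC.elim
    | disj f => exact hC.elim
    | lit D =>
      have ihd := ihd (hΓ.insert D)
      have ihe := ihe (hΓ.insert (-D))
      intro β hξ hβ
      by_contra! hcon
      have hα : Ctl ξ α := hc
      have hca : Ctl ξ a := hd.ctl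
      have hcb : Ctl ξ b := he.ctl
      have hcm : Ctl ξ (max a b) := hca.max hcb
      have hm := max_lt ha hb
      -- Without minimality rules a chain of length ω suffices; iterating at level `max a b` keeps
      -- it below `fv α β`, as that ordinal is closed under smaller levels.
      let s : ℕ → Ordinal.{0} := fun n => (fv (max a b))^[n] β
      have hs1 : ∀ n, s (n + 1) = fv (max a b) (s n) := fun n =>
        Function.iterate_succ_apply' _ n β
      have hs : ∀ n, β ≤ s n ∧ s n < fv α β := by
        intro n
        induction n with
        | zero => exact ⟨le_rfl, lt_fv hα hξ hβ⟩
        | succ n ih =>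
          rw [hs1]
          exact ⟨ih.1.trans (lt_fv hcm (hξ.trans ih.1) (ih.2.trans (fv_lt_Om _ _))).le,
            fv_lt_fv hα hξ hβ hcm (hξ.trans ih.1) ih.2 hm⟩
      have hsO : ∀ n, s n < Om := fun n => (hs n).2.trans (fv_lt_Om _ _)
      have hle : ∀ {c}, Ctl ξ c → c ≤ max a b → ∀ n, fv c (s n) ≤ s (n + 1) := by
        intro c hc hcm' n
        rw [hs1]
        rcases hcm'.eq_or_lt with h | h
        · rw [h]
        · exact (fv_mono_left hcm hc (hξ.trans (hs n).1) (hsO n) h).le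
      have key : ∀ {E : Lit} {c}, Ctl ξ c → c ≤ max a b → Val ξ c (insert (.lit E) Γ) → ∀ n,
          E.rel (s n) (s (n + 1)) := by
        intro E c hc hcm' hv n
        obtain ⟨D', hD' | hD', hr⟩ := hv (s n) (hξ.trans (hs n).1) (hsO n)
        · cases hD'
          exact E.mono le_rfl (hle hc hcm' n) hr
        · exact (hcon D' hD' (D'.mono (hs n).1 ((hle hc hcm' n).trans (hs (n + 1)).2.le) hr)).elim
      refine EvConst.not_alternating hC (s := s) (monotone_nat_of_le_succ fun n => ?_)
        (key hca (le_max_left _ _) ihd) (key hcb (le_max_right _ _) ihe)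
      rw [hs1]
      exact (lt_fv hcm (hξ.trans (hs n).1) (hsO n)).le
  | @rule ξ α Γ ρ a hc hρ hp ha hd ih =>
    rcases hρ with hρ | ⟨φ, n, δ, hn, rfl⟩
    · have hpar : max ξ ρ.par = ξ := by
        rcases hρ with ⟨Δ, hΔ, rfl⟩ | ⟨D, E, hD, rfl⟩ | ⟨φ, n, rfl⟩ <;>
          exact max_eq_left zero_le
      rw [hpar] at hd ih
      exact .of_base hρ a hc (fun i => (hd i).ctl) ha hp fun i => ih i (hΓ.base hρ i)
    · intro β hξ hβ
      -- Either n has appeared by stage β, and then its norm is below β and may serve as a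
      -- parameter, or the principal literal n ∉ R_φ is itself true at β.
      by_cases hnβ : n ∈ φ.stage β
      · have hmax : max ξ (φ.norm n) ≤ β := max_le hξ (PosOp.norm_lt hnβ).le
        obtain ⟨D, hD | hD, hr⟩ := ih () (by rintro A (hA | hA); exacts [hA.elim, hΓ A hA]) β
          hmax hβ
        · exact hD.elim
        · exact ⟨D, hD, D.mono le_rfl
            (fv_mono_left (Ctl.mono (le_max_left _ _) hc) (hd ()).ctl hmax hβ (ha ())).le hr⟩
      · exact ⟨_, hp (-.mem φ n) rfl, hnβ⟩

/-! ### Translation of formulas -/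

namespace Term

theorem val_subst {n m : ℕ} (e : Fin n → Term m) (v : Fin m → ℕ) :
    ∀ t : Term n, (t.subst e).val v = t.val fun i => (e i).val v
  | var _ => rfl
  | app f ts => by simp [subst, val, fun i => val_subst e v (ts i)]

theorem val_shift {n : ℕ} (t : Term n) (x : ℕ) (v : Fin n → ℕ) :
    t.shift.val (Fin.cons x v : Fin (n + 1) → ℕ) = t.val v := by
  simp [shift, val_subst, val]

theorem val_up {n m : ℕ} (e : Fin n → Term m) (x : ℕ) (v : Fin m → ℕ) :
    (fun i => (up e i).val (Fin.cons x v : Fin (m + 1) → ℕ)) =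
      (Fin.cons x fun i => (e i).val v : Fin (n + 1) → ℕ) := by
  funext i
  refine Fin.cases ?_ (fun i => ?_) i
  · simp [up, val]
  · simp [up, val_shift]

theorem val_zero {n : ℕ} (v : Fin n → ℕ) : (zero : Term n).val v = 0 := rfl

theorem val_succ {n : ℕ} (t : Term n) (v : Fin n → ℕ) : (succ t).val v = t.val v + 1 := rfl

theorem val_numeral {n : ℕ} (v : Fin n → ℕ) : ∀ k, (numeral k : Term n).val v = k
  | 0 => rfl
  | k + 1 => by rw [numeral, val_succ, val_numeral]

end Term

namespace IFml

variable {Λ : Type*}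

/-- The literal expressed by a formula. -/
def ev (val : Λ → Lit) : IFml Λ → Lit
  | lit l => val l
  | conj f => .all fun i => (f i).ev val
  | disj f => .ex fun i => (f i).ev val

theorem ev_neg [InvolutiveNeg Λ] {val : Λ → Lit} (h : ∀ l, val (-l) = -val l) :
    ∀ A : IFml Λ, (-A).ev val = -A.ev val
  | lit l => h l
  | conj f => by
    ext γ δ
    simp [ev, Lit.all, Lit.ex, fun i => ev_neg h (f i)]
  | disj f => by
    ext γ δ
    simp [ev, Lit.all, Lit.ex, fun i => ev_neg h (f i)]

/-- An atomic formula of the outer language. -/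
def atom (D : Lit) : IFml (IFml Lit) := .lit (.lit D)

end IFml

namespace Fml

variable {Φ : Set PosOp}

/-- The infinitary formula expressing a formula under an assignment. -/
noncomputable def tr : {n : ℕ} → Fml Φ n → (Fin n → ℕ) → IFml (IFml Lit)
  | _, eq t s, v => .atom (.const (t.val v = s.val v))
  | _, neq t s, v => .atom (-.const (t.val v = s.val v))
  | _, lt t s, v => .atom (.const (t.val v < s.val v))
  | _, nlt t s, v => .atom (-.const (t.val v < s.val v))
  | _, pos p t, v => .atom (.mem p.1 (t.val v))
  | _, neg p t, v => .atom (-.mem p.1 (t.val v))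
  | _, and A B, v => .conj (IFml.two (A.tr v) (B.tr v))
  | _, or A B, v => .disj (IFml.two (A.tr v) (B.tr v))
  | _, all A, v => .conj fun x => A.tr (Fin.cons x v)
  | _, ex A, v => .disj fun x => A.tr (Fin.cons x v)

theorem tr_not : ∀ {n : ℕ} (A : Fml Φ n) (v : Fin n → ℕ), A.not.tr v = -A.tr v
  | _, eq _ _, _ => rfl
  | _, neq _ _, _ => by simp [not, tr, IFml.atom]
  | _, lt _ _, _ => rfl
  | _, nlt _ _, _ => by simp [not, tr, IFml.atom]
  | _, pos _ _, _ => rfl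
  | _, neg _ _, _ => by simp [not, tr, IFml.atom]
  | _, and A B, v => by simp [not, tr, tr_not A, tr_not B, IFml.two_map]
  | _, or A B, v => by simp [not, tr, tr_not A, tr_not B, IFml.two_map]
  | _, all A, v => by simp [not, tr, tr_not A]
  | _, ex A, v => by simp [not, tr, tr_not A]

theorem tr_subst : ∀ {n m : ℕ} (A : Fml Φ n) (e : Fin n → Term m) (v : Fin m → ℕ),
    (A.subst e).tr v = A.tr fun i => (e i).val v
  | _, _, eq _ _, _, _ => by simp [subst, tr, Term.val_subst]
  | _, _, neq _ _, _, _ => by simp [subst, tr, Term.val_subst]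
  | _, _, lt _ _, _, _ => by simp [subst, tr, Term.val_subst]
  | _, _, nlt _ _, _, _ => by simp [subst, tr, Term.val_subst]
  | _, _, pos _ _, _, _ => by simp [subst, tr, Term.val_subst]
  | _, _, neg _ _, _, _ => by simp [subst, tr, Term.val_subst]
  | _, _, and A B, e, v => by simp [subst, tr, tr_subst A, tr_subst B]
  | _, _, or A B, e, v => by simp [subst, tr, tr_subst A, tr_subst B]
  | _, _, all A, e, v => by simp [subst, tr, tr_subst A, Term.val_up]
  | _, _, ex A, e, v => by simp [subst, tr, tr_subst A, Term.val_up]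

theorem tr_shift {n : ℕ} (A : Fml Φ n) (x : ℕ) (v : Fin n → ℕ) :
    A.shift.tr (Fin.cons x v : Fin (n + 1) → ℕ) = A.tr v := by
  simp [shift, tr_subst, Term.val]

theorem tr_inst {n : ℕ} (A : Fml Φ (n + 1)) (t : Term n) (v : Fin n → ℕ) :
    (A.inst t).tr v = A.tr (Fin.cons (t.val v) v) := by
  rw [inst, tr_subst]
  congr 1
  funext i
  refine Fin.cases ?_ (fun i => ?_) i <;> simp [Term.val]

theorem tr_shiftParam {n : ℕ} (A : Fml Φ (n + 1)) (x y : ℕ) (v : Fin n → ℕ) :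
    A.shiftParam.tr (Fin.cons x (Fin.cons y v) : Fin (n + 2) → ℕ) = A.tr (Fin.cons x v) := by
  rw [shiftParam, tr_subst]
  congr 1
  funext i
  refine Fin.cases ?_ (fun i => ?_) i <;> simp [Term.val]

theorem tr_ofSentence {n : ℕ} (A : Fml Φ 0) (v : Fin n → ℕ) :
    (A.ofSentence : Fml Φ n).tr v = A.tr Fin.elim0 := by
  rw [ofSentence, tr_subst]
  congr 1
  funext i
  exact i.elim0

/-- The nesting depth of connectives. -/
def depth : {n : ℕ} → Fml Φ n → ℕ
  | _, and A B => max A.depth B.depth + 1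
  | _, or A B => max A.depth B.depth + 1
  | _, all A => A.depth + 1
  | _, ex A => A.depth + 1
  | _, _ => 0

/-- The literal expressed by a formula under an assignment. -/
noncomputable def sem {n : ℕ} (A : Fml Φ n) (v : Fin n → ℕ) : Lit := (A.tr v).ev (IFml.ev id)

theorem sem_not {n : ℕ} (A : Fml Φ n) (v : Fin n → ℕ) : A.not.sem v = -A.sem v := by
  rw [sem, tr_not, IFml.ev_neg (val := IFml.ev id) (IFml.ev_neg (val := id) fun _ => rfl)]
  rfl

section

variable {n : ℕ} (A B : Fml Φ n) (C : Fml Φ (n + 1)) (v : Fin n → ℕ) (γ δ : Ordinal.{0})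

theorem sem_and : ((A.and B).sem v).rel γ δ ↔ (A.sem v).rel γ δ ∧ (B.sem v).rel γ δ :=
  ⟨fun h => ⟨h 0, h 1⟩, fun h i => by cases i; exacts [h.1, h.2]⟩

theorem sem_or : ((A.or B).sem v).rel γ δ ↔ (A.sem v).rel γ δ ∨ (B.sem v).rel γ δ := by
  constructor
  · rintro ⟨_ | i, h⟩
    exacts [.inl h, .inr h]
  · rintro (h | h)
    exacts [⟨0, h⟩, ⟨1, h⟩]

theorem sem_all : (C.all.sem v).rel γ δ ↔ ∀ x, (C.sem (Fin.cons x v)).rel γ δ := Iff.rfl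

theorem sem_ex : (C.ex.sem v).rel γ δ ↔ ∃ x, (C.sem (Fin.cons x v)).rel γ δ := Iff.rfl

end

theorem Positive.sem_congr : ∀ {n : ℕ} (A : Fml Φ n), A.Positive → ∀ (v : Fin n → ℕ)
    {γ γ' δ : Ordinal.{0}}, (A.sem v).rel γ δ → (A.sem v).rel γ' δ
  | _, eq _ _, _, _, _, _, _, h => h
  | _, neq _ _, _, _, _, _, _, h => h
  | _, lt _ _, _, _, _, _, _, h => h
  | _, nlt _ _, _, _, _, _, _, h => h
  | _, pos _ _, _, _, _, _, _, h => h
  | _, and A B, hA, v, γ, γ', δ, h => by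
    rw [sem_and] at h ⊢
    exact ⟨sem_congr A hA.1 v h.1, sem_congr B hA.2 v h.2⟩
  | _, or A B, hA, v, γ, γ', δ, h => by
    rw [sem_or] at h ⊢
    exact h.imp (sem_congr A hA.1 v) (sem_congr B hA.2 v)
  | _, all A, hA, v, γ, γ', δ, h => fun x => sem_congr A hA _ (h x)
  | _, ex A, hA, v, γ, γ', δ, h => by
    obtain ⟨x, hx⟩ := (sem_ex A v γ δ).1 h
    exact (sem_ex A v γ' δ).2 ⟨x, sem_congr A hA _ hx⟩

theorem Negative.not : ∀ {n : ℕ} (A : Fml Φ n), A.Negative → A.not.Positive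
  | _, eq _ _, _ => trivial
  | _, neq _ _, _ => trivial
  | _, lt _ _, _ => trivial
  | _, nlt _ _, _ => trivial
  | _, neg _ _, _ => trivial
  | _, and A B, h => ⟨Negative.not A h.1, Negative.not B h.2⟩
  | _, or A B, h => ⟨Negative.not A h.1, Negative.not B h.2⟩
  | _, all A, h => Negative.not A h
  | _, ex A, h => Negative.not A h

theorem Negative.sem_congr {n : ℕ} {A : Fml Φ n} (hA : A.Negative) (v : Fin n → ℕ)
    {γ δ δ' : Ordinal.{0}} (h : (A.sem v).rel γ δ) : (A.sem v).rel γ δ' := by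
  by_contra hc
  have : (A.not.sem v).rel δ' γ := by rw [sem_not]; exact hc
  have := Positive.sem_congr _ (Negative.not A hA) v (γ' := δ) this
  rw [sem_not] at this
  exact this h

theorem Positive.sem_ok {n : ℕ} {A : Fml Φ n} (hA : A.Positive) (v : Fin n → ℕ) :
    (A.sem v).Ok := by
  have := EvConst.of_pos (p := fun δ => (A.sem v).rel 0 δ) fun hδ h => Lit.mono _ le_rfl hδ h
  have e : (A.sem v).rel = fun _ δ => (A.sem v).rel 0 δ := by
    funext γ δ
    exact propext ⟨Positive.sem_congr A hA v, Positive.sem_congr A hA v⟩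
  rw [Lit.Ok, e]
  exact this

theorem Negative.sem_ok {n : ℕ} {A : Fml Φ n} (hA : A.Negative) (v : Fin n → ℕ) :
    (A.sem v).Ok := by
  have := (Positive.sem_ok (Negative.not A hA) v).neg
  rwa [sem_not, neg_neg] at this

theorem sem_ball {n : ℕ} (t : Term n) (A : Fml Φ (n + 1)) (v : Fin n → ℕ) (γ δ : Ordinal.{0}) :
    ((ball t A).sem v).rel γ δ ↔ ∀ x < t.val v, (A.sem (Fin.cons x v)).rel γ δ := by
  rw [ball, sem_all]
  refine forall_congr' fun x => ?_
  rw [sem_or, imp_iff_not_or]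
  refine or_congr_left ?_
  show ¬ ((Term.var (0 : Fin (n + 1))).val _ < t.shift.val _) ↔ _
  rw [Term.val_shift]
  rfl

theorem sem_bex {n : ℕ} (t : Term n) (A : Fml Φ (n + 1)) (v : Fin n → ℕ) (γ δ : Ordinal.{0}) :
    ((bex t A).sem v).rel γ δ ↔ ∃ x < t.val v, (A.sem (Fin.cons x v)).rel γ δ := by
  rw [bex, sem_ex]
  refine exists_congr fun x => ?_
  rw [sem_and]
  refine and_congr_left fun _ => ?_
  show ((Term.var (0 : Fin (n + 1))).val _ < t.shift.val _) ↔ _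
  rw [Term.val_shift]
  rfl

/-- The formulas of the lowest level have eventually constant truth values. -/
theorem _root_.WeakID.Hier.sem_ok {s : Side} {k n : ℕ} {A : Fml Φ n} (h : Hier s k A) :
    k = 0 → ∀ v, (A.sem v).Ok := by
  induction h with
  | positive s hA => exact fun _ v => Positive.sem_ok hA v
  | step => intro h; cases h
  | not _ ih =>
    intro hk v
    rw [sem_not]
    exact (ih hk v).neg
  | and _ _ ihA ihB =>
    intro hk v
    have := EvConst.and (ihA hk v) (ihB hk v)
    simpa only [Lit.Ok, ← sem_and] using this
  | or _ _ ihA ihB =>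
    intro hk v
    have := EvConst.or (ihA hk v) (ihB hk v)
    simpa only [Lit.Ok, ← sem_or] using this
  | ball t _ ih =>
    intro hk v
    have := EvConst.bforall (fun x => ih hk (Fin.cons x v)) (t.val v)
    simpa only [Lit.Ok, ← sem_ball] using this
  | bex t _ ih =>
    intro hk v
    have := EvConst.bexists (fun x => ih hk (Fin.cons x v)) (t.val v)
    simpa only [Lit.Ok, ← sem_bex] using this
  | all => intro h; cases h
  | ex => intro h; cases h

/-- Positivity of φ is needed because a negated occurrence of σ would be read with the two stages
exchanged. -/
theorem sem_substPred : ∀ {m n : ℕ} (φ : Fml Unit m), φ.Positive → ∀ (e : Fin m → Term n)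
    (σ : Fml Φ (n + 1)) (v : Fin n → ℕ) (γ δ : Ordinal.{0}),
    ((φ.substPred e σ).sem v).rel γ δ ↔
      φ.Sat (fun _ => {y | (σ.sem (Fin.cons y v)).rel γ δ}) fun i => (e i).val v
  | _, _, eq _ _, _, _, _, _, _, _ => by
    simp [substPred, Sat, sem, tr, IFml.atom, IFml.ev, Lit.const, Term.val_subst]
  | _, _, neq _ _, _, _, _, _, _, _ => by
    simp [substPred, Sat, sem, tr, IFml.atom, IFml.ev, Lit.const, Term.val_subst]
  | _, _, lt _ _, _, _, _, _, _, _ => by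
    simp [substPred, Sat, sem, tr, IFml.atom, IFml.ev, Lit.const, Term.val_subst]
  | _, _, nlt _ _, _, _, _, _, _, _ => by
    simp [substPred, Sat, sem, tr, IFml.atom, IFml.ev, Lit.const, Term.val_subst]
  | _, _, pos _ t, _, e, σ, v, γ, δ => by
    rw [substPred, sem, tr_inst, Term.val_subst]
    rfl
  | _, _, neg _ _, h, _, _, _, _, _ => h.elim
  | _, _, and A B, h, e, σ, v, γ, δ => by
    rw [substPred, sem_and, sem_substPred A h.1, sem_substPred B h.2, Sat]
  | _, _, or A B, h, e, σ, v, γ, δ => by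
    rw [substPred, sem_or, sem_substPred A h.1, sem_substPred B h.2, Sat]
  | _, _, all A, h, e, σ, v, γ, δ => by
    rw [substPred, sem_all, Sat]
    refine forall_congr' fun x => ?_
    rw [sem_substPred A h, Term.val_up]
    simp only [sem, tr_shiftParam]
  | _, _, ex A, h, e, σ, v, γ, δ => by
    rw [substPred, sem_ex, Sat]
    refine exists_congr fun x => ?_
    rw [sem_substPred A h, Term.val_up]
    simp only [sem, tr_shiftParam]

theorem tr_rkLe {k : ℕ} : ∀ {n : ℕ} (A : Fml Φ n) (v : Fin n → ℕ) {q : ℕ}, A.depth ≤ q →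
    (A.tr v).RkLe (fun N => N.RkLe Lit.Ok k) q
  | _, eq _ _, _, _, _ => EvConst.const _
  | _, neq _ _, _, _, _ => (EvConst.const _).not
  | _, lt _ _, _, _, _ => EvConst.const _
  | _, nlt _ _, _, _, _ => (EvConst.const _).not
  | _, pos p t, v, _, _ => Positive.sem_ok (A := pos p t) trivial v
  | _, neg p t, v, _, _ => Negative.sem_ok (A := neg p t) trivial v
  | _, and A B, v, q + 1, h => fun i => by
    have h := max_le_iff.1 (Nat.le_of_succ_le_succ h)
    cases i
    exacts [tr_rkLe A v h.1, tr_rkLe B v h.2]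
  | _, or A B, v, q + 1, h => fun i => by
    have h := max_le_iff.1 (Nat.le_of_succ_le_succ h)
    cases i
    exacts [tr_rkLe A v h.1, tr_rkLe B v h.2]
  | _, all A, v, q + 1, h => fun i => tr_rkLe A _ (Nat.le_of_succ_le_succ h)
  | _, ex A, v, q + 1, h => fun i => tr_rkLe A _ (Nat.le_of_succ_le_succ h)

end Fml

/-! ### Representation of formulas in a target system -/

/-- `Rep V W X N`: in the target system given by the judgements `V` and `W`, the formula `N` may be
introduced by the rules for the connectives of `X`. -/
def Rep (V W : ℕ → Set (IFml Lit) → Prop) : IFml (IFml Lit) → IFml Lit → Prop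
  | .lit M, N => M = N
  | .conj f, N => ∃ g : ℕ → IFml Lit, (∀ x, Rep V W (f x) (g x)) ∧
      ∀ d Γ, N ∈ Γ → (∀ x, V d (insert (g x) Γ)) → W d Γ
  | .disj f, N => ∃ g : ℕ → IFml Lit, (∀ x, Rep V W (f x) (g x)) ∧
      ∀ d Γ x, N ∈ Γ → V d (insert (g x) Γ) → W d Γ

/-- Representation of a formula and its negation. -/
def Rep2 (V W : ℕ → Set (IFml Lit) → Prop) (X : IFml (IFml Lit)) (N : IFml Lit) : Prop :=
  Rep V W X N ∧ Rep V W (-X) (-N)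

theorem Rep2.neg {V W : ℕ → Set (IFml Lit) → Prop} {X : IFml (IFml Lit)} {N : IFml Lit}
    (h : Rep2 V W X N) : Rep2 V W (-X) (-N) :=
  ⟨h.2, by simpa using h.1⟩

/-- The closure properties of a target system. -/
structure Target (k : ℕ) (V W : ℕ → Set (IFml Lit) → Prop) : Prop where
  succ : ∀ {d Γ}, V d Γ → V (d + 1) Γ
  toV : ∀ {d Γ}, W d Γ → V (d + 1) Γ
  cut : ∀ {d Γ} (N : IFml Lit), N.RkLe Lit.Ok k → V d (insert N Γ) → V d (insert (-N) Γ) →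
    V (d + 1) Γ
  em : ∀ {d Γ} (N : IFml Lit), N.RkLe Lit.Ok k → N ∈ Γ → -N ∈ Γ → V (d + 1) Γ
  truth : ∀ {d Γ} (D : Lit), (∀ γ δ, D.rel γ δ) → .lit D ∈ Γ → V (d + 1) Γ
  sem : ∀ {d Γ} (D : Lit) (E : ℕ → Lit), (∀ γ δ, (∀ i, (E i).rel γ δ) → D.rel γ δ) →
    .lit D ∈ Γ → (∀ i, V d (insert (.lit (E i)) Γ)) → W d Γ
  clos : ∀ {d Γ} (φ : PosOp) (n : ℕ), .lit (.mem φ n) ∈ Γ →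
    V d (insert (.lit (.step φ n)) Γ) → V (d + 1) Γ

/-- The calculus in which formulas of the target system are literals. -/
def repCalc (k : ℕ) (V W : ℕ → Set (IFml Lit) → Prop) : Calc (IFml Lit) where
  rules := {ρ | (∃ X N, Rep V W X N ∧ ρ = ⟨{N}, Unit, fun _ => {X}, 0⟩) ∨
    ∃ (Δ : Set (IFml Lit)) (ι : Type) (P : ι → Set (IFml Lit)),
      (∀ d Γ, Δ ⊆ Γ → (∀ i, V d (P i ∪ Γ)) → V (d + 1) Γ) ∧
      ρ = ⟨Δ, ι, fun i => IFml.lit '' P i, 0⟩}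
  ctl _ _ := True
  ok N := N.RkLe Lit.Ok k
  ctl_mono _ h := h
  ctl_add _ _ := trivial
  ctl_nat _ _ := trivial
  ok_neg _ h := h.neg fun _ hl => hl.neg

section Target

variable {k : ℕ} {V W : ℕ → Set (IFml Lit) → Prop}

/-- A derivation without compound outer cuts contains only rules that the target can imitate:
connectives act through representing formulas, and cuts on outer literals are cuts on target
formulas. -/
theorem Der.toTarget (K : Target k V W) {ξ α : Ordinal.{0}} {Γ : Set (IFml (IFml Lit))}
    (h : Der (repCalc k V W) 0 ξ α Γ) : ∀ (d : ℕ), α ≤ d → ∀ Δ : Set (IFml Lit),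
      (∀ X ∈ Γ, ∃ N ∈ Δ, Rep V W X N) → V (d + 1) Δ := by
  have hpred : ∀ {a α : Ordinal.{0}} {d : ℕ}, a < α → α ≤ d → ∃ d', d = d' + 1 ∧ a ≤ d' := by
    intro a α d ha hd
    obtain _ | d := d
    · exact absurd (ha.trans_le hd) (by simp)
    · refine ⟨d, rfl, ?_⟩
      have := ha.trans_le hd
      push_cast at this
      exact Order.lt_add_one_iff.1 this
  have hins : ∀ {X : IFml (IFml Lit)} {N : IFml Lit} {Γ : Set (IFml (IFml Lit))}
      {Δ : Set (IFml Lit)}, Rep V W X N → (∀ X ∈ Γ, ∃ N ∈ Δ, Rep V W X N) →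
      ∀ Y ∈ insert X Γ, ∃ M ∈ insert N Δ, Rep V W Y M := by
    rintro X N Γ Δ hX hΓ Y (rfl | hY)
    · exact ⟨N, .inl rfl, hX⟩
    · obtain ⟨M, hM, hR⟩ := hΓ Y hY
      exact ⟨M, .inr hM, hR⟩
  induction h with
  | conj f a _ hf ha _ ih =>
    intro d hd Δ hΔ
    obtain ⟨N, hN, g, hg, hr⟩ := hΔ _ hf
    obtain ⟨d', rfl, -⟩ := hpred (ha 0) hd
    refine K.toV (hr _ _ hN fun x => ?_)
    obtain ⟨d'', he, hle⟩ := hpred (ha x) hd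
    cases he
    exact ih x d' hle _ (hins (hg x) hΔ)
  | disj f i a _ hf ha _ ih =>
    intro d hd Δ hΔ
    obtain ⟨N, hN, g, hg, hr⟩ := hΔ _ hf
    obtain ⟨d', rfl, hle⟩ := hpred ha hd
    exact K.toV (hr _ _ i hN (ih d' hle _ (hins (hg i) hΔ)))
  | cut C a b _ hC ha hb _ _ ihd ihe =>
    intro d hd Δ hΔ
    cases C with
    | conj f => exact hC.elim
    | disj f => exact hC.elim
    | lit N =>
      obtain ⟨d', rfl, hle⟩ := hpred ha hd
      obtain ⟨d'', he, hle'⟩ := hpred hb hd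
      cases he
      exact K.cut N hC (ihd d' hle _ (hins rfl hΔ)) (ihe d' hle' _ (hins rfl hΔ))
  | rule ρ a _ hρ hp ha _ ih =>
    intro d hd Δ hΔ
    rcases hρ with ⟨X, N, hXN, rfl⟩ | ⟨Δ', ι, P, hP, rfl⟩
    · obtain ⟨d', rfl, hle⟩ := hpred (ha ()) hd
      obtain ⟨M, hM, hNM⟩ := hΔ _ (hp N rfl)
      cases hNM
      -- The extra premise formula X is represented by N, which is already present, so this rule
      -- leaves no trace in the target.
      have := ih () d' hle (insert N Δ) (hins hXN hΔ)
      rw [Set.insert_eq_of_mem hM] at this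
      exact K.succ this
    · refine hP _ _ (fun N hN => ?_) fun i => ?_
      · obtain ⟨M, hM, hNM⟩ := hΔ _ (hp N hN)
        cases hNM
        exact hM
      · obtain ⟨d', rfl, hle⟩ := hpred (ha i) hd
        refine ih i d' hle _ ?_
        rintro Y (⟨N, hN, rfl⟩ | hY)
        · exact ⟨N, .inl hN, rfl⟩
        · obtain ⟨M, hM, hR⟩ := hΔ Y hY
          exact ⟨M, .inr hM, hR⟩

end Target

section Embedding

variable {k : ℕ} {V W : ℕ → Set (IFml Lit) → Prop} {Φ : Set PosOp}

/-! ### Embedding of the finitary theories -/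

/-- Semantic consequence between literals lets the single literal stating the truth condition of A
act as A. It may be used as a cut formula only when its truth value stabilises. -/
theorem Fml.rep_sem (K : Target k V W) : ∀ {n : ℕ} (A : Fml Φ n) (v : Fin n → ℕ),
    Rep V W (A.tr v) (.lit (A.sem v))
  | _, .eq _ _, _ => rfl
  | _, .neq _ _, _ => rfl
  | _, .lt _ _, _ => rfl
  | _, .nlt _ _, _ => rfl
  | _, .pos _ _, _ => rfl
  | _, .neg _ _, _ => rfl
  | _, .and A B, v => by
    refine ⟨fun x => .lit (IFml.two (A.sem v) (B.sem v) x), fun x => ?_, fun d Γ hΓ h => ?_⟩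
    · cases x
      exacts [rep_sem K A v, rep_sem K B v]
    · exact K.sem _ _ (fun γ δ h => (sem_and A B v γ δ).2 ⟨h 0, h 1⟩) hΓ h
  | _, .or A B, v => by
    refine ⟨fun x => .lit (IFml.two (A.sem v) (B.sem v) x), fun x => ?_, fun d Γ x hΓ h => ?_⟩
    · cases x
      exacts [rep_sem K A v, rep_sem K B v]
    · refine K.sem _ (fun _ => IFml.two (A.sem v) (B.sem v) x) (fun γ δ h => ?_) hΓ fun _ => h
      rw [sem_or]
      cases x
      exacts [.inl (h 0), .inr (h 0)]
  | _, .all A, v => ⟨fun x => .lit (A.sem (Fin.cons x v)), fun x => rep_sem K A _,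
      fun _ _ hΓ h => K.sem _ _ (fun _ _ h => h) hΓ h⟩
  | _, .ex A, v => ⟨fun x => .lit (A.sem (Fin.cons x v)), fun x => rep_sem K A _,
      fun _ _ x hΓ h => K.sem (A.ex.sem v) (fun _ => A.sem (Fin.cons x v))
        (fun γ δ h => (sem_ex A v γ δ).2 ⟨x, h 0⟩) hΓ fun _ => h⟩

theorem Fml.rep2_sem (K : Target k V W) {n : ℕ} (A : Fml Φ n) (v : Fin n → ℕ) :
    Rep2 V W (A.tr v) (.lit (A.sem v)) := by
  refine ⟨A.rep_sem K v, ?_⟩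
  rw [IFml.neg_lit, ← tr_not, ← sem_not]
  exact A.not.rep_sem K v

variable {r : ℕ} {Γ : Set (IFml (IFml Lit))}

/-- The link between a formula X and its name N. Because N is an outer literal, cuts on it survive
outer cut elimination. -/
theorem Der.intro {X : IFml (IFml Lit)} {N : IFml Lit} (h : Rep V W X N) (hN : .lit N ∈ Γ) {m : ℕ}
    (hd : Der (repCalc k V W) r 0 m (insert X Γ)) :
    Der (repCalc k V W) r 0 (m + 1 : ℕ) Γ := by
  refine nat_rule (ρ := ⟨{N}, Unit, fun _ => {X}, 0⟩) (.inl ⟨X, N, h, rfl⟩) ?_ fun _ => ?_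
  · rintro l rfl
    exact hN
  · rw [max_self]
    exact hd

theorem Der.admissible {Δ : Set (IFml Lit)} {ι : Type} {P : ι → Set (IFml Lit)}
    (hP : ∀ d Γ, Δ ⊆ Γ → (∀ i, V d (P i ∪ Γ)) → V (d + 1) Γ) (hΔ : ∀ l ∈ Δ, .lit l ∈ Γ) {m : ℕ}
    (hd : ∀ i, Der (repCalc k V W) r 0 m (IFml.lit '' P i ∪ Γ)) :
    Der (repCalc k V W) r 0 (m + 1 : ℕ) Γ := by
  refine nat_rule (ρ := ⟨Δ, ι, fun i => IFml.lit '' P i, 0⟩) (.inr ⟨Δ, ι, P, hP, rfl⟩) hΔ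
    fun i => ?_
  rw [max_self]
  exact hd i

theorem Der.rep_axiom {Δ : Set (IFml Lit)} (hP : ∀ d Γ, Δ ⊆ Γ → V (d + 1) Γ)
    (hΔ : ∀ l ∈ Δ, .lit l ∈ Γ) : Der (repCalc k V W) r 0 0 Γ :=
  .rule ⟨Δ, Empty, fun i => IFml.lit '' (fun _ => ∅ : Empty → Set (IFml Lit)) i, 0⟩ Empty.elim
    trivial (.inr ⟨Δ, Empty, fun _ => ∅, fun d Γ h _ => hP d Γ h, rfl⟩) hΔ (fun i => i.elim)
    fun i => i.elim

theorem Der.rep_em (K : Target k V W) (X : IFml (IFml Lit)) {q : ℕ}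
    (hX : X.RkLe (fun N => N.RkLe Lit.Ok k) q) (h : X ∈ Γ) (h' : -X ∈ Γ) :
    Der (repCalc k V W) r 0 (2 * q : ℕ) Γ := by
  refine Der.em (S := repCalc k V W) (fun N Γ hN h h' => ?_) X q hX h h'
  refine rep_axiom (Δ := {N, -N}) (fun d Γ hΓ => ?_) ?_
  · exact K.em N hN (hΓ (.inl rfl)) (hΓ (.inr rfl))
  · rintro l (rfl | rfl)
    exacts [h, h']

theorem Der.rep_truth (K : Target k V W) (D : Lit) (hD : ∀ γ δ, D.rel γ δ)
    (h : IFml.atom D ∈ Γ) : Der (repCalc k V W) r 0 0 Γ := by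
  refine rep_axiom (Δ := {.lit D}) (fun d Γ hΓ => K.truth D hD (hΓ rfl)) ?_
  rintro l rfl
  exact h

/-- The height depends on the formula alone, not on the assignment, so infinite conjunctions keep it
finite. -/
theorem Der.rep_arith (K : Target k V W) : ∀ {n : ℕ} (B : Fml Empty n), ∃ m : ℕ,
    ∀ (v : Fin n → ℕ) (Γ : Set (IFml (IFml Lit))), B.Sat (fun _ => ∅) v →
      (B.ofArith : Fml Φ n).tr v ∈ Γ → Der (repCalc k V W) r 0 m Γ
  | _, .eq _ _ => ⟨0, fun _ _ h hΓ => by simpa using rep_truth K _ (fun _ _ => h) hΓ⟩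
  | _, .neq _ _ => ⟨0, fun _ _ h hΓ => by simpa using rep_truth K _ (fun _ _ => h) hΓ⟩
  | _, .lt _ _ => ⟨0, fun _ _ h hΓ => by simpa using rep_truth K _ (fun _ _ => h) hΓ⟩
  | _, .nlt _ _ => ⟨0, fun _ _ h hΓ => by simpa using rep_truth K _ (fun _ _ => h) hΓ⟩
  | _, .pos p _ => p.elim
  | _, .neg p _ => p.elim
  | _, .and A B => by
    obtain ⟨m, hm⟩ := rep_arith K A
    obtain ⟨m', hm'⟩ := rep_arith K B
    refine ⟨max m m' + 1, fun v Γ h hΓ => nat_conj_two hΓ ?_ ?_⟩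
    · exact (hm v _ h.1 (.inl rfl)).nat_le (le_max_left _ _)
    · exact (hm' v _ h.2 (.inl rfl)).nat_le (le_max_right _ _)
  | _, .or A B => by
    obtain ⟨m, hm⟩ := rep_arith K A
    obtain ⟨m', hm'⟩ := rep_arith K B
    refine ⟨max m m' + 1, fun v Γ h hΓ => ?_⟩
    rcases h with h | h
    · exact nat_disj hΓ 0 ((hm v _ h (.inl rfl)).nat_le (le_max_left _ _))
    · exact nat_disj hΓ 1 ((hm' v _ h (.inl rfl)).nat_le (le_max_right _ _))
  | _, .all A => by
    obtain ⟨m, hm⟩ := rep_arith K A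
    exact ⟨m + 1, fun v Γ h hΓ => nat_conj hΓ fun x => hm _ _ (h x) (.inl rfl)⟩
  | _, .ex A => by
    obtain ⟨m, hm⟩ := rep_arith K A
    refine ⟨m + 1, fun v Γ h hΓ => ?_⟩
    obtain ⟨x, hx⟩ := h
    exact nat_disj hΓ x (hm _ _ hx (.inl rfl))

theorem Der.rep_closure : ∀ {n : ℕ} (A : Fml Φ n) {m : ℕ},
    (∀ v, Der (repCalc k V W) r 0 m {A.tr v}) →
      ∃ m' : ℕ, Der (repCalc k V W) r 0 m' {A.closure.tr Fin.elim0}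
  | 0, A, m, h => ⟨m, h _⟩
  | n + 1, A, m, h => rep_closure A.all (m := m + 1) fun v =>
      nat_conj (f := fun x => A.tr (Fin.cons x v)) rfl fun x =>
        (h (Fin.cons x v)).mono_left (by simp)

/-! ### The axioms in the outer calculus -/

section Rep2

variable {X : IFml (IFml Lit)} {N : IFml Lit} {q : ℕ}

theorem Der.rep_pos (K : Target k V W) (h : Rep V W X N)
    (hX : X.RkLe (fun N => N.RkLe Lit.Ok k) q) (hN : .lit N ∈ Γ) (hΓ : -X ∈ Γ) :
    Der (repCalc k V W) r 0 (2 * q + 1 : ℕ) Γ :=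
  intro h hN (rep_em K X hX (.inl rfl) (.inr hΓ))

theorem Der.rep_neg (K : Target k V W) (h : Rep V W (-X) (-N))
    (hX : X.RkLe (fun N => N.RkLe Lit.Ok k) q) (hN : .lit (-N) ∈ Γ) (hΓ : X ∈ Γ) :
    Der (repCalc k V W) r 0 (2 * q + 1 : ℕ) Γ :=
  intro h hN (rep_em K X hX (.inr hΓ) (.inl rfl))

end Rep2

/-- Induction for a family `T` of formulas in the target system. -/
def IndOk (k : ℕ) (V W : ℕ → Set (IFml Lit) → Prop) (T : ℕ → IFml (IFml Lit)) : Prop :=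
  ∃ N : ℕ → IFml Lit, (∀ m, (N m).RkLe Lit.Ok k) ∧ (∀ m, Rep2 V W (T m) (N m)) ∧
    ∀ d Γ m, N m ∈ Γ → V d (insert (N 0) Γ) →
      (∀ j, V d (insert (-N j) (insert (N (j + 1)) Γ))) → V (d + 1) Γ

/-- Minimality of `R_φ` for a family `T` of formulas in the target system; the formulas `Ψ x`
express that `φ` holds of `T` and `x`. -/
def MinOk (k : ℕ) (V W : ℕ → Set (IFml Lit) → Prop) (φ : PosOp) (T Ψ : ℕ → IFml (IFml Lit)) :
    Prop :=
  ∃ N M : ℕ → IFml Lit, (∀ m, (N m).RkLe Lit.Ok k) ∧ (∀ m, Rep2 V W (T m) (N m)) ∧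
    (∀ m, Rep V W (-Ψ m) (-M m)) ∧
    ∀ d Γ u, .lit (-.mem φ u) ∈ Γ → N u ∈ Γ →
      (∀ x, V d (insert (-M x) (insert (N x) Γ))) → V (d + 1) Γ

/-- Cut with the name `N m` of `T m`. One side is induction in the target for the names, whose
premises follow from the hypotheses of the axiom by excluded middle between names and formulas; the
other side is such an excluded middle. -/
theorem Der.rep_ind (K : Target k V W) {T : ℕ → IFml (IFml Lit)} (hT : IndOk k V W T) {q : ℕ}
    (hq : ∀ m, (T m).RkLe (fun N => N.RkLe Lit.Ok k) q) (h0 : -T 0 ∈ Γ)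
    (hs : IFml.disj (fun x => .conj (IFml.two (T x) (-T (x + 1)))) ∈ Γ) (hc : .conj T ∈ Γ) :
    Der (repCalc k V W) r 0 (2 * q + 6 : ℕ) Γ := by
  obtain ⟨N, hN, hR, hV⟩ := hT
  refine nat_conj hc fun m => nat_cut (C := .lit (N m)) (hN m) ?_ ?_
  · refine admissible (Δ := {N m}) (ι := Option ℕ)
      (P := fun o => o.elim {N 0} fun j => {-N j, N (j + 1)}) (fun d Γ hΓ h => ?_)
      (by rintro l rfl; exact .inl rfl) fun o => ?_
    · refine hV d Γ m (hΓ rfl) (h none) fun j => ?_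
      have := h (some j)
      rwa [Option.elim_some, Set.insert_union, Set.singleton_union] at this
    · cases o with
      | none =>
        refine (rep_pos K (hR 0).1 (hq 0) (.inl ⟨_, rfl, rfl⟩) (.inr (.inr (.inr h0)))).nat_le ?_
        omega
      | some j =>
        refine nat_disj (.inr (.inr (.inr hs))) j (nat_conj_two (.inl rfl) ?_ ?_)
        · exact rep_neg K (hR j).2 (hq j) (.inr (.inr (.inl ⟨_, .inl rfl, rfl⟩))) (.inl rfl)
        · exact rep_pos K (hR (j + 1)).1 (hq (j + 1)) (.inr (.inr (.inl ⟨_, .inr rfl, rfl⟩)))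
            (.inl rfl)
  · exact (rep_neg K (hR m).2 (hq m) (.inl rfl) (.inr (.inl rfl))).nat_le (by omega)

theorem Der.rep_min (K : Target k V W) {φ : PosOp} {T Ψ : ℕ → IFml (IFml Lit)}
    (hT : MinOk k V W φ T Ψ) {q : ℕ} (hq : ∀ m, (T m).RkLe (fun N => N.RkLe Lit.Ok k) q)
    (hq' : ∀ m, (Ψ m).RkLe (fun N => N.RkLe Lit.Ok k) q) (u : ℕ)
    (h0 : IFml.atom (-.mem φ u) ∈ Γ)
    (hs : IFml.disj (fun x => .conj (IFml.two (Ψ x) (-T x))) ∈ Γ) (hc : T u ∈ Γ) :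
    Der (repCalc k V W) r 0 (2 * q + 5 : ℕ) Γ := by
  obtain ⟨N, M, hN, hR, hR', hV⟩ := hT
  refine nat_cut (C := .lit (N u)) (hN u) ?_ ?_
  · refine admissible (Δ := {.lit (-.mem φ u), N u}) (ι := ℕ)
      (P := fun x => {-M x, N x}) (fun d Γ hΓ h => ?_) ?_ fun x => ?_
    · refine hV d Γ u (hΓ (.inl rfl)) (hΓ (.inr rfl)) fun x => ?_
      have := h x
      rwa [Set.insert_union, Set.singleton_union] at this
    · rintro l (rfl | rfl)
      exacts [.inr h0, .inl rfl]
    · refine nat_disj (.inr (.inr hs)) x (nat_conj_two (.inl rfl) ?_ ?_)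
      · exact rep_neg K (hR' x) (hq' x) (.inr (.inr (.inl ⟨_, .inl rfl, rfl⟩))) (.inl rfl)
      · exact rep_pos K (hR x).1 (hq x) (.inr (.inr (.inl ⟨_, .inr rfl, rfl⟩))) (.inl rfl)
  · exact (rep_neg K (hR u).2 (hq u) (.inl rfl) (.inr hc)).nat_le (by omega)

theorem Der.rep_indAx (K : Target k V W) {n : ℕ} (θ : LFml Φ (n + 1))
    (hθ : ∀ v : Fin n → ℕ, IndOk k V W fun x => θ.tr (Fin.cons x v)) :
    ∃ m : ℕ, Der (repCalc k V W) r 0 m {(indAx θ).closure.tr Fin.elim0} := by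
  refine rep_closure (indAx θ) (m := 2 * θ.depth + 6 + 4) fun v => ?_
  have e : (indAx θ).tr v = .disj (IFml.two (.disj (IFml.two (-θ.tr (Fin.cons 0 v))
      (.disj fun x => .conj (IFml.two (θ.tr (Fin.cons x v)) (-θ.tr (Fin.cons (x + 1) v))))))
      (.conj fun x => θ.tr (Fin.cons x v))) := by
    simp [indAx, Fml.imp, Fml.not, Fml.tr, Fml.tr_not, Fml.tr_inst, Fml.tr_shiftParam,
      Term.val_zero, Term.val_succ, Term.val]
  rw [e]
  refine nat_disj rfl 1 (nat_disj (.inr rfl) 0 (nat_disj (.inl rfl) 0 (nat_disj (.inr (.inl rfl)) 1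
    (rep_ind K (hθ v) (q := θ.depth) (fun m => θ.tr_rkLe _ le_rfl) ?_ ?_ ?_))))
  · exact .inr (.inl rfl)
  · exact .inl rfl
  · exact .inr (.inr (.inr (.inl rfl)))

theorem Der.rep_minAx (K : Target k V W) {n : ℕ} (φ : Φ) (σ : LFml Φ (n + 1))
    (hσ : ∀ (v : Fin n → ℕ) (u : ℕ), MinOk k V W φ.1 (fun x => σ.tr (Fin.cons x v)) fun x =>
      (φ.1.1.substPred (fun _ => Term.var 0) σ.shiftParam.shiftParam).tr
        (Fin.cons x (Fin.cons u v))) :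
    ∃ m : ℕ, Der (repCalc k V W) r 0 m {(minAx φ σ).closure.tr Fin.elim0} := by
  set Ψ : LFml Φ (n + 2) := φ.1.1.substPred (fun _ => Term.var 0) σ.shiftParam.shiftParam with hΨ
  refine rep_closure (minAx φ σ) (m := 2 * max σ.depth Ψ.depth + 5 + 5) fun v => ?_
  have e : (minAx φ σ).tr v = .conj fun u => .disj (IFml.two (.atom (-.mem φ.1 u))
      (.disj (IFml.two (.disj fun x => .conj (IFml.two (Ψ.tr (Fin.cons x (Fin.cons u v)))
        (-σ.tr (Fin.cons x v)))) (σ.tr (Fin.cons u v))))) := by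
    simp [minAx, Fml.imp, Fml.not, Fml.tr, Fml.tr_not, Fml.tr_shiftParam, Term.val, ← hΨ]
  rw [e]
  refine nat_conj rfl fun u => nat_disj (.inl rfl) 0 (nat_disj (.inr (.inl rfl)) 1
    (nat_disj (.inl rfl) 0 (nat_disj (.inr (.inl rfl)) 1
    (rep_min K (hσ v u) (q := max σ.depth Ψ.depth) (fun m => σ.tr_rkLe _ (le_max_left _ _))
      (fun m => Ψ.tr_rkLe _ (le_max_right _ _)) u ?_ ?_ ?_))))
  · exact .inr (.inr (.inr (.inl rfl)))
  · exact .inr (.inl rfl)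
  · exact .inl rfl

theorem Der.rep_closAx (K : Target k V W) (φ : Φ) :
    ∃ m : ℕ, Der (repCalc k V W) r 0 m {(closAx φ).tr Fin.elim0} := by
  set Ψ : LFml Φ 1 := φ.1.1.substPred (fun _ => Term.var 0) (Fml.pos φ (Term.var 0)) with hΨ
  have e : (closAx φ).tr Fin.elim0 = .conj fun x =>
      .disj (IFml.two (-Ψ.tr (Fin.cons x Fin.elim0)) (.atom (.mem φ.1 x))) := by
    simp [closAx, Fml.imp, Fml.tr, Fml.tr_not, Term.val, ← hΨ]
  have hsem : ∀ x, Ψ.sem (Fin.cons x Fin.elim0) = .step φ.1 x := by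
    intro x
    ext γ δ
    rw [hΨ, Fml.sem_substPred _ φ.1.2]
    rfl
  refine ⟨2 * Ψ.depth + 1 + 1 + 1 + 1 + 1, ?_⟩
  rw [e]
  refine nat_conj rfl fun x => nat_disj (.inl rfl) 0 (nat_disj (.inr (.inl rfl)) 1
    (admissible (Δ := {.lit (.mem φ.1 x)}) (ι := Unit) (P := fun _ => {.lit (.step φ.1 x)})
    (fun d Γ hΓ h => K.clos φ.1 x (hΓ rfl) (h ())) (by rintro l rfl; exact .inl rfl) fun _ => ?_))
  refine rep_pos K (X := Ψ.tr (Fin.cons x Fin.elim0)) (N := .lit (.step φ.1 x)) ?_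
    (Ψ.tr_rkLe _ le_rfl) (.inl ⟨_, rfl, rfl⟩) (.inr (.inr (.inl rfl)))
  rw [← hsem]
  exact Ψ.rep_sem K _

/-- The translation of a finitary sequent. -/
def trSeq {n : ℕ} (Γ : List (Fml Φ n)) (v : Fin n → ℕ) : Set (IFml (IFml Lit)) :=
  {X | ∃ A ∈ Γ, A.tr v = X}

theorem trSeq_cons {n : ℕ} (A : Fml Φ n) (Γ : List (Fml Φ n)) (v : Fin n → ℕ) :
    trSeq (A :: Γ) v = insert (A.tr v) (trSeq Γ v) := by
  ext X
  simp [trSeq, eq_comm]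

theorem trSeq_shift {n : ℕ} (Γ : List (Fml Φ n)) (x : ℕ) (v : Fin n → ℕ) :
    trSeq (Γ.map Fml.shift) (Fin.cons x v : Fin (n + 1) → ℕ) = trSeq Γ v := by
  ext X
  simp [trSeq, Fml.tr_shift]

theorem Fml.tr_literal {n : ℕ} (L : Fml Φ n) (hL : L.IsLiteral) (v : Fin n → ℕ) {q : ℕ} :
    (L.tr v).RkLe (fun N => N.RkLe Lit.Ok k) q :=
  L.tr_rkLe v (by cases L <;> first | exact hL.elim | exact Nat.zero_le _)

/-- Height and rank are uniform in the assignment, and the axioms contribute only cuts on literals,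
so all compound cuts come from the finitely many cut formulas of the proof. -/
theorem Derivable.embed (K : Target k V W) {T : Set (Fml Φ 0)}
    (hT : ∀ A ∈ T, ∃ m : ℕ, Der (repCalc k V W) 0 0 m {A.tr Fin.elim0}) {n : ℕ}
    {Γ : List (Fml Φ n)} (h : Derivable T Γ) :
    ∃ r m : ℕ, ∀ v, Der (repCalc k V W) r 0 m (trSeq Γ v) := by
  induction h with
  | literal L hL h h' =>
    exact ⟨0, 2 * 0, fun v => Der.rep_em K (L.tr v) (L.tr_literal hL v) ⟨L, h, rfl⟩
      ⟨L.not, h', L.tr_not v⟩⟩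
  | refl t h =>
    refine ⟨0, 0, fun v => ?_⟩
    rw [Nat.cast_zero]
    exact Der.rep_truth K (.const (t.val v = t.val v)) (fun _ _ => rfl) ⟨_, h, rfl⟩
  | eqSubst L t s hL h h₁ h₂ =>
    refine ⟨0, 2 * 0, fun v => ?_⟩
    by_cases he : t.val v = s.val v
    · refine Der.rep_em K (L.tr (Fin.cons (s.val v) v)) (L.tr_literal hL _)
        ⟨_, h₂, L.tr_inst s v⟩ ⟨_, h₁, ?_⟩
      rw [Fml.tr_not, Fml.tr_inst, he]
    · rw [mul_zero, Nat.cast_zero]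
      exact Der.rep_truth K (-.const (t.val v = s.val v)) (fun _ _ => he) ⟨_, h, rfl⟩
  | ax A hA h =>
    obtain ⟨m, hm⟩ := hT A hA
    refine ⟨0, m, fun v => hm.mono_left ?_⟩
    rintro X rfl
    exact ⟨_, h, A.tr_ofSentence v⟩
  | and A B h _ _ ih₁ ih₂ =>
    obtain ⟨r, m, hm⟩ := ih₁
    obtain ⟨r', m', hm'⟩ := ih₂
    refine ⟨max r r', max m m' + 1, fun v => Der.nat_conj_two ⟨_, h, rfl⟩ ?_ ?_⟩
    · rw [← trSeq_cons]
      exact ((hm v).mono_rank (le_max_left _ _)).nat_le (le_max_left _ _)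
    · rw [← trSeq_cons]
      exact ((hm' v).mono_rank (le_max_right _ _)).nat_le (le_max_right _ _)
  | orLeft A B h _ ih =>
    obtain ⟨r, m, hm⟩ := ih
    refine ⟨r, m + 1, fun v => Der.nat_disj ⟨_, h, rfl⟩ 0 ?_⟩
    have := hm v
    rwa [trSeq_cons] at this
  | orRight A B h _ ih =>
    obtain ⟨r, m, hm⟩ := ih
    refine ⟨r, m + 1, fun v => Der.nat_disj ⟨_, h, rfl⟩ 1 ?_⟩
    have := hm v
    rwa [trSeq_cons] at this
  | all A h _ ih =>
    obtain ⟨r, m, hm⟩ := ih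
    refine ⟨r, m + 1, fun v => Der.nat_conj ⟨_, h, rfl⟩ fun x => ?_⟩
    have := hm (Fin.cons x v)
    rwa [trSeq_cons, trSeq_shift] at this
  | ex A t h _ ih =>
    obtain ⟨r, m, hm⟩ := ih
    refine ⟨r, m + 1, fun v => Der.nat_disj ⟨_, h, rfl⟩ (t.val v) ?_⟩
    have := hm v
    rwa [trSeq_cons, Fml.tr_inst] at this
  | cut C _ _ ih₁ ih₂ =>
    obtain ⟨r, m, hm⟩ := ih₁
    obtain ⟨r', m', hm'⟩ := ih₂
    refine ⟨max (max r r') C.depth, max m m' + 1, fun v => Der.nat_cut (C := C.tr v)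
      (C.tr_rkLe v (le_max_right _ _)) ?_ ?_⟩
    · rw [← trSeq_cons]
      exact ((hm v).mono_rank ((le_max_left _ _).trans (le_max_left _ _))).nat_le (le_max_left _ _)
    · rw [← Fml.tr_not, ← trSeq_cons]
      exact ((hm' v).mono_rank ((le_max_right _ _).trans (le_max_left _ _))).nat_le
        (le_max_right _ _)

/-! ### Eliminating the outer cuts and passing to the target -/

theorem two_opow_add_le {a b c : Ordinal.{0}} (ha : a < c) (hb : b < c) :
    (2 : Ordinal.{0}) ^ a + 2 ^ b ≤ 2 ^ c := by
  have h2 : (0 : Ordinal.{0}) < 2 := zero_lt_two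
  calc (2 : Ordinal.{0}) ^ a + 2 ^ b ≤ 2 ^ max a b + 2 ^ max a b :=
        add_le_add (opow_le_opow_right h2 (le_max_left _ _))
          (opow_le_opow_right h2 (le_max_right _ _))
    _ = 2 ^ max a b * 2 := by rw [← one_add_one_eq_two, mul_add, mul_one]
    _ = 2 ^ (max a b + 1) := by rw [opow_add_one]
    _ ≤ 2 ^ c := opow_le_opow_right h2 (Order.add_one_le_of_lt (max_lt ha hb))

theorem Der.rep_cutElim : ∀ {r m : ℕ} {Γ : Set (IFml (IFml Lit))},
    Der (repCalc k V W) r 0 m Γ → ∃ m' : ℕ, Der (repCalc k V W) 0 0 m' Γ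
  | 0, m, _, h => ⟨m, h⟩
  | r + 1, m, _, h => by
    have := h.cutElim (fun a => 2 ^ a) (isNormal_opow one_lt_two).strictMono two_opow_add_le
      fun _ => trivial
    rw [show (2 : Ordinal.{0}) ^ (m : Ordinal.{0}) = ((2 ^ m : ℕ) : Ordinal.{0}) by
      rw [opow_natCast]; push_cast; rfl] at this
    exact rep_cutElim this

/-- A theorem of the theory about `R_φ` holds in every target system in which the axioms of
induction and minimality are admissible. -/
theorem target_of_provable (K : Target k V W) (Θ Γ : FmlClass Φ)
    (hΘ : ∀ (n : ℕ) (θ : LFml Φ (n + 1)), θ ∈ Θ (n + 1) → ∀ v : Fin n → ℕ,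
      IndOk k V W fun x => θ.tr (Fin.cons x v))
    (hΓ : ∀ (n : ℕ) (φ : Φ) (σ : LFml Φ (n + 1)), σ ∈ Γ (n + 1) → ∀ (v : Fin n → ℕ) (u : ℕ),
      MinOk k V W φ.1 (fun x => σ.tr (Fin.cons x v)) fun x =>
        (φ.1.1.substPred (fun _ => Term.var 0) σ.shiftParam.shiftParam).tr
          (Fin.cons x (Fin.cons u v)))
    (φ : Φ) (n : ℕ) (h : Provable (thID Φ Θ Γ) (Fml.pos φ (Term.numeral n))) :
    ∃ d, V d {.lit (.mem φ.1 n)} := by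
  have hT : ∀ A ∈ thID Φ Θ Γ, ∃ m : ℕ, Der (repCalc k V W) 0 0 m {A.tr Fin.elim0} := by
    rintro A (((⟨B, hB, rfl⟩ | ⟨n, θ, hθ, rfl⟩) | ⟨φ, rfl⟩) | ⟨n, φ, σ, hσ, rfl⟩)
    · obtain ⟨m, hm⟩ := Der.rep_arith K B
      exact ⟨m, hm _ _ hB rfl⟩
    · exact Der.rep_indAx K θ (hΘ n θ hθ)
    · exact Der.rep_closAx K φ
    · exact Der.rep_minAx K φ σ (hΓ n φ σ hσ)
  obtain ⟨r, m, hm⟩ := Derivable.embed K hT h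
  obtain ⟨m', hm'⟩ := Der.rep_cutElim (hm Fin.elim0)
  refine ⟨m' + 1, hm'.toTarget K m' le_rfl _ ?_⟩
  rintro X ⟨A, hA, rfl⟩
  rw [List.mem_singleton] at hA
  subst hA
  refine ⟨_, rfl, ?_⟩
  simp [Fml.tr, IFml.atom, Rep, Term.val_numeral]

end Embedding

/-! ### Minimality for simple formulas -/

section SimpleMin

variable {k : ℕ} {V W : ℕ → Set (IFml Lit) → Prop} {Φ : Set PosOp}

theorem Fml.sem_substPred_shiftParam {n : ℕ} (φ : PosOp) (σ : LFml Φ (n + 1)) (v : Fin n → ℕ)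
    (u x : ℕ) :
    (φ.1.substPred (fun _ => Term.var 0) σ.shiftParam.shiftParam).sem
      (Fin.cons x (Fin.cons u v) : Fin (n + 2) → ℕ) = .opr φ (fun y => σ.sem (Fin.cons y v)) x := by
  ext γ δ
  rw [sem_substPred _ φ.2]
  simp only [sem, tr_shiftParam]
  rfl

/-- For rectangular stable σ everything is named by single literals: σ(x) by its truth condition and
φ(σ,x) by `Lit.opr`. -/
theorem minOk_of_rect (K : Target k V W)
    (hV : ∀ {d Γ φ σ u}, Rect σ → .lit (-.mem φ u) ∈ Γ → .lit (σ u) ∈ Γ →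
      (∀ x, V d (insert (.lit (-.opr φ σ x)) (insert (.lit (σ x)) Γ))) → V (d + 1) Γ)
    {n : ℕ} (φ : PosOp) (σ : LFml Φ (n + 1)) (v : Fin n → ℕ) (u : ℕ)
    (hok : ∀ x, (σ.sem (Fin.cons x v)).Ok) (hr : Rect fun x => σ.sem (Fin.cons x v)) :
    MinOk k V W φ (fun x => σ.tr (Fin.cons x v)) fun x =>
      (φ.1.substPred (fun _ => Term.var 0) σ.shiftParam.shiftParam).tr
        (Fin.cons x (Fin.cons u v)) := by
  refine ⟨fun x => .lit (σ.sem (Fin.cons x v)),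
    fun x => .lit (.opr φ (fun y => σ.sem (Fin.cons y v)) x), fun x => hok x,
    fun x => σ.rep2_sem K _, fun x => ?_, fun d Γ u h h' hd => hV hr h h' hd⟩
  have := (Fml.rep2_sem K (φ.1.substPred (fun _ => Term.var 0) σ.shiftParam.shiftParam)
    (Fin.cons x (Fin.cons u v))).2
  rwa [Fml.sem_substPred_shiftParam] at this

/-- A positive formula ignores the first stage and a negative one the second, so in either case the
stages can be recombined. -/
theorem posOrNeg_rect {n : ℕ} {σ : LFml Φ (n + 1)} (h : σ ∈ posOrNeg Φ (n + 1)) (v : Fin n → ℕ) :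
    (∀ x, (σ.sem (Fin.cons x v)).Ok) ∧ Rect fun x => σ.sem (Fin.cons x v) := by
  rcases h with h | h
  · exact ⟨fun x => Fml.Positive.sem_ok h _, fun x _ _ _ _ _ h' => Fml.Positive.sem_congr _ h _ h'⟩
  · exact ⟨fun x => Fml.Negative.sem_ok h _, fun x _ _ _ _ h' _ => Fml.Negative.sem_congr h _ h'⟩

theorem posAndNeg_rect {n : ℕ} {σ : LFml Φ (n + 1)} (h : σ ∈ posAndNeg Φ (n + 1))
    (v : Fin n → ℕ) :
    (∀ x, (σ.sem (Fin.cons x v)).Ok) ∧ Rect fun x => σ.sem (Fin.cons x v) := by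
  obtain ⟨C, D, hC, hD, rfl⟩ := h
  refine ⟨fun x => ?_, fun x γ δ γ' δ' h h' => ?_⟩
  · have := EvConst.and (Fml.Positive.sem_ok hC (Fin.cons x v))
      (Fml.Negative.sem_ok hD (Fin.cons x v))
    simpa only [Lit.Ok, ← Fml.sem_and] using this
  · simp only [Fml.sem_and] at h h' ⊢
    exact ⟨Fml.Positive.sem_congr _ hC _ h'.1, Fml.Negative.sem_congr hD _ h.2⟩

/-- The asymmetric reading validates excluded middle only because the positive stage is not smaller
than the negative one. -/
theorem Lit.rel_or_neg (D : Lit) {γ δ : Ordinal.{0}} (h : γ ≤ δ) : D.rel γ δ ∨ (-D).rel γ δ := by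
  by_cases hD : D.rel δ γ
  exacts [.inl (D.mono h h hD), .inr hD]

end SimpleMin

/-! ### The target system for induction without unbounded quantifiers -/

/-- Validity at level `2d + 1`. -/
def NatVal (d : ℕ) (Γ : Set (IFml Lit)) : Prop := Val 0 (2 * (d : Ordinal.{0}) + 1) Γ

section NatVal

variable {d : ℕ} {Γ : Set (IFml Lit)}

theorem two_mul_nat_add_one_lt (d : ℕ) : 2 * (d : Ordinal.{0}) + 1 < omegaTower 1 := by
  have : 2 * (d : Ordinal.{0}) + 1 = ((2 * d + 1 : ℕ) : Ordinal.{0}) := by push_cast; rfl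
  rw [this, omegaTower, omegaTower, opow_one]
  exact natCast_lt_omega0 _

theorem NatVal.rule {ρ : InfRule Lit} (hρ : ρ ∈ weakRules) (hp : ∀ l ∈ ρ.prin, IFml.lit l ∈ Γ)
    (h : ∀ i, NatVal d (ρ.prem i ∪ Γ)) : NatVal (d + 1) Γ :=
  Val.weak_rule (two_mul_nat_add_one_lt _) hρ (fun _ => d)
    (fun _ => by exact_mod_cast Nat.lt_succ_self d) hp h

theorem NatVal.succ (h : NatVal d Γ) : NatVal (d + 1) Γ := by
  intro β hξ hβ
  obtain ⟨D, hD, hr⟩ := h β hξ hβ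
  refine ⟨D, hD, D.mono le_rfl (fv_mono_left (ξ := 0)
    (Ctl.of_lt_omegaTower 0 (two_mul_nat_add_one_lt _))
    (Ctl.of_lt_omegaTower 0 (two_mul_nat_add_one_lt _)) zero_le hβ ?_).le hr⟩
  exact (two_mul_add_one_lt (by exact_mod_cast Nat.lt_succ_self d)).trans (lt_add_one _)

theorem NatVal.target : Target 0 NatVal NatVal where
  succ := NatVal.succ
  toV := NatVal.succ
  cut N hN h h' := by
    cases N with
    | lit D =>
      exact Val.weak_cut (two_mul_nat_add_one_lt _) (by exact_mod_cast Nat.lt_succ_self _)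
        (by exact_mod_cast Nat.lt_succ_self _) hN h h'
    | conj f => exact hN.elim
    | disj f => exact hN.elim
  em N hN h h' := by
    cases N with
    | lit D =>
      refine NatVal.rule (ρ := axRule {D, -D}) (.inl (.inl ⟨_, fun γ δ hle _ => ?_, rfl⟩)) ?_
        fun i => i.elim
      · rcases D.rel_or_neg hle with hD | hD
        exacts [⟨D, .inl rfl, hD⟩, ⟨-D, .inr rfl, hD⟩]
      · rintro l (rfl | rfl)
        exacts [h, h']
    | conj f => exact hN.elim
    | disj f => exact hN.elim
  truth D hD h := by
    refine NatVal.rule (ρ := axRule {D}) (.inl (.inl ⟨{D}, fun γ δ _ _ => ⟨D, rfl, hD γ δ⟩, rfl⟩))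
      ?_ fun i => i.elim
    rintro l rfl
    exact h
  -- Semantic consequence leaves the level unchanged, since all premises are read at the same two
  -- stages; hence both judgements of the target may coincide.
  sem D E hD h hE := by
    intro β hξ hβ
    by_contra! hcon
    refine hcon D h (hD _ _ fun i => ?_)
    obtain ⟨D', hD' | hD', hr⟩ := hE i β hξ hβ
    · cases hD'
      exact hr
    · exact (hcon D' hD' hr).elim
  clos φ n h hd := by
    refine NatVal.rule (ρ := closRule φ n) (.inl (.inr (.inr ⟨φ, n, rfl⟩))) ?_ fun _ => hd
    rintro l rfl
    exact h

theorem NatVal.min {φ : PosOp} {σ : ℕ → Lit} {u : ℕ} (hσ : Rect σ)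
    (h : .lit (-.mem φ u) ∈ Γ) (h' : .lit (σ u) ∈ Γ)
    (hd : ∀ x, NatVal d (insert (.lit (-.opr φ σ x)) (insert (.lit (σ x)) Γ))) :
    NatVal (d + 1) Γ := by
  refine NatVal.rule (ρ := minRule φ σ u) (.inr (.inl ⟨φ, σ, u, hσ, rfl⟩)) ?_ fun x => ?_
  · rintro l (rfl | rfl)
    exacts [h, h']
  · have := hd x
    rwa [← Set.singleton_union (a := IFml.lit (σ x)), ← Set.insert_union] at this

theorem NatVal.indOk {Φ : Set PosOp} {n : ℕ} {θ : LFml Φ (n + 1)} (h : Hier .pi 0 θ)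
    (v : Fin n → ℕ) : IndOk 0 NatVal NatVal fun x => θ.tr (Fin.cons x v) := by
  refine ⟨fun x => .lit (θ.sem (Fin.cons x v)), fun x => h.sem_ok rfl _,
    fun x => θ.rep2_sem NatVal.target _, fun d Γ m hm h0 hs => ?_⟩
  refine NatVal.rule (ρ := indRule (fun x => θ.sem (Fin.cons x v)) m)
    (.inr (.inr ⟨_, m, fun j => h.sem_ok rfl _, rfl⟩)) ?_ fun o => ?_
  · rintro l rfl
    exact hm
  · cases o with
    | none => exact h0
    | some j =>
      have := hs j
      rw [← Set.singleton_union (a := IFml.lit (θ.sem (Fin.cons (j + 1) v))),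
        ← Set.insert_union] at this
      exact this

end NatVal

/-- Membership in a stage bounds the norm. -/
theorem Val.norm_lt {α x : Ordinal.{0}} {φ : PosOp} {n : ℕ} (h : Val 0 α {.lit (.mem φ n)})
    (hα : Ctl 0 α) (hx : Ctl 0 x) (hlt : Om * α < x) : n ∈ φ.fix ∧ φ.norm n < vartheta x := by
  obtain ⟨D, hD, hr⟩ := h 0 le_rfl Om_pos
  cases hD
  exact ⟨PosOp.mem_fix hr, (PosOp.norm_lt hr).trans (fv_zero_lt_vartheta hx hα hlt)⟩

theorem norm_lt_of_provable_zero {Φ : Set PosOp} (Γ : FmlClass Φ)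
    (hΓ : ∀ {n : ℕ} {σ : LFml Φ (n + 1)}, σ ∈ Γ (n + 1) → ∀ v : Fin n → ℕ,
      (∀ x, (σ.sem (Fin.cons x v)).Ok) ∧ Rect fun x => σ.sem (Fin.cons x v))
    (φ : Φ) (n : ℕ) (h : Provable (thID Φ (piClass Φ 0) Γ) (Fml.pos φ (Term.numeral n))) :
    n ∈ φ.1.fix ∧ φ.1.norm n < vartheta (Om * omegaTower 1) := by
  obtain ⟨d, hd⟩ := target_of_provable NatVal.target (piClass Φ 0) Γ
    (fun n θ hθ v => NatVal.indOk hθ v)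
    (fun n φ σ hσ v u => minOk_of_rect NatVal.target NatVal.min φ.1 σ v u (hΓ hσ v).1 (hΓ hσ v).2)
    φ n h
  exact Val.norm_lt hd (Ctl.of_lt_omegaTower 0 (two_mul_nat_add_one_lt d))
    (ctl_omegaTower 0 1).Om_mul ((mul_lt_mul_iff_right₀ Om_pos).2 (two_mul_nat_add_one_lt d))

/-! ### Prenex formulas -/

/-- Infinitary formulas with at most `k` alternating connectives over admitted literals, the
outermost one being a conjunction (`pi`) or a disjunction (`sigma`). -/
inductive Prenex : Side → ℕ → IFml Lit → Prop
  | lit {s : Side} {k : ℕ} {D : Lit} : D.Ok → Prenex s k (.lit D)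
  | conj {k : ℕ} {f : ℕ → IFml Lit} : (∀ i, Prenex .sigma k (f i)) → Prenex .pi (k + 1) (.conj f)
  | disj {k : ℕ} {f : ℕ → IFml Lit} : (∀ i, Prenex .pi k (f i)) → Prenex .sigma (k + 1) (.disj f)

/-- The immediate subformulas; a literal is its own subformula. -/
def IFml.comp {Λ : Type*} : IFml Λ → ℕ → IFml Λ
  | lit l, _ => lit l
  | conj f, i => f i
  | disj f, i => f i

theorem IFml.comp_neg {Λ : Type*} [InvolutiveNeg Λ] (N : IFml Λ) (i : ℕ) :
    (-N).comp i = -N.comp i := by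
  cases N <;> rfl

namespace Prenex

variable {s : Side} {k : ℕ} {N : IFml Lit}

theorem neg (h : Prenex s k N) : Prenex s.dual k (-N) := by
  induction h with
  | lit h => exact .lit h.neg
  | conj _ ih => exact .disj ih
  | disj _ ih => exact .conj ih

theorem rkLe (h : Prenex s k N) : N.RkLe Lit.Ok k := by
  induction h with
  | lit h => exact h
  | conj _ ih => exact ih
  | disj _ ih => exact ih

theorem succ (h : Prenex s k N) : Prenex s (k + 1) N := by
  induction h with
  | lit h => exact .lit h
  | conj _ ih => exact .conj ih
  | disj _ ih => exact .disj ih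

theorem exists_lit (h : Prenex s 0 N) : ∃ D : Lit, D.Ok ∧ N = .lit D := by
  cases h with
  | lit h => exact ⟨_, h, rfl⟩

theorem comp (h : Prenex s (k + 1) N) (i : ℕ) : Prenex s.dual k (N.comp i) := by
  cases h with
  | lit h => exact .lit h
  | conj h => exact h i
  | disj h => exact h i

end Prenex

theorem Side.dual_dual (s : Side) : s.dual.dual = s := by cases s <;> rfl

/-! ### Calculi with all rules for literals -/

/-- The calculus contains the basic rules, and heights may be increased by the limit `e`. -/
structure BaseSys (S : Calc Lit) (e : Ordinal.{0}) : Prop where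
  base : baseRules ⊆ S.rules
  ok : S.ok = Lit.Ok
  ctl : S.ctl 0 e
  le : ω ≤ e

/-- The formulas `¬X 0, …, ¬X (b - 1)`. -/
def negs (X : ℕ → IFml Lit) (b : ℕ) : Set (IFml Lit) := {A | ∃ x < b, A = -X x}

theorem negs_zero (X : ℕ → IFml Lit) : negs X 0 = ∅ := by simp [negs]

theorem negs_succ (X : ℕ → IFml Lit) (b : ℕ) : negs X (b + 1) = insert (-X b) (negs X b) := by
  ext A
  simp only [negs, Set.mem_ofPred_eq, Set.mem_insert_iff, Nat.lt_succ_iff_lt_or_eq]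
  constructor
  · rintro ⟨x, hx | rfl, rfl⟩
    exacts [.inr ⟨x, hx, rfl⟩, .inl rfl]
  · rintro (rfl | ⟨x, hx, rfl⟩)
    exacts [⟨b, .inr rfl, rfl⟩, ⟨x, .inl hx, rfl⟩]

theorem BaseSys.rkLe {S : Calc Lit} {e : Ordinal.{0}} (hS : BaseSys S e) {N : IFml Lit} {k : ℕ}
    (h : N.RkLe Lit.Ok k) : N.RkLe S.ok k := by
  rwa [hS.ok]

section Finite

variable {S : Calc Lit} {e : Ordinal.{0}} {K k m : ℕ} {Γ : Set (IFml Lit)} {N : IFml Lit}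

theorem Der.lit_ax (hS : BaseSys S e) (Δ : Set Lit)
    (h : ∀ γ δ, γ ≤ δ → δ < Om → ∃ D ∈ Δ, D.rel γ δ) (hΔ : ∀ l ∈ Δ, .lit l ∈ Γ) :
    Der S K 0 (m : ℕ) Γ :=
  (Der.rule (axRule Δ) Empty.elim (S.ctl_nat 0 0) (hS.base (.inl ⟨Δ, h, rfl⟩)) hΔ (fun i => i.elim)
    fun i => i.elim).nat_le (Nat.zero_le m)

theorem Der.lit_truth (hS : BaseSys S e) (D : Lit) (hD : ∀ γ δ, D.rel γ δ) (h : .lit D ∈ Γ) :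
    Der S K 0 (m : ℕ) Γ :=
  lit_ax hS {D} (fun γ δ _ _ => ⟨D, rfl, hD γ δ⟩) (by rintro l rfl; exact h)

theorem Der.lit_em (hS : BaseSys S e) (hN : N.RkLe Lit.Ok k) (hm : 2 * k ≤ m) (h : N ∈ Γ)
    (h' : -N ∈ Γ) : Der S K 0 (m : ℕ) Γ := by
  refine (Der.em (S := S) (fun D Γ _ h h' => ?_) N k (hS.rkLe hN) h h').nat_le hm
  rw [← Nat.cast_zero]
  refine lit_ax hS {D, -D} (fun γ δ hle _ => ?_) ?_
  · rcases D.rel_or_neg hle with hD | hD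
    exacts [⟨D, .inl rfl, hD⟩, ⟨-D, .inr rfl, hD⟩]
  · rintro l (rfl | rfl)
    exacts [h, h']

theorem Der.comp_pi (hN : Prenex .pi k N) (h : N ∈ Γ)
    (hd : ∀ j, Der S K 0 (m : ℕ) (insert (N.comp j) Γ)) : Der S K 0 (m + 1 : ℕ) Γ := by
  cases hN with
  | lit hD =>
    have := hd 0
    rw [IFml.comp, Set.insert_eq_of_mem h] at this
    exact this.nat_le (Nat.le_succ m)
  | conj _ => exact nat_conj h hd

theorem Der.comp_sigma (hN : Prenex .sigma k N) (h : N ∈ Γ) (j : ℕ)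
    (hd : Der S K 0 (m : ℕ) (insert (N.comp j) Γ)) : Der S K 0 (m + 1 : ℕ) Γ := by
  cases hN with
  | lit hD =>
    rw [IFml.comp, Set.insert_eq_of_mem h] at hd
    exact hd.nat_le (Nat.le_succ m)
  | disj _ => exact nat_disj h j hd

theorem Der.pi_comp (hS : BaseSys S e) (hN : Prenex .pi (k + 1) N) (j : ℕ) (hm : 2 * k + 1 ≤ m)
    (h : -N ∈ Γ) (h' : N.comp j ∈ Γ) : Der S K 0 (m : ℕ) Γ := by
  refine (comp_sigma (m := 2 * k) hN.neg h j (lit_em hS (hN.comp j).rkLe le_rfl (.inr h') ?_)).nat_le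
    hm
  rw [IFml.comp_neg]
  exact .inl rfl

/-- The rule for a finite list of conjunctions. -/
theorem Der.comp_negs {X : ℕ → IFml Lit} (hX : ∀ x, Prenex .sigma k (X x)) : ∀ (b : ℕ)
    {Γ : Set (IFml Lit)}, negs X b ⊆ Γ →
    (∀ y : ℕ → ℕ, Der S K 0 (m : ℕ) (negs (fun x => (X x).comp (y x)) b ∪ Γ)) →
    Der S K 0 (m + b : ℕ) Γ
  | 0, Γ, _, hd => by simpa [negs_zero] using hd fun _ => 0
  | b + 1, Γ, hΓ, hd => by
    rw [negs_succ] at hΓ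
    refine comp_pi (hX b).neg (hΓ (.inl rfl)) fun j => comp_negs hX b ?_ fun y => ?_
    · exact ((Set.subset_insert _ _).trans hΓ).trans (Set.subset_insert _ _)
    -- The choice function is extended by the component `j` for the last conjunct.
    · refine (hd fun x => if x < b then y x else j).mono_left ?_
      rw [negs_succ]
      rintro A ((rfl | ⟨x, hx, rfl⟩) | hA)
      · refine .inr (.inl ?_)
        simp [IFml.comp_neg]
      · exact .inl ⟨x, hx, by simp [hx]⟩
      · exact .inr (.inr hA)

/-- Bounded conjunctions of prenex formulas. -/
theorem Prenex.exists_bconj (hS : BaseSys S e) (b : ℕ) : ∀ (k : ℕ) (s : Side), ∃ m : ℕ,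
    ∀ X : ℕ → IFml Lit, (∀ x, Prenex s k (X x)) → ∃ Z, Prenex s k Z ∧
      (∀ x < b, Der S K 0 (m : ℕ) {-Z, X x}) ∧ Der S K 0 (m : ℕ) (insert Z (negs X b))
  | 0, s => by
    refine ⟨0, fun X hX => ?_⟩
    choose D hD e using fun x => (hX x).exists_lit
    let B : Lit := ⟨fun γ δ => ∀ x < b, (D x).rel γ δ,
      fun hγ hδ h x hx => (D x).mono hγ hδ (h x hx)⟩
    refine ⟨.lit B, .lit (EvConst.bforall hD b), ?_, ?_⟩
    · intro x hx
      rw [e x]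
      refine Der.lit_ax hS {-B, D x} (fun γ δ hle _ => ?_) ?_
      · by_cases hr : ∀ x < b, (D x).rel δ γ
        · exact ⟨_, .inr rfl, (D x).mono hle hle (hr x hx)⟩
        · exact ⟨_, .inl rfl, hr⟩
      · rintro l (rfl | rfl)
        exacts [.inl rfl, .inr rfl]
    · refine Der.lit_ax hS (insert B {l | ∃ x < b, l = -D x}) (fun γ δ hle _ => ?_) ?_
      · by_cases hr : ∀ x < b, (D x).rel γ δ
        · exact ⟨_, .inl rfl, hr⟩
        · push Not at hr
          obtain ⟨x, hx, hr⟩ := hr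
          exact ⟨_, .inr ⟨x, hx, rfl⟩, fun h => hr ((D x).mono hle hle h)⟩
      · rintro l (rfl | ⟨x, hx, rfl⟩)
        exacts [.inl rfl, .inr ⟨x, hx, by rw [e x]; rfl⟩]
  | k + 1, .pi => by
    refine ⟨2 * k + 2, fun X hX => ?_⟩
    -- Two conjunctions are contracted by pairing; indices outside the bound are filled with a true
    -- literal.
    let f : ℕ → IFml Lit := fun c =>
      if c.unpair.1 < b then (X c.unpair.1).comp c.unpair.2 else .lit (.const True)
    have hf : ∀ c, Prenex .sigma k (f c) := fun c => by
      by_cases hc : c.unpair.1 < b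
      · simp only [f, if_pos hc]
        exact (hX c.unpair.1).comp c.unpair.2
      · simpa only [f, if_neg hc] using Prenex.lit (D := .const True) (EvConst.const True)
    refine ⟨.conj f, .conj hf, fun x hx => ?_, Der.nat_conj (.inl rfl) fun c => ?_⟩
    · refine Der.comp_pi (hX x) (.inr rfl) fun j => Der.nat_disj (.inr (.inl rfl)) (Nat.pair x j) ?_
      refine Der.lit_em hS ((hX x).comp j).rkLe le_rfl (.inr (.inl rfl)) (.inl ?_)
      exact congrArg Neg.neg (by simp [f, hx])
    · by_cases hc : c.unpair.1 < b
      · refine Der.pi_comp hS (hX c.unpair.1) c.unpair.2 le_rfl (.inr (.inr ⟨_, hc, rfl⟩)) (.inl ?_)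
        simp [f, hc]
      · refine Der.lit_truth hS (.const True) (fun _ _ => trivial) (.inl ?_)
        simp [f, hc]
  | k + 1, .sigma => by
    obtain ⟨m, hm⟩ := exists_bconj hS b k .pi
    -- The height grows with the bound b, which depends on the assignment. No single finite number
    -- covers all instances, so the target must absorb finite addends.
    refine ⟨m + 2 + b, fun X hX => ?_⟩
    -- Collection: a witness for each x < b is coded into one number, which moves the disjunction in
    -- front of the bounded conjunction.
    obtain ⟨dec, hdec⟩ : ∃ dec : ℕ → ℕ → ℕ, ∀ y : ℕ → ℕ, ∃ c, ∀ x < b, dec c x = y x := by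
      refine ⟨fun c x => ((Denumerable.ofNat (List ℕ) c)[x]?).getD 0, fun y =>
        ⟨Encodable.encode ((List.range b).map y), fun x hx => ?_⟩⟩
      simp [hx]
    choose Z hZ hZX hXZ using fun c => hm (fun x => (X x).comp (dec c x)) fun x =>
      (hX x).comp (dec c x)
    refine ⟨.disj Z, .disj hZ, fun x hx => ?_, ?_⟩
    · refine (Der.nat_conj (.inl rfl) fun c => Der.comp_sigma (hX x) (.inr (.inr rfl)) (dec c x)
        ((hZX c x hx).mono_left ?_)).nat_le (Nat.le_add_right _ _)
      rintro A (rfl | rfl)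
      exacts [.inr (.inl rfl), .inl rfl]
    · refine Der.comp_negs hX b (Set.subset_insert _ _) fun y => ?_
      obtain ⟨c, hc⟩ := hdec y
      refine (Der.nat_disj (.inr (.inl rfl)) c ((hXZ c).mono_left ?_)).nat_le (Nat.le_succ _)
      rintro A (rfl | ⟨x, hx, rfl⟩)
      · exact .inl rfl
      · exact .inr (.inl ⟨x, hx, by simp only [hc x hx]⟩)

end Finite

/-! ### The target system given by a calculus -/

/-- Derivability with height `e * d`. -/
def LimDer (S : Calc Lit) (K : ℕ) (e : Ordinal.{0}) (d : ℕ) (Γ : Set (IFml Lit)) : Prop :=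
  Der S K 0 (e * d) Γ

/-- Derivability with height `e * d + m` for some `m`. -/
def NearDer (S : Calc Lit) (K : ℕ) (e : Ordinal.{0}) (d : ℕ) (Γ : Set (IFml Lit)) : Prop :=
  ∃ m : ℕ, Der S K 0 (e * d + m) Γ

section Near

variable {S : Calc Lit} {e : Ordinal.{0}} {K k d : ℕ} {Γ Γ' : Set (IFml Lit)} {N : IFml Lit}

theorem BaseSys.ctl_mul (hS : BaseSys S e) : ∀ d : ℕ, S.ctl 0 (e * d)
  | 0 => by simpa using S.ctl_nat 0 0
  | d + 1 => by
    rw [Nat.cast_add_one, mul_add, mul_one]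
    exact S.ctl_add (hS.ctl_mul d) hS.ctl

theorem BaseSys.ctl_mul_add (hS : BaseSys S e) (d m : ℕ) : S.ctl 0 (e * d + m) :=
  S.ctl_add (hS.ctl_mul d) (S.ctl_nat 0 m)

theorem LimDer.near (h : LimDer S K e d Γ) : NearDer S K e d Γ :=
  ⟨0, by rwa [Nat.cast_zero, add_zero]⟩

theorem LimDer.mono (h : LimDer S K e d Γ) (hΓ : Γ ⊆ Γ') : LimDer S K e d Γ' := h.mono_left hΓ

theorem Der.mul_add_of_nat (hS : BaseSys S e) {m : ℕ} (h : Der S K 0 (m : ℕ) Γ) (d : ℕ) :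
    Der S K 0 (e * d + m) Γ :=
  h.mono_height le_add_self (hS.ctl_mul_add d m)

theorem NearDer.of_nat (hS : BaseSys S e) {m : ℕ} (h : Der S K 0 (m : ℕ) Γ) (d : ℕ) :
    NearDer S K e d Γ :=
  ⟨m, h.mul_add_of_nat hS d⟩

theorem NearDer.mono (h : NearDer S K e d Γ) (hΓ : Γ ⊆ Γ') : NearDer S K e d Γ' := by
  obtain ⟨m, h⟩ := h
  exact ⟨m, h.mono_left hΓ⟩

theorem NearDer.lim (hS : BaseSys S e) (h : NearDer S K e d Γ) : LimDer S K e (d + 1) Γ := by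
  obtain ⟨m, h⟩ := h
  refine h.mono_height ?_ (hS.ctl_mul (d + 1))
  rw [Nat.cast_add_one, mul_add, mul_one]
  gcongr
  exact (natCast_lt_omega0 m).le.trans hS.le

theorem Der.mul_add_cut (hS : BaseSys S e) {m m' : ℕ} (hN : N.RkLe Lit.Ok K)
    (h : Der S K 0 (e * d + m) (insert N Γ)) (h' : Der S K 0 (e * d + m') (insert (-N) Γ)) :
    Der S K 0 (e * d + (max m m' + 1 : ℕ)) Γ :=
  .cut N _ _ (hS.ctl_mul_add _ _) (hS.rkLe hN)
    (by gcongr; exact Nat.lt_succ_of_le (le_max_left _ _))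
    (by gcongr; exact Nat.lt_succ_of_le (le_max_right _ _)) h h'

theorem NearDer.cut (hS : BaseSys S e) (hN : N.RkLe Lit.Ok K) (h : NearDer S K e d (insert N Γ))
    (h' : NearDer S K e d (insert (-N) Γ)) : NearDer S K e d Γ := by
  obtain ⟨m, h⟩ := h
  obtain ⟨m', h'⟩ := h'
  exact ⟨_, h.mul_add_cut hS hN h'⟩

theorem NearDer.cut_negs (hS : BaseSys S e) {X : ℕ → IFml Lit} (hX : ∀ x, (X x).RkLe Lit.Ok K) :
    ∀ b : ℕ, (∀ x < b, NearDer S K e d (insert (X x) Γ)) → NearDer S K e d (negs X b ∪ Γ) →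
      NearDer S K e d Γ
  | 0, _, h' => by simpa [negs_zero] using h'
  | b + 1, h, h' => by
    refine cut_negs hS hX b (fun x hx => h x (hx.trans (Nat.lt_succ_self b))) ?_
    refine NearDer.cut hS (hX b) ((h b (Nat.lt_succ_self b)).mono
      (Set.insert_subset_insert Set.subset_union_right)) ?_
    rwa [negs_succ, Set.insert_union] at h'

theorem NearDer.rule (hS : BaseSys S e) {ρ : InfRule Lit} (hρ : ρ ∈ S.rules) (h0 : ρ.par = 0)
    (hp : ∀ l ∈ ρ.prin, IFml.lit l ∈ Γ) (h : ∀ i, LimDer S K e d (ρ.prem i ∪ Γ)) :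
    NearDer S K e d Γ := by
  refine ⟨1, .rule ρ (fun _ => e * d) (hS.ctl_mul_add _ _) hρ hp (fun _ => by simp) fun i => ?_⟩
  rw [h0, max_self]
  exact h i

/-- One step of the outer derivation costs a full summand e ≥ ω, so any finite number of auxiliary
inferences is free. -/
theorem LimDer.target (hS : BaseSys S e) (K : ℕ) : Target K (LimDer S K e) (NearDer S K e) where
  succ h := h.near.lim hS
  toV h := h.lim hS
  cut N hN h h' := (NearDer.cut hS hN h.near h'.near).lim hS
  em N hN h h' := (NearDer.of_nat hS (Der.lit_em hS hN le_rfl h h') _).lim hS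
  truth D hD h := (NearDer.of_nat hS (Der.lit_truth (m := 0) hS D hD h) _).lim hS
  sem D E hD h hE := by
    refine NearDer.rule (ρ := semRule D E) hS
      (hS.base (.inr (.inl ⟨D, E, fun γ δ _ _ => hD γ δ, rfl⟩))) rfl ?_ hE
    rintro l rfl
    exact h
  clos φ n h hd := by
    refine NearDer.lim hS (NearDer.rule (ρ := closRule φ n) hS
      (hS.base (.inr (.inr ⟨φ, n, rfl⟩))) rfl ?_ fun _ => hd)
    rintro l rfl
    exact h

/-! ### Prenex representations -/

/-- Replacing a representing formula by one that it implies. -/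
theorem Rep.of_imp (hS : BaseSys S e) {X : IFml (IFml Lit)} (hX : ∀ M, X ≠ .lit M)
    {N' : IFml Lit} (hN : N.RkLe Lit.Ok K) {m : ℕ} (h : Der S K 0 (m : ℕ) {-N, N'})
    (hR : Rep (LimDer S K e) (NearDer S K e) X N) :
    Rep (LimDer S K e) (NearDer S K e) X N' := by
  have key : ∀ {d Γ}, N' ∈ Γ → NearDer S K e d (insert N Γ) → NearDer S K e d Γ := by
    intro d Γ hΓ hd
    refine hd.cut hS hN (NearDer.of_nat hS (h.mono_left ?_) d)
    rintro A (rfl | rfl)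
    exacts [.inl rfl, .inr hΓ]
  cases X with
  | lit M => exact (hX M rfl).elim
  | conj f =>
    obtain ⟨g, hg, hr⟩ := hR
    exact ⟨g, hg, fun d Γ hΓ hd => key hΓ (hr d _ (.inl rfl) fun x =>
      (hd x).mono (Set.insert_subset_insert (Set.subset_insert _ _)))⟩
  | disj f =>
    obtain ⟨g, hg, hr⟩ := hR
    exact ⟨g, hg, fun d Γ x hΓ hd => key hΓ (hr d _ x (.inl rfl)
      (hd.mono (Set.insert_subset_insert (Set.subset_insert _ _))))⟩

/-- Representation of a conjunction that amounts to a bounded one. -/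
theorem rep_bconj (hS : BaseSys S e) {s : Side} (hk : k ≤ K) {X : ℕ → IFml (IFml Lit)}
    {N Y : ℕ → IFml Lit} (hN : ∀ x, Prenex s k (N x))
    (hR : ∀ x, Rep2 (LimDer S K e) (NearDer S K e) (X x) (Y x)) (b : ℕ)
    (hb : ∀ x < b, ∃ y, Y y = N x)
    (hY : ∀ y, (∃ x < b, Y y = N x) ∨ Y y = .lit (.const True)) :
    ∃ Z, Prenex s k Z ∧ Rep2 (LimDer S K e) (NearDer S K e) (.conj X) Z := by
  obtain ⟨m, hm⟩ := Prenex.exists_bconj (K := K) hS b k s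
  obtain ⟨Z, hZ, hZN, hNZ⟩ := hm N hN
  have hrk : ∀ x, (N x).RkLe Lit.Ok K := fun x => (hN x).rkLe.mono hk
  refine ⟨Z, hZ, ⟨Y, fun x => (hR x).1, fun d Γ hΓ hd => ?_⟩,
    ⟨fun x => -Y x, fun x => (hR x).2, fun d Γ y hΓ hd => ?_⟩⟩
  · refine NearDer.cut_negs hS hrk b (fun x hx => ?_) (NearDer.of_nat hS (hNZ.mono_left ?_) d)
    · obtain ⟨y, hy⟩ := hb x hx
      rw [← hy]
      exact (hd y).near
    · rintro A (rfl | hA)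
      exacts [.inr hΓ, .inl hA]
  · rcases hY y with ⟨x, hx, hy⟩ | hy
    · simp only [hy] at hd
      refine NearDer.cut hS (hrk x) (NearDer.of_nat hS ((hZN x hx).mono_left ?_) d) hd.near
      rintro A (rfl | rfl)
      exacts [.inr hΓ, .inl rfl]
    · simp only [hy] at hd
      exact NearDer.cut hS (N := .lit (.const True)) (EvConst.const True)
        (NearDer.of_nat hS (Der.lit_truth (m := 0) hS _ (fun _ _ => trivial) (.inl rfl)) d) hd.near

theorem rep_and (hS : BaseSys S e) {s : Side} (hk : k ≤ K) {X X' : IFml (IFml Lit)}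
    {N' : IFml Lit} (hN : Prenex s k N) (hN' : Prenex s k N')
    (hR : Rep2 (LimDer S K e) (NearDer S K e) X N)
    (hR' : Rep2 (LimDer S K e) (NearDer S K e) X' N') :
    ∃ Z, Prenex s k Z ∧ Rep2 (LimDer S K e) (NearDer S K e) (.conj (IFml.two X X')) Z := by
  refine rep_bconj hS hk (N := IFml.two N N') (Y := IFml.two N N') (fun x => ?_) (fun x => ?_) 2
    (fun x _ => ⟨x, rfl⟩) fun y => .inl ?_
  · cases x <;> assumption
  · cases x <;> assumption
  · cases y
    exacts [⟨0, Nat.zero_lt_two, rfl⟩, ⟨1, Nat.one_lt_two, rfl⟩]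

theorem rep_ball (hS : BaseSys S e) {s : Side} (hk : k ≤ K) {X : ℕ → IFml (IFml Lit)}
    {N : ℕ → IFml Lit} (hN : ∀ x, Prenex s k (N x))
    (hR : ∀ x, Rep2 (LimDer S K e) (NearDer S K e) (X x) (N x)) (b : ℕ) :
    ∃ Z, Prenex s k Z ∧ Rep2 (LimDer S K e) (NearDer S K e)
      (.conj fun x => .disj (IFml.two (.atom (-.const (x < b))) (X x))) Z := by
  -- For x ≥ b the instance is true through its guard and is named by a true literal; only the
  -- instances below b remain.
  refine rep_bconj hS hk hN (Y := fun x => if x < b then N x else .lit (.const True)) (fun x => ?_)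
    b (fun x hx => ⟨x, if_pos hx⟩) fun y => ?_
  · have hok : ∀ p, (IFml.lit (.const p) : IFml Lit).RkLe Lit.Ok K := fun p => EvConst.const p
    refine ⟨⟨IFml.two (.lit (-.const (x < b))) (N x), fun y => ?_, fun d Γ y hΓ hd => ?_⟩,
      ⟨IFml.two (.lit (.const (x < b))) (-N x), fun y => ?_, fun d Γ hΓ hd => ?_⟩⟩
    · cases y
      exacts [rfl, (hR x).1]
    · by_cases hx : x < b
      · rw [if_pos hx] at hΓ
        cases y
        · exact NearDer.cut hS (hok (x < b)) (NearDer.of_nat hS (Der.lit_truth (m := 0) hS _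
            (fun _ _ => hx) (.inl rfl)) d) hd.near
        · rw [IFml.two, Set.insert_eq_of_mem hΓ] at hd
          exact hd.near
      · rw [if_neg hx] at hΓ
        exact NearDer.of_nat hS (Der.lit_truth (m := 0) hS _ (fun _ _ => trivial) hΓ) d
    · cases y
      · exact congrArg IFml.lit (neg_neg (Lit.const (x < b)))
      · exact (hR x).2
    · by_cases hx : x < b
      · rw [if_pos hx] at hΓ
        have := hd 1
        rw [IFml.two, Set.insert_eq_of_mem hΓ] at this
        exact this.near
      · exact NearDer.cut hS (hok (x < b)) (hd 0).near (NearDer.of_nat hS (Der.lit_truth (m := 0)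
          hS (-.const (x < b)) (fun _ _ => hx) (.inl rfl)) d)
  · by_cases hy : y < b
    exacts [.inl ⟨y, hy, if_pos hy⟩, .inr (if_neg hy)]

/-- Contraction of two conjunctions. -/
theorem rep_all (hS : BaseSys S e) (hk : k + 1 ≤ K) {X : ℕ → IFml (IFml Lit)}
    {N : ℕ → IFml Lit} (hN : ∀ x, Prenex .pi (k + 1) (N x))
    (hR : ∀ x, Rep2 (LimDer S K e) (NearDer S K e) (X x) (N x)) :
    ∃ Z, Prenex .pi (k + 1) Z ∧ Rep2 (LimDer S K e) (NearDer S K e) (.conj X) Z := by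
  have hrk : ∀ x, (N x).RkLe Lit.Ok K := fun x => (hN x).rkLe.mono hk
  -- Here infinitely many instances are combined, so the auxiliary heights must have a common bound;
  -- contraction by pairing gives 2k+1 for all of them.
  refine ⟨.conj fun c => (N c.unpair.1).comp c.unpair.2, .conj fun c => (hN _).comp _,
    ⟨N, fun x => (hR x).1, fun d Γ hΓ hd => ?_⟩,
    ⟨fun x => -N x, fun x => (hR x).2, fun d Γ x hΓ hd => ?_⟩⟩
  · refine ⟨_, .conj _ (fun _ => e * d + (max 0 (2 * k + 1) + 1 : ℕ)) (hS.ctl_mul_add d (2 * k + 3))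
      hΓ (fun _ => by gcongr; omega) fun c => ?_⟩
    refine Der.mul_add_cut hS (hrk c.unpair.1) (m := 0) ?_ (m' := 2 * k + 1) ?_
    · rw [Nat.cast_zero, add_zero]
      exact (hd c.unpair.1).mono (Set.insert_subset_insert (Set.subset_insert _ _))
    · exact (Der.pi_comp hS (hN c.unpair.1) c.unpair.2 le_rfl (.inl rfl)
        (.inr (.inl rfl))).mul_add_of_nat hS d
  · refine NearDer.cut hS (hrk x) (NearDer.of_nat hS (Der.comp_pi (hN x) (.inl rfl) fun j =>
      Der.nat_disj (.inr (.inr hΓ)) (Nat.pair x j) (Der.lit_em hS ((hN x).comp j).rkLe le_rfl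
        (.inr (.inl rfl)) (.inl ?_))) d) hd.near
    exact congrArg Neg.neg (by simp)

theorem Rep2.of_neg {V W : ℕ → Set (IFml Lit) → Prop} {s : Side} {X : IFml (IFml Lit)}
    (h : ∃ Z, Prenex s.dual k Z ∧ Rep2 V W (-X) Z) : ∃ Z, Prenex s k Z ∧ Rep2 V W X Z := by
  obtain ⟨Z, hZ, hR⟩ := h
  exact ⟨-Z, by simpa [Side.dual_dual] using hZ.neg, by simpa using hR.neg⟩

variable {Φ : Set PosOp}

theorem Fml.IsLiteral.sem_ok {n : ℕ} {A : Fml Φ n} (h : A.IsLiteral) (v : Fin n → ℕ) :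
    (A.sem v).Ok := by
  have := A.tr_literal (k := 0) (q := 0) h v
  cases A <;> first | exact this | exact h.elim

theorem Fml.tr_ne_lit {n : ℕ} {A : Fml Φ n} (h : ¬ A.IsLiteral) (v : Fin n → ℕ) (M : IFml Lit) :
    A.tr v ≠ .lit M := by
  cases A <;> first | exact (h trivial).elim | (intro h; cases h)

/-- A dummy connective in front changes the side of the hierarchy. Literals are treated separately
because an outer literal is represented by itself only. -/
theorem rep_dual (hS : BaseSys S e) (hk : k ≤ K) {s : Side} {n : ℕ} {A : Fml Φ n}
    {v : Fin n → ℕ} (hN : Prenex s k N)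
    (hR : Rep2 (LimDer S K e) (NearDer S K e) (A.tr v) N) :
    ∃ Z, Prenex s.dual (k + 1) Z ∧ Rep2 (LimDer S K e) (NearDer S K e) (A.tr v) Z := by
  by_cases hA : A.IsLiteral
  · exact ⟨_, .lit (hA.sem_ok v), A.rep2_sem (LimDer.target hS K) v⟩
  have hX := Fml.tr_ne_lit hA v
  have hX' : ∀ M, -A.tr v ≠ .lit M := fun M h => hX (-M) (by rw [← neg_neg (A.tr v), h]; rfl)
  have hrk := hN.rkLe.mono hk
  have hrk' : (-N).RkLe Lit.Ok K := hN.neg.rkLe.mono hk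
  cases s with
  | sigma =>
    refine ⟨.conj fun _ => N, .conj fun _ => hN,
      Rep.of_imp hS hX hrk (Der.nat_conj (.inr rfl) fun _ =>
        Der.lit_em hS hN.rkLe le_rfl (.inl rfl) (.inr (.inl rfl))) hR.1,
      Rep.of_imp hS hX' hrk' (Der.nat_disj (.inr rfl) 0
        (Der.lit_em hS hN.neg.rkLe le_rfl (.inl rfl) (.inr (.inl rfl)))) hR.2⟩
  | pi =>
    refine ⟨.disj fun _ => N, .disj fun _ => hN,
      Rep.of_imp hS hX hrk (Der.nat_disj (.inr rfl) 0
        (Der.lit_em hS hN.rkLe le_rfl (.inl rfl) (.inr (.inl rfl)))) hR.1,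
      Rep.of_imp hS hX' hrk' (Der.nat_conj (.inr rfl) fun _ =>
        Der.lit_em hS hN.neg.rkLe le_rfl (.inl rfl) (.inr (.inl rfl))) hR.2⟩

theorem Fml.tr_ball {n : ℕ} (t : Term n) (A : Fml Φ (n + 1)) (v : Fin n → ℕ) :
    (ball t A).tr v = .conj fun x => .disj (IFml.two (.atom (-.const (x < t.val v)))
      (A.tr (Fin.cons x v))) := by
  simp [ball, tr, Term.val_shift, Term.val]

theorem Fml.tr_bex {n : ℕ} (t : Term n) (A : Fml Φ (n + 1)) (v : Fin n → ℕ) :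
    (bex t A).tr v = .disj fun x => .conj (IFml.two (.atom (.const (x < t.val v)))
      (A.tr (Fin.cons x v))) := by
  simp [bex, tr, Term.val_shift, Term.val]

/-- Formulas of the hierarchy have prenex representations. -/
theorem Hier.exists_rep (hS : BaseSys S e) {s : Side} {n : ℕ} {A : Fml Φ n} (h : Hier s k A) :
    k ≤ K → ∀ v, ∃ N, Prenex s k N ∧ Rep2 (LimDer S K e) (NearDer S K e) (A.tr v) N := by
  induction h with
  | positive s hA =>
    exact fun _ v => ⟨_, .lit (Fml.Positive.sem_ok hA v), Fml.rep2_sem (LimDer.target hS K) _ v⟩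
  | @step s s' k n A _ ih =>
    intro hk v
    obtain ⟨N, hN, hR⟩ := ih (Nat.le_of_succ_le hk) v
    by_cases hs : s' = s
    · subst hs
      exact ⟨N, hN.succ, hR⟩
    · obtain rfl : s' = s.dual := by cases s <;> cases s' <;> simp_all [Side.dual]
      exact rep_dual hS (Nat.le_of_succ_le hk) hN hR
  | not _ ih =>
    intro hk v
    obtain ⟨N, hN, hR⟩ := ih hk v
    rw [Fml.tr_not]
    exact ⟨_, hN.neg, hR.neg⟩
  | and _ _ ihA ihB =>
    intro hk v
    obtain ⟨N, hN, hR⟩ := ihA hk v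
    obtain ⟨N', hN', hR'⟩ := ihB hk v
    exact rep_and hS hk hN hN' hR hR'
  | or _ _ ihA ihB =>
    intro hk v
    obtain ⟨N, hN, hR⟩ := ihA hk v
    obtain ⟨N', hN', hR'⟩ := ihB hk v
    refine Rep2.of_neg ?_
    have := rep_and hS hk hN.neg hN'.neg hR.neg hR'.neg
    rwa [← IFml.two_map] at this
  | ball t _ ih =>
    intro hk v
    choose N hN hR using fun x : ℕ => ih hk (Fin.cons x v)
    rw [Fml.tr_ball]
    exact rep_ball hS hk hN hR _
  | bex t _ ih =>
    intro hk v
    choose N hN hR using fun x : ℕ => ih hk (Fin.cons x v)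
    refine Rep2.of_neg ?_
    have := rep_ball hS hk (fun x => (hN x).neg) (fun x => (hR x).neg) (t.val v)
    simp only [Fml.tr_bex, IFml.neg_disj, IFml.neg_conj, IFml.two_map]
    exact this
  | all _ ih =>
    intro hk v
    choose N hN hR using fun x : ℕ => ih hk (Fin.cons x v)
    exact rep_all hS hk hN hR
  | ex _ ih =>
    intro hk v
    choose N hN hR using fun x : ℕ => ih hk (Fin.cons x v)
    exact Rep2.of_neg (rep_all hS hk (fun x => (hN x).neg) fun x => (hR x).neg)

/-- With infinite rules induction becomes m successive cuts on the representing formulas, whose rank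
is at most K. The number of cuts depends on m, but all of them fit below the next multiple of e. -/
theorem LimDer.indOk (hS : BaseSys S e) {n : ℕ} {θ : LFml Φ (n + 1)} (h : Hier .pi K θ)
    (v : Fin n → ℕ) : IndOk K (LimDer S K e) (NearDer S K e) fun x => θ.tr (Fin.cons x v) := by
  choose N hN hR using fun x : ℕ => h.exists_rep (K := K) hS le_rfl (Fin.cons x v)
  refine ⟨N, fun x => (hN x).rkLe, hR, fun d Γ m hm h0 hs => NearDer.lim hS ?_⟩
  have main : ∀ j, NearDer S K e d (insert (N j) Γ) := by
    intro j
    induction j with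
    | zero => exact h0.near
    | succ j ih =>
      exact NearDer.cut hS (hN j).rkLe
        (ih.mono (Set.insert_subset_insert (Set.subset_insert _ _))) (hs j).near
  have := main m
  rwa [Set.insert_eq_of_mem hm] at this

end Near

/-! ### Unbounded induction over simple minimality -/

theorem weakCalc_base : BaseSys weakCalc ω := ⟨fun _ h => .inl h, rfl, trivial, le_rfl⟩

theorem LimDer.min {K d : ℕ} {Γ : Set (IFml Lit)} {φ : PosOp} {σ : ℕ → Lit} {u : ℕ}
    (hσ : Rect σ) (h : .lit (-.mem φ u) ∈ Γ) (h' : .lit (σ u) ∈ Γ)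
    (hd : ∀ x, LimDer weakCalc K ω d (insert (.lit (-.opr φ σ x)) (insert (.lit (σ x)) Γ))) :
    LimDer weakCalc K ω (d + 1) Γ := by
  refine NearDer.lim weakCalc_base (NearDer.rule (ρ := minRule φ σ u) weakCalc_base
    (.inr (.inl ⟨φ, σ, u, hσ, rfl⟩)) rfl ?_ fun x => ?_)
  · rintro l (rfl | rfl)
    exacts [h, h']
  · have := hd x
    rwa [← Set.singleton_union (a := IFml.lit (σ x)), ← Set.insert_union] at this

theorem two_lt_omega0 : (2 : Ordinal.{0}) < ω := by exact_mod_cast natCast_lt_omega0 2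

/-- Each step raises the height from α to 2^α ≤ ω^α, that is, one level up in the tower. -/
theorem Der.weak_cutElim : ∀ {r j : ℕ} {α : Ordinal.{0}} {Γ : Set (IFml Lit)},
    Der weakCalc r 0 α Γ → α < omegaTower j →
      ∃ α' < omegaTower (j + r), Der weakCalc 0 0 α' Γ
  | 0, _, α, _, h, hα => ⟨α, hα, h⟩
  | r + 1, j, α, _, h, hα => by
    have := h.cutElim (fun a => 2 ^ a) (isNormal_opow one_lt_two).strictMono two_opow_add_le
      fun _ => trivial
    obtain ⟨α', hα', h'⟩ := weak_cutElim (j := j + 1) this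
      ((opow_le_opow_left α two_lt_omega0.le).trans_lt (by
        rw [omegaTower]
        exact (opow_lt_opow_iff_right one_lt_omega0).2 hα))
    exact ⟨α', by rwa [Nat.add_right_comm, add_assoc] at hα', h'⟩

theorem two_mul_add_one_lt_omegaTower {j : ℕ} {α : Ordinal.{0}} (h : α < omegaTower (j + 2)) :
    2 * α + 1 < omegaTower (j + 2) := by
  have h0 : (2 : Ordinal.{0}) < omegaTower (j + 2) := by
    refine lt_of_lt_of_le two_lt_omega0 (left_le_opow ω ?_)
    exact opow_pos _ omega0_pos
  have h1 := isPrincipal_mul_omega0_opow_opow (omegaTower j) h0 h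
  exact isPrincipal_add_omega0_opow (omegaTower (j + 1)) h1 (one_lt_two.trans h0)

theorem norm_lt_of_provable_succ {Φ : Set PosOp} (k : ℕ) (Γ : FmlClass Φ)
    (hΓ : ∀ {n : ℕ} {σ : LFml Φ (n + 1)}, σ ∈ Γ (n + 1) → ∀ v : Fin n → ℕ,
      (∀ x, (σ.sem (Fin.cons x v)).Ok) ∧ Rect fun x => σ.sem (Fin.cons x v))
    (φ : Φ) (n : ℕ) (h : Provable (thID Φ (piClass Φ (k + 1)) Γ) (Fml.pos φ (Term.numeral n))) :
    n ∈ φ.1.fix ∧ φ.1.norm n < vartheta (Om * omegaTower (k + 2)) := by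
  obtain ⟨d, hd⟩ := target_of_provable (LimDer.target weakCalc_base (k + 1)) (piClass Φ (k + 1)) Γ
    (fun n θ hθ v => LimDer.indOk weakCalc_base hθ v)
    (fun n φ σ hσ v u => minOk_of_rect (LimDer.target weakCalc_base (k + 1)) LimDer.min φ.1 σ v u
      (hΓ hσ v).1 (hΓ hσ v).2) φ n h
  have := Der.cutElim (fun a => 2 ^ a) (isNormal_opow one_lt_two).strictMono two_opow_add_le
    (fun _ => trivial) hd
  -- The first elimination is sharper than the general estimate: 2^(ω·d) = ω^d is below ω^ω, the
  -- tower of index 2, and saves one level.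
  obtain ⟨α, hα, hd'⟩ := Der.weak_cutElim (j := 2) this (by
    rw [opow_mul, opow_omega0 one_lt_two two_lt_omega0, omegaTower, omegaTower, omegaTower,
      opow_one]
    exact (opow_lt_opow_iff_right one_lt_omega0).2 (natCast_lt_omega0 d))
  rw [add_comm] at hα
  have hlt := two_mul_add_one_lt_omegaTower hα
  refine Val.norm_lt (hd'.val_weak ?_ hlt) (Ctl.of_lt_omegaTower 0 hlt)
    (ctl_omegaTower 0 _).Om_mul ((mul_lt_mul_iff_right₀ Om_pos).2 hlt)
  rintro A rfl
  exact ⟨_, rfl⟩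

theorem norm_lt_of_provable {Φ : Set PosOp} (k : ℕ) (Γ : FmlClass Φ)
    (hΓ : ∀ {n : ℕ} {σ : LFml Φ (n + 1)}, σ ∈ Γ (n + 1) → ∀ v : Fin n → ℕ,
      (∀ x, (σ.sem (Fin.cons x v)).Ok) ∧ Rect fun x => σ.sem (Fin.cons x v))
    (φ : Φ) (n : ℕ) (h : Provable (thID Φ (piClass Φ k) Γ) (Fml.pos φ (Term.numeral n))) :
    n ∈ φ.1.fix ∧ φ.1.norm n < vartheta (Om * omegaTower (1 + k)) := by
  rw [add_comm]
  cases k with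
  | zero => exact norm_lt_of_provable_zero Γ hΓ φ n h
  | succ k => exact norm_lt_of_provable_succ k Γ hΓ φ n h

/-! ### Accessibility operators -/

theorem Fml.sat_not_ofArith {P : Type} {I J : P → Set ℕ} : ∀ {n : ℕ} (B : Fml Empty n)
    (v : Fin n → ℕ), (B.ofArith : Fml P n).not.Sat I v → (B.ofArith : Fml P n).not.Sat J v
  | _, eq _ _, _, h => h
  | _, neq _ _, _, h => h
  | _, lt _ _, _, h => h
  | _, nlt _ _, _, h => h
  | _, pos p _, _, _ => p.elim
  | _, neg p _, _, _ => p.elim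
  | _, and A B, v, h => h.imp (sat_not_ofArith A v) (sat_not_ofArith B v)
  | _, or A B, v, h => ⟨sat_not_ofArith A v h.1, sat_not_ofArith B v h.2⟩
  | _, all A, _, h => h.imp fun _ hx => sat_not_ofArith A _ hx
  | _, ex A, _, h => fun x => sat_not_ofArith A _ (h x)

/-- All that matters about the guard is that it does not depend on X; its boundedness plays no role.
-/
theorem exists_of_mem_accOps {φ : PosOp} (h : φ ∈ accOps) : ∃ (Θ : Fml Unit 2) (t : Term 2),
    Θ.Positive ∧ φ.1 = .all (.or Θ (.pos () t)) ∧
      ∀ {I J : Unit → Set ℕ} {v}, Θ.Sat I v → Θ.Sat J v := by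
  obtain ⟨θ, t, -, e⟩ := h
  have hp := φ.2
  rw [e] at hp
  exact ⟨_, t, hp.1, e, fun h => Fml.sat_not_ofArith θ _ h⟩

section Acc

variable {Φ : Set PosOp}

/-- The condition on `x` and `y` under which the instance for `y` of an accessibility operator is
vacuous. -/
def AccVac (Θ : Fml Unit 2) (x y : ℕ) : Prop := Θ.Sat (fun _ => ∅) (Fin.cons y fun _ => x)

theorem mem_toHom_acc {φ : PosOp} {Θ : Fml Unit 2} {t : Term 2}
    (e : φ.1 = .all (.or Θ (.pos () t)))
    (hΘ : ∀ {I J : Unit → Set ℕ} {v}, Θ.Sat I v → Θ.Sat J v) {X : Set ℕ} {x : ℕ}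
    (h : x ∈ φ.toHom X) (y : ℕ) : AccVac Θ x y ∨ t.val (Fin.cons y fun _ => x) ∈ X := by
  have h' : φ.1.Sat (fun _ => X) (fun _ => x) := h
  rw [e] at h'
  exact (h' y).imp_left hΘ

theorem tr_substPred_acc (Θ : Fml Unit 2) (t : Term 2) {n : ℕ} (σ : LFml Φ (n + 1))
    (v : Fin n → ℕ) (u x : ℕ) :
    ((Fml.all (.or Θ (.pos () t))).substPred (fun _ => Term.var 0) σ.shiftParam.shiftParam).tr
      (Fin.cons x (Fin.cons u v) : Fin (n + 2) → ℕ) =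
    .conj fun y => .disj (IFml.two
      ((Θ.substPred (Term.up fun _ => Term.var 0) σ.shiftParam.shiftParam.shiftParam).tr
        (Fin.cons y (Fin.cons x (Fin.cons u v))))
      (σ.tr (Fin.cons (t.val (Fin.cons y fun _ => x)) v))) := by
  simp only [Fml.substPred, Fml.tr, Fml.tr_inst, Fml.tr_shiftParam, Term.val_subst, Term.val_up]
  rfl

theorem sem_substPred_acc {Θ : Fml Unit 2} (hp : Θ.Positive)
    (hΘ : ∀ {I J : Unit → Set ℕ} {v}, Θ.Sat I v → Θ.Sat J v) {n : ℕ} (σ : LFml Φ (n + 1))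
    (v : Fin n → ℕ) (u x y : ℕ) :
    (Θ.substPred (Term.up fun _ => Term.var 0) σ.shiftParam.shiftParam.shiftParam).sem
      (Fin.cons y (Fin.cons x (Fin.cons u v)) : Fin (n + 3) → ℕ) = .const (AccVac Θ x y) := by
  ext γ δ
  rw [Fml.sem_substPred _ hp, Term.val_up]
  exact ⟨fun h => hΘ h, fun h => hΘ h⟩

end Acc

/-! ### Minimality of accessibility operators for prenex formulas -/

theorem normCalc_base : BaseSys normCalc Om :=
  ⟨fun _ h => .inl h, rfl, ctl_Om 0, omega0_lt_Om.le⟩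

/-- The instances of an accessibility operator for the family `N`. -/
noncomputable def accFml (q : ℕ → Prop) (N : ℕ → IFml Lit) (c : ℕ) : IFml Lit :=
  open Classical in
  if q c.unpair.1 then .lit (.const True) else (N c.unpair.1).comp c.unpair.2

theorem omega0_opow_add_one_lt {η ξ : Ordinal.{0}} (h : η < ξ) : ω ^ η + 1 < ω ^ ξ := by
  have hlt : ω ^ η < ω ^ ξ := (opow_lt_opow_iff_right one_lt_omega0).2 h
  refine isPrincipal_add_omega0_opow ξ hlt (lt_of_le_of_lt ?_ hlt)
  exact Order.one_le_iff_pos.2 (opow_pos _ omega0_pos)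

theorem Der.pi_inversion {S : Calc Lit} {r k : ℕ} {ξ α : Ordinal.{0}} {Γ : Set (IFml Lit)}
    {N : IFml Lit} (h : Der S r ξ α (insert N Γ)) (hN : Prenex .pi k N) (j : ℕ) :
    Der S r ξ α (insert (N.comp j) Γ) := by
  cases hN with
  | lit => exact h
  | conj => exact h.inversion _ j subset_rfl

/-- Recursion on the norm: the elements required by u have smaller norm, so `N` is derived for them
first. Their components give the one-layer formula φ(N,u), and a cut of rank 1 with the premise for
u yields `N u`. The summand ω^ξ leaves room for the intermediate rule and is controlled by the norm.
-/
theorem Der.acc_min {φ : PosOp} {q : ℕ → ℕ → Prop} {t : ℕ → ℕ → ℕ}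
    (hφ : ∀ {X : Set ℕ} {x}, x ∈ φ.toHom X → ∀ y, q x y ∨ t x y ∈ X)
    {N : ℕ → IFml Lit} (hN : ∀ x, Prenex .pi 1 (N x)) {a : Ordinal.{0}} {Γ : Set (IFml Lit)}
    (h : ∀ x, Der normCalc 1 0 a
      (insert (-.conj (accFml (q x) fun y => N (t x y))) (insert (N x) Γ)))
    (ξ : Ordinal.{0}) : ∀ (u : ℕ) (δ : Ordinal.{0}), u ∈ φ.stage δ → φ.norm u = ξ →
      Der normCalc 1 ξ (a + ω ^ ξ + 1) (insert (N u) Γ) := by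
  have ha : Ctl 0 a := (h 0).ctl
  induction ξ using WellFoundedLT.induction with
  | ind ξ ih =>
    intro u δ hu hξ
    have hc : Ctl ξ (a + ω ^ ξ) := (ha.mono zero_le).add (Ctl.of_le le_rfl).exp
    have hpos : (0 : Ordinal.{0}) < ω ^ ξ := opow_pos _ omega0_pos
    have hM : (IFml.conj (accFml (q u) fun y => N (t u y))).RkLe Lit.Ok 1 := by
      intro c
      unfold accFml
      split_ifs
      · exact EvConst.const True
      · exact ((hN _).comp _).rkLe
    have hcomp : ∀ c, ∃ b < a + ω ^ ξ, Der normCalc 1 ξ b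
        (insert (accFml (q u) (fun y => N (t u y)) c)
          (insert (.conj (accFml (q u) fun y => N (t u y))) (insert (N u) Γ))) := by
      intro c
      unfold accFml
      split_ifs with hq
      · refine ⟨(0 : ℕ), ?_, (Der.lit_truth (m := 0) normCalc_base (.const True)
          (fun _ _ => trivial) (.inl rfl)).weaken zero_le le_rfl (Ctl.nat _ _) subset_rfl⟩
        rw [Nat.cast_zero]
        exact hpos.trans_le le_add_self
      -- At its norm u satisfies φ, so the non-vacuous instance requires an element of an earlier
      -- stage, which has smaller norm.
      · have hw := (hφ (PosOp.mem_norm hu) c.unpair.1).resolve_left hq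
        have hη : φ.norm (t u c.unpair.1) < ξ := hξ ▸ PosOp.norm_lt hw
        have hd := ih _ hη _ _ hw rfl
        refine ⟨_, ?_, Der.weaken (α := a + ω ^ φ.norm (t u c.unpair.1) + 1) ?_ hη.le le_rfl
          (Ctl.mono hη.le hd.ctl)
          (Set.insert_subset_insert ((Set.subset_insert _ _).trans (Set.subset_insert _ _)))⟩
        · rw [add_assoc]
          gcongr
          exact omega0_opow_add_one_lt hη
        · exact hd.pi_inversion (hN _) c.unpair.2
    choose b hb hd using hcomp
    refine .cut (.conj (accFml (q u) fun y => N (t u y))) (a + ω ^ ξ) a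
      (Ctl.add hc (Ctl.one ξ)) hM (lt_add_one _) ?_ ?_ ?_
    · exact le_self_add.trans_lt (lt_add_one _)
    · exact .conj _ b hc (.inl rfl) hb hd
    · exact (h u).weaken zero_le le_rfl (ha.mono zero_le) subset_rfl

/-- The norm rule supplies |u| as a parameter and thereby controls ω^|u|. As |u| is countable, the
resulting height stays below Ω·(d+1), which explains the choice of Ω as limit. -/
theorem LimDer.acc_min {φ : PosOp} {q : ℕ → ℕ → Prop} {t : ℕ → ℕ → ℕ}
    (hφ : ∀ {X : Set ℕ} {x}, x ∈ φ.toHom X → ∀ y, q x y ∨ t x y ∈ X)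
    {N : ℕ → IFml Lit} (hN : ∀ x, Prenex .pi 1 (N x)) {d : ℕ} {Γ : Set (IFml Lit)} {u : ℕ}
    (hu : .lit (-.mem φ u) ∈ Γ) (hNu : N u ∈ Γ)
    (h : ∀ x, LimDer normCalc 1 Om d
      (insert (-.conj (accFml (q x) fun y => N (t x y))) (insert (N x) Γ))) :
    LimDer normCalc 1 Om (d + 1) Γ := by
  by_cases hst : ∃ δ < Om, u ∈ φ.stage δ
  · obtain ⟨δ, hδ, hst⟩ := hst
    have hd := Der.acc_min hφ hN h _ u δ hst rfl
    rw [Set.insert_eq_of_mem hNu] at hd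
    refine .rule (normRule φ u) (fun _ => Om * d + ω ^ φ.norm u + 1)
      (normCalc_base.ctl_mul (d + 1)) (.inr ⟨φ, u, δ, hst, rfl⟩) (by rintro l rfl; exact hu) (fun _ => ?_) fun _ => ?_
    · rw [Nat.cast_add_one, mul_add, mul_one, add_assoc]
      gcongr
      exact add_lt_Om (omega0_opow_lt_Om ((PosOp.norm_lt hst).trans hδ)) one_lt_Om
    · simpa [normRule] using hd
  -- If u is in no countable stage, u ∉ R_φ is an axiom, since validity concerns countable stages
  -- only; the countability of closure ordinals is not needed.
  · refine NearDer.lim normCalc_base (NearDer.of_nat normCalc_base (m := 0) ?_ d)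
    refine Der.lit_ax normCalc_base {-.mem φ u} (fun γ δ hγ hδ => ⟨_, rfl, fun hm => ?_⟩) ?_
    · exact hst ⟨γ, hγ.trans_lt hδ, hm⟩
    · rintro l rfl
      exact hu

/-- An accessibility operator only puts one universal quantifier in front of σ. Contracted with the
leading conjunction of σ, it leaves φ(σ,x) at rank 1. -/
theorem LimDer.minOk {Φ : Set PosOp} {φ : PosOp} (hφ : φ ∈ accOps) {n : ℕ} {σ : LFml Φ (n + 1)}
    (hσ : Hier .pi 1 σ) (v : Fin n → ℕ) (u : ℕ) :
    MinOk 1 (LimDer normCalc 1 Om) (NearDer normCalc 1 Om) φ (fun x => σ.tr (Fin.cons x v))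
      fun x => (φ.1.substPred (fun _ => Term.var 0) σ.shiftParam.shiftParam).tr
        (Fin.cons x (Fin.cons u v)) := by
  obtain ⟨Θ, t, hp, e, hΘ⟩ := exists_of_mem_accOps hφ
  choose N hN hR using fun x : ℕ => hσ.exists_rep (K := 1) normCalc_base le_rfl (Fin.cons x v)
  let s : ℕ → ℕ → ℕ := fun x y => t.val (Fin.cons y fun _ => x)
  refine ⟨N, fun x => .conj (accFml (AccVac Θ x) fun y => N (s x y)), fun x => (hN x).rkLe, hR,
    fun x => ?_, fun d Γ u hu hNu h => LimDer.acc_min (mem_toHom_acc e hΘ) hN hu hNu h⟩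
  have hS := normCalc_base
  have hok : ∀ p, (IFml.lit (.const p) : IFml Lit).RkLe Lit.Ok 1 := fun p => EvConst.const p
  classical
  simp only [e, tr_substPred_acc, IFml.neg_conj, IFml.neg_disj, IFml.two_map]
  refine ⟨fun y => if AccVac Θ x y then .lit (-.const True) else -N (s x y), fun y => ?_,
    fun d Γ y hΓ hd => ?_⟩
  · refine ⟨IFml.two (.lit (-.const (AccVac Θ x y))) (-N (s x y)), fun i => ?_,
      fun d Γ hΓ hd => ?_⟩
    · cases i with
      | zero =>
        have := (Fml.rep2_sem (LimDer.target hS 1) (Θ.substPred (Term.up fun _ => Term.var 0)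
          σ.shiftParam.shiftParam.shiftParam) (Fin.cons y (Fin.cons x (Fin.cons u v)))).2
        rwa [sem_substPred_acc hp hΘ] at this
      | succ i => exact (hR _).2
    · by_cases hq : AccVac Θ x y
      · exact NearDer.cut hS (hok (AccVac Θ x y)) (NearDer.of_nat hS (Der.lit_truth (m := 0) hS _
          (fun _ _ => hq) (.inl rfl)) d) (hd 0).near
      · simp only [if_neg hq] at hΓ
        have := hd 1
        rw [IFml.two, Set.insert_eq_of_mem hΓ] at this
        exact this.near
  · by_cases hq : AccVac Θ x y
    · simp only [if_pos hq] at hd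
      exact NearDer.cut hS (hok True) (NearDer.of_nat hS (Der.lit_truth (m := 0) hS _
        (fun _ _ => trivial) (.inl rfl)) d) hd.near
    · simp only [if_neg hq] at hd
      refine NearDer.cut hS (hN (s x y)).rkLe (NearDer.of_nat hS (Der.comp_pi (hN _) (.inl rfl)
        fun j => Der.nat_disj (.inr (.inr hΓ)) (Nat.pair y j) (Der.lit_em hS
          ((hN (s x y)).comp j).rkLe le_rfl (.inr (.inl rfl)) (.inl ?_))) d) hd.near
      exact congrArg Neg.neg (by simp [accFml, hq])

theorem Om_opow_omega0 : Om ^ ω = ω ^ (Om * ω) := by rw [opow_mul, omega0_opow_Om]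

theorem norm_lt_of_provable_acc (φ : accOps) (n : ℕ)
    (h : Provable (thID accOps (piClass accOps 1) (piClass accOps 1))
      (Fml.pos φ (Term.numeral n))) :
    n ∈ φ.1.fix ∧ φ.1.norm n < vartheta (Om ^ ω) := by
  obtain ⟨d, hd⟩ := target_of_provable (LimDer.target normCalc_base 1) (piClass accOps 1)
    (piClass accOps 1) (fun n θ hθ v => LimDer.indOk normCalc_base hθ v)
    (fun n φ σ hσ v u => LimDer.minOk φ.2 hσ v u) φ n h
  -- The base ω is used because the closure defining `Ctl` contains ω^α along with α.
  have hd' := Der.cutElim (fun a => ω ^ a) (isNormal_opow one_lt_omega0).strictMono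
    (fun {a b c} ha hb => (isPrincipal_add_omega0_opow c
      ((opow_lt_opow_iff_right one_lt_omega0).2 ha)
      ((opow_lt_opow_iff_right one_lt_omega0).2 hb)).le) Ctl.exp hd
  have hω : Ctl 0 ω := by simpa [omegaTower] using ctl_omegaTower 0 1
  refine Val.norm_lt (hd'.val_norm ?_) hd'.ctl ?_ ?_
  · rintro A rfl
    exact ⟨_, rfl⟩
  · rw [Om_opow_omega0]
    exact hω.Om_mul.exp
  -- Ω·ω^(Ω·d) = ω^(Ω·(1+d)), whose exponent is below Ω·ω.
  · rw [Om_opow_omega0]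
    nth_rewrite 1 [← omega0_opow_Om]
    rw [← opow_add, opow_lt_opow_iff_right one_lt_omega0]
    calc Om + Om * (d : Ordinal.{0}) = Om * ((1 + d : ℕ) : Ordinal.{0}) := by
          rw [Nat.cast_add, mul_add, Nat.cast_one, mul_one]
      _ < Om * ω := (mul_lt_mul_iff_right₀ Om_pos).2 (natCast_lt_omega0 _)

end WeakID

theorem theorem2p4 :
    (∀ (k : ℕ) (φ : (Set.univ : Set WeakID.PosOp)) (n : ℕ),
      WeakID.Provable
          (WeakID.thID Set.univ (WeakID.piClass Set.univ k) (WeakID.posOrNeg Set.univ))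
          (WeakID.Fml.pos φ (WeakID.Term.numeral n)) →
        n ∈ φ.1.fix ∧
          φ.1.norm n < WeakID.vartheta (WeakID.Om * WeakID.omegaTower (1 + k))) ∧
    (∀ (k : ℕ) (φ : WeakID.accOps) (n : ℕ),
      WeakID.Provable
          (WeakID.thID WeakID.accOps (WeakID.piClass WeakID.accOps k)
            (WeakID.posAndNeg WeakID.accOps))
          (WeakID.Fml.pos φ (WeakID.Term.numeral n)) →
        n ∈ φ.1.fix ∧
          φ.1.norm n < WeakID.vartheta (WeakID.Om * WeakID.omegaTower (1 + k))) ∧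
    (∀ (φ : WeakID.accOps) (n : ℕ),
      WeakID.Provable
          (WeakID.thID WeakID.accOps (WeakID.piClass WeakID.accOps 1)
            (WeakID.piClass WeakID.accOps 1))
          (WeakID.Fml.pos φ (WeakID.Term.numeral n)) →
        n ∈ φ.1.fix ∧
          φ.1.norm n < WeakID.vartheta (WeakID.Om ^ Ordinal.omega0)) := by
  exact ⟨fun k φ n h => WeakID.norm_lt_of_provable k _ WeakID.posOrNeg_rect φ n h,
    fun k φ n h => WeakID.norm_lt_of_provable k _ WeakID.posAndNeg_rect φ n h,
    fun φ n h => WeakID.norm_lt_of_provable_acc φ n h⟩
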